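/- Let $T$ be a complete first-order theory in a language $L$, write $|T|=|L|+\aleph_0$, and assume that $T$ is dependent: there are no formula $\varphi(\bar x,\bar y)$, model of $T$ and finite tuples $\bar a_u$ ($u\subseteq\omega$), $\bar b_n$ ($n<\omega$) in it with $\varphi(\bar a_u,\bar b_n)$ true exactly when $n\in u$. Work inside an infinite $\bar\kappa$-saturated model $\mathfrak C$ of $T$ (the monster); types are computed in $\mathfrak C$, and a model means an elementary submodel $M\prec\mathfrak C$. Definitions. A type $p(\bar x)$ does not split over $B$ if $\varphi(\bar x,\bar b),\neg\varphi(\bar x,\bar c)\in p$ implies $\mathrm{tp}(\bar b,B)\neq\mathrm{tp}(\bar c,B)$. Write $A\le_\kappa C$ ($C$ is $\mathbf F^{\mathrm{nsp}}_\kappa$-constructible over $A$) if $C=A\cup\{a_\beta:\beta<\alpha\}$ for some ordinal $\alpha$ and elements $a_\beta$ such that, for each $\beta<\alpha$, the type of $a_\beta$ over $A_\beta=A\cup\{a_\gamma:\gamma<\beta\}$ does not split over some $B_\beta\subseteq A_\beta$ with $|B_\beta|<\kappa$. The pair $(A,A^+)$ is $\kappa$-reduced if, whenever $A\le_\kappa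 C$, $|C|<\bar\kappa$, and $\bar c$ is a sequence of length $<\kappa$ from $A^+$, the type $\mathrm{tp}(\bar c,A)$ has a unique extension to a complete type over $C$. For a model $M$ and a set $B$, $M_{[B]}$ is the expansion of $M$ by the relations $\{\bar d\in{}^{n}M:\mathfrak C\models\varphi[\bar d,\bar b]\}$ for all $n<\omega$ and all formulas $\varphi(\bar x,\bar b)$ with $n$ free variables and parameters $\bar b$ from $B$. A pair of models $(M,N)$ is $\kappa$-nice if $M\prec N$, $(M,N)$ is $\kappa$-reduced, $M$ and $N$ are $\kappa$-saturated, and $M_{[N]}\prec M^+_{[N]}$ for every model $M^+$ with $|M^+|<\bar\kappa$ and $M\le_\kappa M^+$. Theorem. Let $\kappa>|T|$ be a regular cardinal and let $\lambda<\bar\kappa$ be an infinite cardinal with $\lambda=\lambda^\theta$ for every cardinal $\theta$ with $0<\theta<\kappa$. Let $A\subseteq A^+\subseteq\mathfrak C$ with $|A^+|\le\lambda$. Then there is a model $M$ of cardinality $\lambda$ such that: (A) $A\le_\kappa M$ and $(M,A^+)$ is $\kappa$-reduced; and (B) there is a model $N$ with $|N|<\bar\kappa$ and $A^+\subseteq N$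 such that $(M,N)$ is $\kappa$-nice. -/

import Mathlib

open Cardinal FirstOrder

universe u v w x

namespace DependentThy

open FirstOrder.Language

section Types

variable (L : FirstOrder.Language.{u, v}) {𝔐 : Type w} [L.Structure 𝔐]

/-- `tp(c, A)` computed in `𝔐`, for a tuple `c` indexed by `ι`. A formula with parameters from `A`
in the variables indexed by `ι` is an `L`-formula with free variables in `A ⊕ ι`, where a variable
in `A` is always interpreted by itself. -/
def tp {ι : Type x} (c : ι → 𝔐) (A : Set 𝔐) : Set (L.Formula (A ⊕ ι)) :=
  {φ | φ.Realize (Sum.elim (fun a : A => (a : 𝔐)) c)}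

/-- `p` is a complete type over `A` in the variables indexed by `ι`: a set of formulas with
parameters from `A` that is finitely satisfiable in `𝔐` and contains every formula or its
negation. -/
def IsCompleteType {ι : Type x} (A : Set 𝔐) (p : Set (L.Formula (A ⊕ ι))) : Prop :=
  (∀ s : Finset (L.Formula (A ⊕ ι)), (∀ φ ∈ s, φ ∈ p) →
      ∃ c : ι → 𝔐, ∀ φ ∈ s, φ ∈ tp L c A) ∧
    ∀ φ : L.Formula (A ⊕ ι), φ ∈ p ∨ φ.not ∈ p

/-- The type `q` over `C` extends the type `p` over `A ⊆ C`. -/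
def Extends {ι : Type x} {A C : Set 𝔐} (h : A ⊆ C) (q : Set (L.Formula (C ⊕ ι)))
    (p : Set (L.Formula (A ⊕ ι))) : Prop :=
  ∀ φ ∈ p, φ.relabel (Sum.map (Set.inclusion h) id) ∈ q

/-- `p(x)`, a type over `D`, does not split over `B`: if `φ(x, b)` and `¬φ(x, c)` are in `p`, for
finite tuples `b`, `c` from `D`, then `tp(b, B) ≠ tp(c, B)`. -/
def DoesNotSplit {ι : Type x} {D : Set 𝔐} (p : Set (L.Formula (D ⊕ ι))) (B : Set 𝔐) : Prop :=
  ∀ (k : ℕ) (φ : L.Formula (Fin k ⊕ ι)) (b c : Fin k → D),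
    φ.relabel (Sum.map b id) ∈ p → φ.not.relabel (Sum.map c id) ∈ p →
      tp L (fun i => (b i : 𝔐)) B ≠ tp L (fun i => (c i : 𝔐)) B

/-- `𝔐` is `κ`-saturated: every complete 1-type over a set of fewer than `κ` parameters is
realized. -/
def IsSaturated (𝔐 : Type w) [L.Structure 𝔐] (κ : Cardinal.{w}) : Prop :=
  ∀ A : Set 𝔐, #A < κ → ∀ p : Set (L.Formula (A ⊕ Unit)), IsCompleteType L A p →
    ∃ a : 𝔐, p = tp L (fun _ : Unit => a) A

end Types

/-- `T` is dependent: no formula `φ(x, y)` has the independence property, that is, there are no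
model of `T` and finite tuples `a_u` (`u ⊆ ℕ`) and `b_n` (`n ∈ ℕ`) in it such that
`φ(a_u, b_n)` holds if and only if `n ∈ u`. -/
def IsDependent {L : FirstOrder.Language.{u, v}} (T : L.Theory) : Prop :=
  ¬ ∃ (k m : ℕ) (φ : L.Formula (Fin k ⊕ Fin m)) (M : T.ModelType.{u, v, max u v})
      (a : Set ℕ → Fin k → M) (b : ℕ → Fin m → M),
      ∀ (s : Set ℕ) (n : ℕ), n ∈ s ↔ φ.Realize (Sum.elim (a s) (b n))

section Constructions

variable (L : FirstOrder.Language.{u, v}) {𝔐 : Type w} [L.Structure 𝔐]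

/-- The set `A_β = A ∪ {a_γ : γ < β}`. -/
def stage (A : Set 𝔐) {α : Ordinal.{w}} (a : Set.Iio α → 𝔐) (β : Ordinal.{w}) : Set 𝔐 :=
  A ∪ {z | ∃ γ : Set.Iio α, (γ : Ordinal.{w}) < β ∧ a γ = z}

/-- A non-splitting (`F^nsp_κ`-) construction over `A`: a sequence `⟨(a_β, B_β) : β < α⟩` such that
`B_β ⊆ A_β`, `|B_β| < κ` and `tp(a_β, A_β)` does not split over `B_β`. -/
structure NspConstruction (κ : Cardinal.{w}) (A : Set 𝔐) where
  /-- the length `α` -/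
  length : Ordinal.{w}
  /-- the elements `a_β` -/
  elt : Set.Iio length → 𝔐
  /-- the sets `B_β` -/
  base : Set.Iio length → Set 𝔐
  base_subset : ∀ β, base β ⊆ stage A elt β
  card_base_lt : ∀ β, #(base β) < κ
  doesNotSplit : ∀ β, DoesNotSplit L (tp L (fun _ : Unit => elt β) (stage A elt β)) (base β)

/-- `A ≤_κ C`: the set `C` is `F^nsp_κ`-constructible over `A`. -/
def NspLE (κ : Cardinal.{w}) (A C : Set 𝔐) : Prop :=
  ∃ 𝒜 : NspConstruction L κ A, C = stage A 𝒜.elt 𝒜.length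

/-- `(A, A⁺)` is `κ`-reduced, inside the `κbar`-saturated monster model `𝔐` all of whose relevant
subsets are of cardinality `< κbar`: if `A ≤_κ C` and `c` is a sequence of length `< κ` from `A⁺`
then `tp(c, A)` has a unique extension to a complete type over `C`. The sequences of length `< κ`
are given as families over arbitrary index types of cardinality `< κ`. -/
def IsReduced (κbar κ : Cardinal.{w}) (A A' : Set 𝔐) : Prop :=
  ∀ C : Set 𝔐, #C < κbar → ∀ h : A ⊆ C, NspLE L κ A C →
    ∀ (ι : Type w) (c : ι → 𝔐), #ι < κ → (∀ i, c i ∈ A') →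
      ∃! q : Set (L.Formula (C ⊕ ι)), IsCompleteType L C q ∧ Extends L h q (tp L c A)

/-- The relational language with an `n`-ary symbol for each formula `φ(x, b)` in `n` free variables
with parameters `b` from the set `B`. -/
def traceLang (B : Set 𝔐) : FirstOrder.Language.{0, max u v w} where
  Functions _ := Empty
  Relations n := L.Formula (B ⊕ Fin n)

/-- The interpretation of the added symbols on `M ≺ 𝔐` in the expansion `M_[B]`: the symbol of
`φ(x, b)` is interpreted by the trace on `M` of the set defined by `φ(x, b)` in `𝔐`. Together with
the given `L`-structure this makes `M` a structure for `L.sum (traceLang L B)`, namely `M_[B]`. -/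
instance traceStructure (B : Set 𝔐) (M : L.ElementarySubstructure 𝔐) :
    (traceLang L B).Structure M where
  funMap f := Empty.elim f
  RelMap {n} (R : L.Formula (B ⊕ Fin n)) y :=
    R.Realize (Sum.elim (fun b : B => (b : 𝔐)) (fun i => (y i : 𝔐)))

/-- `M_[B] ≺ M'_[B]`: the inclusion is an elementary embedding of the expansions. -/
def TraceElementary (B : Set 𝔐) (M M' : L.ElementarySubstructure 𝔐) : Prop :=
  ∃ f : M ↪ₑ[L.sum (traceLang L B)] M', ∀ y : M, (f y : 𝔐) = y

/-- `(M, N)` is `κ`-nice, for elementary submodels `M`, `N` of the monster model `𝔐`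
(so that `M ⊆ N` means `M ≺ N`). -/
structure IsNice (κbar κ : Cardinal.{w}) (M N : L.ElementarySubstructure 𝔐) : Prop where
  reduced : IsReduced L κbar κ (M : Set 𝔐) (N : Set 𝔐)
  le : M ≤ N
  saturated_left : IsSaturated L M κ
  saturated_right : IsSaturated L N κ
  trace : ∀ M' : L.ElementarySubstructure 𝔐, #M' < κbar →
    NspLE L κ (M : Set 𝔐) (M' : Set 𝔐) → TraceElementary L (N : Set 𝔐) M M'

end Constructions

end DependentThy

/-! Call a type over a set small-nonsplitting if it does not split over some subset of cardinality
less than κ. The model M is the union of a κ-chain of constructible extensions. Since κ is regular,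
any small piece of data in M already lies in an early stage, and a later stage has dealt with it.
Four facts carry the argument.

Constructions give nonsplitting for sets, not only for single elements: if C is constructible over
A, the type over A of every small subset of C is small-nonsplitting (`Con.sNsp`). Reducedness and
niceness are verified from this property alone.

Constructions are plentiful and the tasks are few. By a VC-dimension count, each type over a small
set has a small-nonsplitting extension (`Setting.exists_nsp`). Over a κ-saturated set, a
small-nonsplitting type extends uniquely with the same base (`Nsp.unique`, `Nsp.exists_extend`), and
it is determined by its base and the type of its Morley sequences. So there are at most λ of them
(`KSat.exists_representatives`), and all can be treated by one construction of size λ.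

An indiscernible sequence alternates boundedly often. Hence, after adding finitely many terms of a
Morley sequence, the truth value of X(c, d) is the same for all further realizations d of a given
small-nonsplitting type (`Setting.exists_decide`). Doing this for all c and closing off κ times
gives reducedness (`Setting.exists_good_zero`).

For the trace expansions, traces of definable sets are closed under projection, by honest
definitions (`ExtDef.exists_proj`). With this, `TraceFam.decided` shows by induction on formulas of
the expansion that, for a of small-nonsplitting type over M, a single formula in the type of a over
M settles the truth value, uniformly in the extension M' of M; elementarity follows. The quantifier
step needs, inside M, smaller sets that are rich one level lower and whose small-nonsplitting types
with a prescribed base are realized in M whenever they extend to small-nonsplitting types over M;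
this is the hierarchy `Good`. If a truth value were not settled, one could find in M an alternating
Morley sequence, against dependence. -/

namespace DependentThy

open FirstOrder.Language Set

/-! ### Equality of types, expressed through definable sets -/

section EqTp

variable {L : FirstOrder.Language.{u, v}} {𝔐 : Type w} [L.Structure 𝔐]

/-- The fiber description of definable sets with parameters. -/
theorem definable_iff_fiber {ι : Type*} {D : Set 𝔐} {X : Set (ι → 𝔐)} :
    D.Definable L X ↔ ∃ (k : ℕ) (b : Fin k → 𝔐) (Y : Set (Fin k ⊕ ι → 𝔐)),
      (∀ i, b i ∈ D) ∧ (∅ : Set 𝔐).Definable L Y ∧ X = {a | Sum.elim b a ∈ Y} := by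
  constructor
  · intro h
    obtain ⟨A0, hA0, hd⟩ := definable_iff_finitely_definable.1 h
    obtain ⟨φ, rfl⟩ := definable_iff_exists_formula_sum.1 hd
    let e := A0.equivFin
    refine ⟨A0.card, fun i => (e.symm i : 𝔐), {v | (φ.relabel (Sum.map e id)).Realize v}, ?_, ?_, ?_⟩
    · intro i
      exact hA0 (e.symm i).2
    · exact empty_definable_iff.2 ⟨_, rfl⟩
    · ext a
      simp only [mem_ofPred_eq, Formula.realize_relabel]
      have : (Sum.elim (fun i => ((e.symm i : A0) : 𝔐)) a) ∘ (Sum.map e id) =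
          Sum.elim (Subtype.val : A0 → 𝔐) a := by
        funext z; rcases z with z | z <;> simp
      rw [this]; rfl
  · rintro ⟨k, b, Y, hb, hY, rfl⟩
    obtain ⟨φ, rfl⟩ := empty_definable_iff.1 hY
    refine definable_iff_exists_formula_sum.2
      ⟨φ.relabel (Sum.map (fun i => (⟨b i, hb i⟩ : D)) id), ?_⟩
    ext a
    simp only [mem_ofPred_eq, Formula.realize_relabel]
    have : (Sum.elim (Subtype.val : D → 𝔐) a) ∘ (Sum.map (fun i => (⟨b i, hb i⟩ : D)) id) =
        Sum.elim b a := by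
      funext z; rcases z with z | z <;> simp
    rw [this]

theorem definable_fiber {ι κ : Type*} [Finite κ] {D : Set 𝔐} {b : κ → 𝔐} (hb : ∀ i, b i ∈ D)
    {Y : Set (κ ⊕ ι → 𝔐)} (hY : D.Definable L Y) :
    D.Definable L {a : ι → 𝔐 | Sum.elim b a ∈ Y} := by
  obtain ⟨φ, rfl⟩ := definable_iff_exists_formula_sum.1 hY
  refine definable_iff_exists_formula_sum.2
    ⟨φ.relabel (Sum.elim Sum.inl (Sum.map (fun i => (⟨b i, hb i⟩ : D)) id)), ?_⟩
  ext a
  simp only [mem_ofPred_eq, Formula.realize_relabel]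
  have : (Sum.elim (Subtype.val : D → 𝔐) a) ∘
      (Sum.elim Sum.inl (Sum.map (fun i => (⟨b i, hb i⟩ : D)) id)) =
      Sum.elim Subtype.val (Sum.elim b a) := by
    funext z; rcases z with z | z | z <;> simp
  rw [this]

/-- A formula involves only finitely many variables. -/
theorem exists_formula_finite_vars {ι : Type*} {D : Set 𝔐} (φ : L.Formula (D ⊕ ι)) :
    ∃ (n : ℕ) (f : Fin n → ι) (ψ : L.Formula (D ⊕ Fin n)), ∀ c : ι → 𝔐,
      ψ.Realize (Sum.elim Subtype.val (c ∘ f)) ↔ φ.Realize (Sum.elim Subtype.val c) := by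
  classical
  let V := (φ.freeVarFinset).toRight
  let e := V.equivFin
  refine ⟨V.card, fun i => ((e.symm i : V) : ι), φ.restrictFreeVar
    (fun x => Sum.casesOn (motive := fun y => y ∈ φ.freeVarFinset → D ⊕ Fin V.card) x.1
      (fun x _ => Sum.inl x) (fun x hx => Sum.inr (e ⟨x, by simpa [V] using hx⟩)) x.2),
    fun c => BoundedFormula.realize_restrictFreeVar _ ?_⟩
  rintro ⟨x | x, hx⟩ <;> simp

variable (L) in
/-- Two tuples have the same type over `D`. -/
def EqTp {ι : Type*} (D : Set 𝔐) (a b : ι → 𝔐) : Prop :=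
  ∀ X : Set (ι → 𝔐), D.Definable L X → (a ∈ X ↔ b ∈ X)

namespace EqTp

variable {ι κ : Type*} {D E : Set 𝔐} {a b c : ι → 𝔐}

theorem refl (D : Set 𝔐) (a : ι → 𝔐) : EqTp L D a a := fun _ _ => Iff.rfl
theorem symm (h : EqTp L D a b) : EqTp L D b a := fun X hX => (h X hX).symm
theorem trans (h : EqTp L D a b) (h' : EqTp L D b c) : EqTp L D a c :=
  fun X hX => (h X hX).trans (h' X hX)
theorem mono (h : EqTp L E a b) (hDE : D ⊆ E) : EqTp L D a b := fun X hX => h X (hX.mono hDE)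
theorem comp (h : EqTp L D a b) (f : κ → ι) : EqTp L D (a ∘ f) (b ∘ f) :=
  fun _ hX => h _ (hX.preimage_comp f)

theorem of_imp (h : ∀ X : Set (ι → 𝔐), D.Definable L X → a ∈ X → b ∈ X) : EqTp L D a b :=
  fun X hX => ⟨h X hX, fun hb => by_contra fun ha => h _ hX.compl ha hb⟩

theorem iff_formula : EqTp L D a b ↔ ∀ φ : L.Formula (D ⊕ ι),
    φ.Realize (Sum.elim Subtype.val a) ↔ φ.Realize (Sum.elim Subtype.val b) := by
  constructor
  · intro h φ
    exact h {v | φ.Realize (Sum.elim Subtype.val v)} (definable_iff_exists_formula_sum.2 ⟨φ, rfl⟩)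
  · intro h X hX
    obtain ⟨φ, rfl⟩ := definable_iff_exists_formula_sum.1 hX
    exact h φ

theorem iff_tp : EqTp L D a b ↔ tp L a D = tp L b D := by
  rw [iff_formula, Set.ext_iff]; rfl

theorem iff_sumElim : EqTp L D a b ↔
    EqTp L ∅ (Sum.elim (Subtype.val : D → 𝔐) a) (Sum.elim (Subtype.val : D → 𝔐) b) := by
  constructor
  · intro h X hX
    obtain ⟨φ, rfl⟩ := empty_definable_iff.1 hX
    exact iff_formula.1 h φ
  · intro h
    rw [iff_formula]
    intro φ
    exact h {v | φ.Realize v} (empty_definable_iff.2 ⟨_, rfl⟩)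

theorem iff_finite_vars : EqTp L D a b ↔ ∀ (n : ℕ) (f : Fin n → ι), EqTp L D (a ∘ f) (b ∘ f) := by
  refine ⟨fun h n f => h.comp f, fun h => iff_formula.2 fun φ => ?_⟩
  obtain ⟨n, f, ψ, hψ⟩ := exists_formula_finite_vars φ
  rw [← hψ, ← hψ]
  exact iff_formula.1 (h n f) ψ

/-- Types over `D ∪ range a` are types over `D` of longer tuples. -/
theorem union_range_iff {a : κ → 𝔐} {b c : ι → 𝔐} :
    EqTp L (D ∪ range a) b c ↔ EqTp L D (Sum.elim a b) (Sum.elim a c) := by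
  rw [iff_sumElim (D := D), iff_sumElim (D := D ∪ range a)]
  constructor
  · intro h
    let f : D ⊕ (κ ⊕ ι) → ↑(D ∪ range a) ⊕ ι :=
      Sum.elim (fun d => Sum.inl ⟨d, Or.inl d.2⟩)
        (Sum.elim (fun i => Sum.inl ⟨a i, Or.inr ⟨i, rfl⟩⟩) Sum.inr)
    have := h.comp f
    convert this using 1 <;> · funext z; rcases z with z | z | z <;> rfl
  · intro h
    classical
    have hx : ∀ x : ↑(D ∪ range a), ∃ y : D ⊕ κ, Sum.elim Subtype.val a y = x := by
      rintro ⟨x, hx | ⟨i, rfl⟩⟩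
      · exact ⟨Sum.inl ⟨x, hx⟩, rfl⟩
      · exact ⟨Sum.inr i, rfl⟩
    choose g hg using hx
    let f : ↑(D ∪ range a) ⊕ ι → D ⊕ (κ ⊕ ι) :=
      Sum.elim (fun x => Sum.map id Sum.inl (g x)) (fun i => Sum.inr (Sum.inr i))
    have := h.comp f
    have aux : ∀ e : ι → 𝔐, (Sum.elim (Subtype.val : ↑(D ∪ range a) → 𝔐) e) =
        (Sum.elim Subtype.val (Sum.elim a e)) ∘ f := by
      intro e
      funext z
      rcases z with z | z
      · have := hg z
        simp only [Sum.elim_inl, Function.comp_apply, f]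
        rw [← this]
        rcases g z with y | y <;> rfl
      · rfl
    rw [aux, aux]; exact this

theorem iff_finite_params : EqTp L D a b ↔ ∀ (n : ℕ) (d : Fin n → 𝔐), (∀ i, d i ∈ D) →
    EqTp L ∅ (Sum.elim d a) (Sum.elim d b) := by
  constructor
  · intro h n d hd
    rw [← union_range_iff]
    refine h.mono ?_
    simpa [range_subset_iff] using hd
  · intro h X hX
    obtain ⟨k, d, Y, hd, hY, rfl⟩ := definable_iff_fiber.1 hX
    exact h k d hd Y hY

theorem sum_swap {a a' : ι → 𝔐} {b b' : κ → 𝔐} (h : EqTp L D (Sum.elim a b) (Sum.elim a' b')) :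
    EqTp L D (Sum.elim b a) (Sum.elim b' a') := by
  have := h.comp (Sum.swap : κ ⊕ ι → ι ⊕ κ)
  convert this using 1 <;> · funext z; rcases z with z | z <;> rfl

theorem sum_right {a a' : ι → 𝔐} {b b' : κ → 𝔐} (h : EqTp L D (Sum.elim a b) (Sum.elim a' b')) :
    EqTp L D b b' := h.comp Sum.inr

/-- A tuple from `D` with the type of `b` over `D` equals `b`. -/
theorem eq_of_mem (h : EqTp L D a b) (ha : ∀ i, a i ∈ D) : a = b := by
  funext i
  have h1 := h.comp (fun _ : Fin 1 => i)
  have := (h1 {x : Fin 1 → 𝔐 | x 0 ∈ ({a i} : Set 𝔐)} (Definable.singleton_of_mem L (ha i))).1 rfl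
  exact this.symm

end EqTp

end EqTp

/-! ### Compactness and homogeneity in the monster model -/

section Saturation

variable {L : FirstOrder.Language.{u, v}} {𝔐 : Type w} [L.Structure 𝔐] {κbar : Cardinal.{w}}

theorem exists_average_unit (hsat : IsSaturated L 𝔐 κbar) {D : Set 𝔐}
    (hD : #D < κbar) (U : Ultrafilter (Unit → 𝔐)) :
    ∃ a : Unit → 𝔐, ∀ X, D.Definable L X → (a ∈ X ↔ X ∈ U) := by
  let p : Set (L.Formula (D ⊕ Unit)) := {φ | {x | φ.Realize (Sum.elim Subtype.val x)} ∈ U}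
  have hp : IsCompleteType L D p := by
    constructor
    · intro s hs
      have : (⋂ φ ∈ s, {x : Unit → 𝔐 | φ.Realize (Sum.elim (Subtype.val : D → 𝔐) x)}) ∈ U :=
        (Filter.biInter_finset_mem s).2 hs
      obtain ⟨x, hx⟩ := U.nonempty_of_mem this
      refine ⟨x, fun φ hφ => ?_⟩
      simp only [mem_iInter] at hx
      exact hx φ hφ
    · intro φ
      rcases U.mem_or_compl_mem {x | φ.Realize (Sum.elim (Subtype.val : D → 𝔐) x)} with h | h
      · exact Or.inl h
      · refine Or.inr ?_
        change {x | φ.not.Realize (Sum.elim (Subtype.val : D → 𝔐) x)} ∈ U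
        simpa [Formula.realize_not, compl_ofPred] using h
  obtain ⟨a, ha⟩ := hsat D hD p hp
  refine ⟨fun _ => a, fun X hX => ?_⟩
  obtain ⟨φ, rfl⟩ := definable_iff_exists_formula_sum.1 hX
  change φ ∈ tp L (fun _ : Unit => a) D ↔ φ ∈ p
  rw [ha]

/-- The coordinates are realized one at a time: once the first one is `a0`, the fibres over `a0` of
the definable members of `U` generate a proper filter, and an ultrafilter above it is averaged over
`D ∪ {a0}` by induction. -/
theorem exists_average_fin (hsat : IsSaturated L 𝔐 κbar) (hκ : ℵ₀ ≤ κbar) (n : ℕ) :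
    ∀ {D : Set 𝔐}, #D < κbar → ∀ U : Ultrafilter (Fin n → 𝔐),
    ∃ a : Fin n → 𝔐, ∀ X, D.Definable L X → (a ∈ X ↔ X ∈ U) := by
  induction n with
  | zero =>
    intro D hD U
    refine ⟨Fin.elim0, fun X _ => ?_⟩
    rcases Set.eq_empty_or_nonempty X with rfl | ⟨x, hx⟩
    · simp
    · have : X = Set.univ := by ext y; simp [Subsingleton.elim y x, hx]
      rw [this]
      exact ⟨fun _ => Filter.univ_mem, fun _ => trivial⟩
  | succ n ih =>
    intro D hD U
    obtain ⟨a0, ha0⟩ := exists_average_unit hsat hD (U.map (fun f _ => f 0))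
    let V : Set (Set (Fin n → 𝔐)) := {Z | ∃ X, D.Definable L X ∧ X ∈ U ∧
      Z = {y | (Fin.cons (a0 ()) y : Fin (n+1) → 𝔐) ∈ X}}
    -- Finitely many fibres meet because the projection of the intersection of the corresponding
    -- members of `U` is definable over `D` and belongs to the pushforward of `U`, so that it
    -- contains `a0`.
    have hV : ∀ s : Finset (Set (Fin n → 𝔐)), (s : Set _) ⊆ V → (⋂₀ (s : Set (Set (Fin n → 𝔐)))).Nonempty := by
      intro s hs
      choose X hX using fun i : s => hs i.2
      have hW1 : D.Definable L (⋂ i, X i) :=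
        definable_iInter_of_finite fun i => (hX i).1
      have hW2 : (⋂ i, X i) ∈ U := by
        rw [← Ultrafilter.mem_coe, Filter.iInter_mem]
        exact fun i => (hX i).2.1
      set W := ⋂ i, X i
      have h1 : D.Definable L {x : Unit → 𝔐 | ∃ y : Fin n → 𝔐, Sum.elim x y ∈
          {z : Unit ⊕ Fin n → 𝔐 | (z ∘ (Fin.cons (Sum.inl ()) Sum.inr : Fin (n+1) → _)) ∈ W}} :=
        Definable.exists_of_finite (hW1.preimage_comp _)
      have h2 := (ha0 _ h1).2 ?_
      · obtain ⟨y, hy⟩ := h2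
        refine ⟨y, fun Z hZ => ?_⟩
        change y ∈ ((⟨Z, hZ⟩ : s) : Set (Fin n → 𝔐))
        rw [(hX ⟨Z, hZ⟩).2.2]
        have : (Sum.elim a0 y) ∘ (Fin.cons (Sum.inl ()) Sum.inr : Fin (n+1) → _) = Fin.cons (a0 ()) y := by
          funext i
          refine Fin.cases ?_ (fun i => ?_) i <;> simp
        simp only [mem_ofPred_eq, this] at hy
        exact mem_iInter.1 hy ⟨Z, hZ⟩
      · refine Ultrafilter.mem_map.2 (Filter.mem_of_superset hW2 ?_)
        intro f hf
        refine ⟨fun i => f i.succ, ?_⟩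
        have : (Sum.elim (fun _ => f 0) (fun i => f i.succ)) ∘ (Fin.cons (Sum.inl ()) Sum.inr : Fin (n+1) → Unit ⊕ Fin n) = f := by
          funext i
          refine Fin.cases ?_ (fun i => ?_) i <;> simp
        simp only [mem_ofPred_eq, this]
        exact hf
    have hne : (Filter.generate V).NeBot := by
      rw [Filter.generate_neBot_iff]
      intro t ht htf
      have := hV htf.toFinset (by simpa using ht)
      simpa using this
    obtain ⟨a1, ha1⟩ := ih (D := D ∪ {a0 ()}) ((Cardinal.mk_union_le _ _).trans_lt
      (Cardinal.add_lt_of_lt hκ hD (by simpa using lt_of_lt_of_le Cardinal.one_lt_aleph0 hκ)))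
      (Ultrafilter.of (Filter.generate V))
    refine ⟨Fin.cons (a0 ()) a1, ?_⟩
    have key : ∀ X, D.Definable L X → X ∈ U → (Fin.cons (a0 ()) a1 : Fin (n+1) → 𝔐) ∈ X := by
      intro X hX hXU
      have h1 : (D ∪ {a0 ()}).Definable L {y : Fin n → 𝔐 | (Fin.cons (a0 ()) y : Fin (n+1) → 𝔐) ∈ X} := by
        have := definable_fiber (L := L) (D := D ∪ {a0 ()}) (b := a0) (by simp)
          ((hX.mono subset_union_left).preimage_comp (Fin.cons (Sum.inl ()) Sum.inr : Fin (n+1) → Unit ⊕ Fin n))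
        convert this using 1
        ext y
        have : (Sum.elim a0 y) ∘ (Fin.cons (Sum.inl ()) Sum.inr : Fin (n+1) → _) = Fin.cons (a0 ()) y := by
          funext i
          refine Fin.cases ?_ (fun i => ?_) i <;> simp
        simp only [mem_ofPred_eq, mem_preimage, this]
      refine (ha1 _ h1).2 (Ultrafilter.of_le _ ?_)
      exact Filter.mem_generate_of_mem ⟨X, hX, hXU, rfl⟩
    intro X hX
    refine ⟨fun h => by_contra fun h' => ?_, key X hX⟩
    exact key _ hX.compl (Ultrafilter.compl_mem_iff_notMem.2 h') h

/-- In a saturated structure, averages of ultrafilters over small sets are realized. -/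
theorem exists_average (hsat : IsSaturated L 𝔐 κbar) (hκ : ℵ₀ ≤ κbar) {ι : Type*} [Finite ι]
    {D : Set 𝔐} (hD : #D < κbar) (U : Ultrafilter (ι → 𝔐)) :
    ∃ a : ι → 𝔐, ∀ X, D.Definable L X → (a ∈ X ↔ X ∈ U) := by
  obtain ⟨n, ⟨e⟩⟩ := Finite.exists_equiv_fin ι
  obtain ⟨a, ha⟩ := exists_average_fin hsat hκ n hD (U.map (fun f => f ∘ e.symm))
  refine ⟨a ∘ e, fun X hX => ?_⟩
  have h1 := ha _ (hX.preimage_comp e)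
  rw [Ultrafilter.mem_map] at h1
  have : (fun f : ι → 𝔐 => f ∘ e.symm) ⁻¹' ((fun g : Fin n → 𝔐 => g ∘ e) ⁻¹' X) = X := by
    ext f
    simp [Function.comp_assoc]
  rw [this] at h1
  exact h1

/-- Compactness in a saturated structure. -/
theorem exists_mem_of_fip (hsat : IsSaturated L 𝔐 κbar) (hκ : ℵ₀ ≤ κbar) {ι : Type*} [Finite ι]
    {D : Set 𝔐} (hD : #D < κbar) {V : Set (Set (ι → 𝔐))} (hV : ∀ X ∈ V, D.Definable L X)
    (hfip : ∀ t ⊆ V, t.Finite → (⋂₀ t).Nonempty) : (⋂₀ V).Nonempty := by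
  have hne : (Filter.generate V).NeBot := by
    rw [Filter.generate_neBot_iff]
    exact fun t ht htf => hfip t ht htf
  obtain ⟨a, ha⟩ := exists_average hsat hκ hD (Ultrafilter.of (Filter.generate V))
  exact ⟨a, fun X hX => (ha X (hV X hX)).2 (Ultrafilter.of_le _ (Filter.mem_generate_of_mem hX))⟩

/-- Finite closure under intersections version of compactness. -/
theorem exists_mem_of_directed (hsat : IsSaturated L 𝔐 κbar) (hκ : ℵ₀ ≤ κbar) {ι : Type*} [Finite ι]
    {D : Set 𝔐} (hD : #D < κbar) {V : Set (Set (ι → 𝔐))} (hV : ∀ X ∈ V, D.Definable L X)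
    (hV0 : V.Nonempty) (hne : ∀ X ∈ V, X.Nonempty) (hint : ∀ X ∈ V, ∀ Y ∈ V, X ∩ Y ∈ V) : (⋂₀ V).Nonempty := by
  obtain ⟨X0, hX0⟩ := hV0
  refine exists_mem_of_fip hsat hκ hD hV ?_
  intro t ht htf
  have : X0 ∩ ⋂₀ t ∈ V := by
    induction t, htf using Set.Finite.induction_on with
    | empty => simpa using hX0
    | @insert a s has hs ih =>
      rw [sInter_insert, inter_left_comm]
      exact hint _ (ht (mem_insert _ _)) _ (ih ((subset_insert _ _).trans ht))
  exact (hne _ this).mono inter_subset_right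

/-- Homogeneity for finite tuples. -/
theorem EqTp.exists_extend (hsat : IsSaturated L 𝔐 κbar) (hκ : ℵ₀ ≤ κbar) {ι κ : Type*} [Finite ι]
    [Finite κ] {D : Set 𝔐} (hD : #D < κbar) {a a' : ι → 𝔐} (h : EqTp L D a a') (b : κ → 𝔐) :
    ∃ b' : κ → 𝔐, EqTp L D (Sum.elim a b) (Sum.elim a' b') := by
  have hcard : #↑(D ∪ range a') < κbar :=
    (Cardinal.mk_union_le _ _).trans_lt (Cardinal.add_lt_of_lt hκ hD
      ((Set.finite_range a').lt_aleph0.trans_le hκ))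
  have hne : (⋂₀ {Z | ∃ X, D.Definable L X ∧ Sum.elim a b ∈ X ∧
      Z = {y : κ → 𝔐 | Sum.elim a' y ∈ X}}).Nonempty := by
    refine exists_mem_of_directed hsat hκ hcard ?_ ⟨_, Set.univ, definable_univ, trivial, rfl⟩ ?_ ?_
    · rintro _ ⟨X, hX, -, rfl⟩
      exact definable_fiber (D := D ∪ range a') (fun i => mem_union_right _ (mem_range_self i))
        (hX.mono subset_union_left)
    · rintro _ ⟨X, hX, hab, rfl⟩
      exact (h _ hX.exists_of_finite).1 ⟨b, hab⟩
    · rintro _ ⟨X, hX, hab, rfl⟩ _ ⟨Y, hY, hab', rfl⟩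
      exact ⟨X ∩ Y, hX.inter hY, ⟨hab, hab'⟩, rfl⟩
  obtain ⟨b', hb'⟩ := hne
  exact ⟨b', EqTp.of_imp fun X hX hab => hb' _ ⟨X, hX, hab, rfl⟩⟩

theorem mk_union_range_lt {κ : Cardinal.{w}} (hκ : ℵ₀ ≤ κ) {ι : Type*} [Finite ι]
    {D : Set 𝔐} (hD : #D < κ) (a : ι → 𝔐) : #↑(D ∪ range a) < κ :=
  (Cardinal.mk_union_le _ _).trans_lt (Cardinal.add_lt_of_lt hκ hD
    ((Set.finite_range a).lt_aleph0.trans_le hκ))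

end Saturation

/-! ### Subsets of the monster model realizing all types over their small subsets -/

section KSat

variable (L : FirstOrder.Language.{u, v}) {𝔐 : Type w} [L.Structure 𝔐]

/-- Every 1-type over a subset of `M` of cardinality `< κ` is realized in `M`. -/
def KSat (κ : Cardinal.{w}) (M : Set 𝔐) : Prop :=
  ∀ B ⊆ M, #B < κ → ∀ a : 𝔐, ∃ a' ∈ M, EqTp L B (fun _ : Unit => a') (fun _ => a)

variable {L} {κbar κ : Cardinal.{w}}

/-- By homogeneity of the monster model, the last entry is first moved to a point over the copy `a'`
already found in `M`, and that point is then copied into `M` over `B` and `a'`. -/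
theorem KSat.exists_fin (hsat : IsSaturated L 𝔐 κbar) (hκ : ℵ₀ ≤ κ) (hκκ : κ ≤ κbar)
    {M : Set 𝔐} (hM : KSat L κ M) {B : Set 𝔐} (hB : B ⊆ M) (hBκ : #B < κ) (n : ℕ)
    (a : Fin n → 𝔐) : ∃ a' : Fin n → 𝔐, (∀ i, a' i ∈ M) ∧ EqTp L B a' a := by
  induction n with
  | zero => exact ⟨a, fun i => i.elim0, EqTp.refl _ _⟩
  | succ n ih =>
    obtain ⟨a', ha', h⟩ := ih (fun i => a i.castSucc)
    obtain ⟨b, hb⟩ := h.symm.exists_extend hsat (hκ.trans hκκ) (hBκ.trans_le hκκ)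
      (fun _ : Unit => a (Fin.last n))
    obtain ⟨b', hb'M, hb'⟩ := hM (B ∪ range a')
      (union_subset hB (by simpa [range_subset_iff] using ha'))
      (mk_union_range_lt hκ hBκ a') (b ())
    rw [EqTp.union_range_iff] at hb'
    have h2 := hb'.trans hb.symm
    refine ⟨Fin.snoc a' b', ?_, ?_⟩
    · intro i
      refine Fin.lastCases ?_ (fun i => ?_) i <;> simp [hb'M, ha']
    · have h3 := h2.comp (Fin.snoc Sum.inl (Sum.inr ()) : Fin (n+1) → Fin n ⊕ Unit)
      convert h3 using 1
      · funext i
        refine Fin.lastCases ?_ (fun i => ?_) i <;> simp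
      · funext i
        refine Fin.lastCases ?_ (fun i => ?_) i <;> simp

theorem KSat.exists_finite (hsat : IsSaturated L 𝔐 κbar) (hκ : ℵ₀ ≤ κ) (hκκ : κ ≤ κbar)
    {M : Set 𝔐} (hM : KSat L κ M) {B : Set 𝔐} (hB : B ⊆ M) (hBκ : #B < κ) {ι : Type*} [Finite ι]
    (a : ι → 𝔐) : ∃ a' : ι → 𝔐, (∀ i, a' i ∈ M) ∧ EqTp L B a' a := by
  obtain ⟨n, ⟨e⟩⟩ := Finite.exists_equiv_fin ι
  obtain ⟨a', ha', h⟩ := hM.exists_fin hsat hκ hκκ hB hBκ n (a ∘ e.symm)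
  refine ⟨a' ∘ e, fun i => ha' _, ?_⟩
  have := h.comp e
  simpa [Function.comp_assoc] using this

/-- A nonempty set definable over `M` has points in `M`. -/
theorem KSat.exists_mem (hsat : IsSaturated L 𝔐 κbar) (hκ : ℵ₀ ≤ κ) (hκκ : κ ≤ κbar)
    {M : Set 𝔐} (hM : KSat L κ M) {ι : Type*} [Finite ι] {X : Set (ι → 𝔐)}
    (hX : M.Definable L X) (hne : X.Nonempty) : ∃ a ∈ X, ∀ i, a i ∈ M := by
  obtain ⟨A0, hA0, hX'⟩ := definable_iff_finitely_definable.1 hX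
  obtain ⟨a, ha⟩ := hne
  obtain ⟨a', ha', h⟩ := hM.exists_finite hsat hκ hκκ hA0
    ((Finset.finite_toSet A0).lt_aleph0.trans_le hκ) a
  exact ⟨a', (h X hX').2 ha, ha'⟩

end KSat

end DependentThy

namespace DependentThy

open FirstOrder.Language Set

/-! ### Finite VC-dimension and bounded alternation -/

section NIP

variable {L : FirstOrder.Language.{u, v}}

/-- Compactness: if arbitrarily long finite sequences were shattered in this one model, the theory
with constants for all tuples a_u and b_n would be finitely satisfiable, and a model of it would
have the independence property. -/
theorem IsDependent.exists_not_shattered_fin {T : L.Theory} (hdep : IsDependent T)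
    {𝔐 : Type w} [L.Structure 𝔐] [𝔐 ⊨ T] [Nonempty 𝔐] {k m : ℕ} (φ : L.Formula (Fin k ⊕ Fin m)) :
    ∃ N : ℕ, ∀ d : Fin N → Fin m → 𝔐, ∃ s : Set (Fin N), ∀ a : Fin k → 𝔐,
      ¬ ∀ i, i ∈ s ↔ φ.Realize (Sum.elim a (d i)) := by
  by_contra! hcon
  apply hdep
  -- The constants live in `Type`, so the model given by satisfiability lies in the universe
  -- required by `IsDependent`.
  let C : Type := (Set ℕ × Fin k) ⊕ (ℕ × Fin m)
  let ψ : Set ℕ → ℕ → L.Formula C := fun s n => φ.relabel (Sum.map (fun i => (s, i)) (fun i => (n, i)))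
  let σ : Set ℕ → ℕ → L[[C]].Sentence := fun s n => Formula.equivSentence (ψ s n)
  let T' : ℕ → L[[C]].Theory := fun N => (L.lhomWithConstants C).onTheory T ∪
    {τ | ∃ n < N, ∃ s, (n ∈ s ∧ τ = σ s n) ∨ (n ∉ s ∧ τ = (σ s n).not)}
  have hdir : Directed (· ⊆ ·) T' := by
    apply Monotone.directed_le
    intro N N' h
    refine union_subset_union_right _ ?_
    rintro τ ⟨n, hn, s, hs⟩
    exact ⟨n, hn.trans_le h, s, hs⟩
  have hsat : Theory.IsSatisfiable (⋃ N, T' N) := by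
    rw [Theory.isSatisfiable_directed_union_iff hdir]
    intro N
    obtain ⟨d, hd⟩ := hcon N
    choose a ha using hd
    -- At level `N` the constants for a_s name a witness for the trace of `s` on the first `N`
    -- indices; the constants for b_n with `n ≥ N` are not mentioned and receive a default value.
    let c : C → 𝔐 := Sum.elim (fun p => a {i | (i : ℕ) ∈ p.1} p.2)
      (fun p => if h : p.1 < N then d ⟨p.1, h⟩ p.2 else Classical.arbitrary 𝔐)
    let : (constantsOn C).Structure 𝔐 := constantsOn.structure c
    have hreal : ∀ s n (hn : n < N), 𝔐 ⊨ σ s n ↔ n ∈ s := by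
      intro s n hn
      have h1 := ha {i | (i : ℕ) ∈ s} ⟨n, hn⟩
      simp only [mem_ofPred_eq] at h1
      rw [h1]
      change (Formula.equivSentence (ψ s n)).Realize 𝔐 ↔ _
      rw [Formula.realize_equivSentence, Formula.realize_relabel]
      have : (fun x => ((L.con x : L[[C]].Constants) : 𝔐)) ∘
          (Sum.map (fun i => (s, i)) (fun i => (n, i)) : _ → C) =
          Sum.elim (a {i | (i : ℕ) ∈ s}) (d ⟨n, hn⟩) := by
        funext z
        rcases z with z | z
        · change c (Sum.inl (s, z)) = _
          simp [c]
        · change c (Sum.inr (n, z)) = _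
          simp [c, hn]
      rw [this]
    have : 𝔐 ⊨ T' N := by
      refine ((LHom.onTheory_model _ _).2 inferInstance).union ?_
      refine ⟨?_⟩
      rintro τ ⟨n, hn, s, ⟨hs, rfl⟩ | ⟨hs, rfl⟩⟩
      · exact (hreal s n hn).2 hs
      · rw [Sentence.realize_not]
        exact fun h => hs ((hreal s n hn).1 h)
    exact Theory.Model.isSatisfiable 𝔐
  obtain ⟨W⟩ := hsat
  have hWT : ∀ N, W ⊨ T' N := fun N => W.is_model.mono (subset_iUnion T' N)
  have hW0 : W ⊨ (L.lhomWithConstants C).onTheory T := (hWT 0).mono subset_union_left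
  let W' : T.ModelType := hW0.bundled.reduct (L.lhomWithConstants C)
  refine ⟨k, m, φ, W', fun s i => (L.con (Sum.inl (s, i) : C) : W),
    fun n i => (L.con (Sum.inr (n, i) : C) : W), ?_⟩
  have hreal : ∀ s n, W ⊨ σ s n ↔ φ.Realize (M := W') (Sum.elim (fun i => (L.con (Sum.inl (s, i) : C) : W))
      (fun i => (L.con (Sum.inr (n, i) : C) : W))) := by
    intro s n
    let : L.Structure W := (L.lhomWithConstants C).reduct W
    have : (L.lhomWithConstants C).IsExpansionOn W := LHom.isExpansionOn_reduct _ _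
    change (Formula.equivSentence (ψ s n)).Realize W ↔ _
    rw [Formula.realize_equivSentence, Formula.realize_relabel]
    have : (fun x => ((L.con x : L[[C]].Constants) : W)) ∘
        (Sum.map (fun i => (s, i)) (fun i => (n, i)) : _ → C) =
        (Sum.elim (fun i => (L.con (Sum.inl (s, i) : C) : W))
      (fun i => (L.con (Sum.inr (n, i) : C) : W))) := by
      funext z
      rcases z with z | z <;> rfl
    rw [this]; rfl
  intro s n
  rw [← hreal]
  have hmod := (hWT (n+1)).realize_of_mem
  constructor
  · intro hs
    exact hmod _ (Or.inr ⟨n, n.lt_succ_self, s, Or.inl ⟨hs, rfl⟩⟩)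
  · intro h
    by_contra hs
    have := hmod _ (Or.inr ⟨n, n.lt_succ_self, s, Or.inr ⟨hs, rfl⟩⟩)
    rw [Sentence.realize_not] at this
    exact this h

variable (L) in
/-- Every `∅`-definable family of definable sets has finite VC-dimension. -/
def NIP (𝔐 : Type w) [L.Structure 𝔐] : Prop :=
  ∀ (α β : Type) [Finite α] [Finite β] (X : Set (α ⊕ β → 𝔐)), (∅ : Set 𝔐).Definable L X →
    ∃ N : ℕ, ∀ d : Fin N → β → 𝔐, ∃ s : Set (Fin N), ∀ a : α → 𝔐,
      ¬ ∀ i, i ∈ s ↔ Sum.elim a (d i) ∈ X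

theorem IsDependent.nip {T : L.Theory} (hdep : IsDependent T)
    {𝔐 : Type w} [L.Structure 𝔐] [𝔐 ⊨ T] [Nonempty 𝔐] : NIP L 𝔐 := by
  intro α β _ _ X hX
  obtain ⟨φ, rfl⟩ := empty_definable_iff.1 hX
  obtain ⟨k, ⟨e⟩⟩ := Finite.exists_equiv_fin α
  obtain ⟨m, ⟨e'⟩⟩ := Finite.exists_equiv_fin β
  obtain ⟨N, hN⟩ := hdep.exists_not_shattered_fin (𝔐 := 𝔐) (φ.relabel (Sum.map e e'))
  refine ⟨N, fun d => ?_⟩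
  obtain ⟨s, hs⟩ := hN (fun i => d i ∘ e'.symm)
  refine ⟨s, fun a ha => hs (a ∘ e.symm) fun i => ?_⟩
  rw [ha i, Formula.realize_relabel]
  have : (Sum.elim (a ∘ e.symm) (d i ∘ e'.symm)) ∘ (Sum.map e e') = Sum.elim a (d i) := by
    funext z; rcases z with z | z <;> simp
  rw [this]; rfl

variable {𝔐 : Type w} [L.Structure 𝔐]

variable (L) in
/-- Increasing subtuples of `d 0, …, d (K - 1)` of the same length have the same type over `D`. -/
def Indisc {ι : Type*} (D : Set 𝔐) (d : ℕ → ι → 𝔐) (K : ℕ) : Prop :=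
  ∀ (k : ℕ) (f g : Fin k → ℕ), StrictMono f → StrictMono g → (∀ i, f i < K) → (∀ i, g i < K) →
    EqTp L D (fun p : Fin k × ι => d (f p.1) p.2) (fun p => d (g p.1) p.2)

theorem Indisc.mono {ι : Type*} {D D' : Set 𝔐} {d : ℕ → ι → 𝔐} {K : ℕ} (h : Indisc L D d K)
    (hD : D' ⊆ D) : Indisc L D' d K :=
  fun k f g hf hg hf' hg' => (h k f g hf hg hf' hg').mono hD

/-- An indiscernible sequence does not alternate too often. -/
theorem NIP.exists_alternation_bound (hnip : NIP L 𝔐) {γ ι : Type} [Finite γ] [Finite ι]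
    {X : Set (γ ⊕ ι → 𝔐)} (hX : (∅ : Set 𝔐).Definable L X) :
    ∃ K : ℕ, ∀ d : ℕ → ι → 𝔐, Indisc L ∅ d K → ∀ (m : γ → 𝔐) (P : Prop),
      ¬ ∀ i < K, (Sum.elim m (d i) ∈ X ↔ (P ↔ Even i)) := by
  obtain ⟨N, hN⟩ := hnip _ _ _ hX
  refine ⟨2 * N, fun d hd m P halt => ?_⟩
  obtain ⟨s, hs⟩ := hN (fun i => d i)
  let Z : Set (Fin N × ι → 𝔐) := {v | ∃ a : γ → 𝔐, Sum.elim v a ∈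
    (⋂ j : Fin N, {z : (Fin N × ι) ⊕ γ → 𝔐 |
      j ∈ s ↔ (z ∘ (Sum.elim Sum.inr (fun i => Sum.inl (j, i)) : γ ⊕ ι → _)) ∈ X})}
  have hZ : (∅ : Set 𝔐).Definable L Z := by
    refine Definable.exists_of_finite (definable_iInter_of_finite fun j => ?_)
    have h1 := hX.preimage_comp (Sum.elim Sum.inr (fun i => Sum.inl (j, i)) : γ ⊕ ι → (Fin N × ι) ⊕ γ)
    by_cases hj : j ∈ s
    · convert h1 using 1; ext z; simp [hj]
    · convert h1.compl using 1; ext z; simp [hj]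
  have hmem : ∀ (f : Fin N → ℕ), (fun p : Fin N × ι => d (f p.1) p.2) ∈ Z ↔
      ∃ a : γ → 𝔐, ∀ j, j ∈ s ↔ Sum.elim a (d (f j)) ∈ X := by
    intro f
    simp only [Z, mem_ofPred_eq, mem_iInter]
    refine exists_congr fun a => forall_congr' fun j => ?_
    have : (Sum.elim (fun p : Fin N × ι => d (f p.1) p.2) a) ∘
        (Sum.elim Sum.inr (fun i => Sum.inl (j, i)) : γ ⊕ ι → _) = Sum.elim a (d (f j)) := by
      funext z; rcases z with z | z <;> rfl
    rw [this]
  classical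
  -- From each pair of neighbours 2j, 2j + 1 choose the one on which the alternation gives the value
  -- prescribed by `s`. The pattern `s` is then realized on an increasing subsequence, and by
  -- indiscernibility on the first `N` terms.
  let f : Fin N → ℕ := fun j => if (P ↔ j ∈ s) then 2 * j else 2 * j + 1
  have hf : StrictMono f := by
    intro i j hij
    have : (i : ℕ) < j := hij
    simp only [f]
    split_ifs <;> omega
  have hfK : ∀ i, f i < 2 * N := by
    intro i
    have := i.2
    simp only [f]
    split_ifs <;> omega
  have h1 : (fun p : Fin N × ι => d (f p.1) p.2) ∈ Z := by
    rw [hmem]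
    refine ⟨m, fun j => ?_⟩
    rw [halt _ (hfK j)]
    by_cases h : (P ↔ j ∈ s)
    · simp [f, h]
    · simp only [f, h, if_false]
      have : ¬ Even (2 * (j : ℕ) + 1) := by simp
      tauto
  have h2 := (hd N f (fun i => (i : ℕ)) hf (fun i j h => h) hfK (fun i => by have := i.2; omega) Z hZ).1 h1
  obtain ⟨a, ha⟩ := (hmem _).1 h2
  exact hs a ha

end NIP

end DependentThy

namespace DependentThy

open FirstOrder.Language Set

variable {L : FirstOrder.Language.{u, v}} {𝔐 : Type w} [L.Structure 𝔐]

/-! ### Nonsplitting -/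

section Nsp

variable (L) in
/-- The type over `D` of (any enumeration of) `S` does not split over `B`. -/
def Nsp (D B S : Set 𝔐) : Prop :=
  ∀ (k : ℕ) (b c : Fin k → 𝔐), (∀ i, b i ∈ D) → (∀ i, c i ∈ D) → EqTp L B b c → EqTp L S b c

namespace Nsp

variable {D D' B B' S S' : Set 𝔐}

theorem mono (h : Nsp L D B S) (hD : D' ⊆ D) (hB : B ⊆ B') (hS : S' ⊆ S) : Nsp L D' B' S' :=
  fun k b c hb hc hbc => (h k b c (fun i => hD (hb i)) (fun i => hD (hc i)) (hbc.mono hB)).mono hS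

theorem eqTp (h : Nsp L D B S) {ι : Type*} {b c : ι → 𝔐} (hb : ∀ i, b i ∈ D)
    (hc : ∀ i, c i ∈ D) (hbc : EqTp L B b c) : EqTp L S b c :=
  EqTp.iff_finite_vars.2 fun n f => h n _ _ (fun _ => hb _) (fun _ => hc _) (hbc.comp f)

/-- An enumeration of `B` is prefixed to both tuples, which stay inside `D` because `B ⊆ D`. -/
theorem eqTp_union (h : Nsp L D B S) (hBD : B ⊆ D) {ι : Type*} {b c : ι → 𝔐} (hb : ∀ i, b i ∈ D)
    (hc : ∀ i, c i ∈ D) (hbc : EqTp L B b c) : EqTp L (S ∪ B) b c := by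
  have hr : range (Subtype.val : B → 𝔐) = B := Subtype.range_val
  have h1 : EqTp L (S ∪ range (Subtype.val : B → 𝔐)) b c := by
    rw [EqTp.union_range_iff]
    refine h.eqTp ?_ ?_ ?_
    · rintro (i | i)
      exacts [hBD i.2, hb i]
    · rintro (i | i)
      exacts [hBD i.2, hc i]
    · rw [← EqTp.union_range_iff, hr, union_self]
      exact hbc
  rwa [hr] at h1

theorem range_iff {ι : Type*} {a : ι → 𝔐} : Nsp L D B (range a) ↔
    ∀ (k : ℕ) (b c : Fin k → 𝔐), (∀ i, b i ∈ D) → (∀ i, c i ∈ D) → EqTp L B b c →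
      EqTp L ∅ (Sum.elim b a) (Sum.elim c a) := by
  refine forall₃_congr fun k b c => forall₃_congr fun hb hc hbc => ?_
  rw [← empty_union (range a), EqTp.union_range_iff]
  exact ⟨fun h => h.sum_swap, fun h => h.sum_swap⟩

theorem congr {ι : Type*} {a a' : ι → 𝔐} (h : Nsp L D B (range a)) (haa : EqTp L D a a') :
    Nsp L D B (range a') := by
  rw [range_iff] at h ⊢
  intro k b c hb hc hbc
  have h1 := EqTp.iff_finite_params.1 haa k b hb
  have h2 := EqTp.iff_finite_params.1 haa k c hc
  exact h1.symm.trans ((h k b c hb hc hbc).trans h2)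

theorem doesNotSplit_iff {ι : Type*} {a : ι → 𝔐} :
    DoesNotSplit L (tp L a D) B ↔ Nsp L D B (range a) := by
  rw [range_iff]
  have key : ∀ k (φ : L.Formula (Fin k ⊕ ι)) (b : Fin k → D),
      φ.relabel (Sum.map b id) ∈ tp L a D ↔ φ.Realize (Sum.elim (fun i => (b i : 𝔐)) a) := by
    intro k φ b
    change (φ.relabel (Sum.map b id)).Realize (Sum.elim (Subtype.val : D → 𝔐) a) ↔ _
    rw [Formula.realize_relabel]
    have : (Sum.elim (Subtype.val : D → 𝔐) a) ∘ (Sum.map b id) = Sum.elim (fun i => (b i : 𝔐)) a := by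
      funext z; rcases z with z | z <;> rfl
    rw [this]
  constructor
  · intro h k b c hb hc hbc
    refine EqTp.of_imp fun X hX hbX => by_contra fun hcX => ?_
    obtain ⟨φ, rfl⟩ := empty_definable_iff.1 hX
    refine h k φ (fun i => ⟨b i, hb i⟩) (fun i => ⟨c i, hc i⟩) ((key _ _ _).2 hbX)
      ((key _ _ _).2 ?_) (EqTp.iff_tp.1 hbc)
    rw [Formula.realize_not]
    exact hcX
  · intro h k φ b c hb hc htp
    rw [key] at hb hc
    rw [Formula.realize_not] at hc
    exact hc ((h k _ _ (fun i => (b i).2) (fun i => (c i).2) (EqTp.iff_tp.2 htp)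
      {v | φ.Realize v} (empty_definable_iff.2 ⟨_, rfl⟩)).1 hb)

/-- Two tuples with the same type over `B ∪ S` agree wherever one of them has an entry in `S`. The
remaining entries lie in `D`, so the hypothesis applies to them, and the entries in `S` return as
parameters. -/
theorem split (h : Nsp L D B (S ∪ S')) : Nsp L (D ∪ S) (B ∪ S) S' := by
  classical
  intro k b c hb hc hbc
  have hS : ∀ i, b i ∈ S → c i = b i := by
    intro i hi
    have h1 := hbc.comp (fun _ : Unit => i)
    have h2 := h1.eq_of_mem (fun _ => Or.inr hi)
    exact (congrFun h2 ()).symm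
  have hS' : ∀ i, b i ∉ S → c i ∉ S := by
    intro i hi hci
    have h1 := hbc.symm.comp (fun _ : Unit => i)
    have h2 := h1.eq_of_mem (fun _ => Or.inr hci)
    exact hi (by rw [← show c i = b i from congrFun h2 ()]; exact hci)
  let J := {i : Fin k // b i ∉ S}
  have h1 : EqTp L (B ∪ S) (fun j : J => b j) (fun j : J => c j) := hbc.comp Subtype.val
  have h2 : EqTp L (S ∪ S') (fun j : J => b j) (fun j : J => c j) :=
    h.eqTp (fun j => (hb j).resolve_right j.2) (fun j => (hc j).resolve_right (hS' j j.2))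
      (h1.mono subset_union_left)
  have hr : range (Subtype.val : S → 𝔐) = S := Subtype.range_val
  replace h2 : EqTp L (S' ∪ range (Subtype.val : S → 𝔐)) (fun j : J => b j) (fun j : J => c j) :=
    h2.mono (by rw [hr, union_comm])
  rw [EqTp.union_range_iff] at h2
  let f : Fin k → S ⊕ J := fun i => if hi : b i ∈ S then Sum.inl ⟨b i, hi⟩ else Sum.inr ⟨i, hi⟩
  have h3 := h2.comp f
  convert h3 using 1
  · funext i
    by_cases hi : b i ∈ S <;> simp [f, hi]
  · funext i
    by_cases hi : b i ∈ S
    · simp [f, hi, hS i hi]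
    · simp [f, hi]

end Nsp

end Nsp

section SNsp

variable (L) in
/-- The type over `A` of every small subset of `C` does not split over a small set. -/
def SNsp (κ : Cardinal.{w}) (A C : Set 𝔐) : Prop :=
  ∀ S ⊆ C, #S < κ → ∃ B ⊆ A, #B < κ ∧ Nsp L A B S

theorem SNsp.trans {κ : Cardinal.{w}} {A C E : Set 𝔐} (h : SNsp L κ A C) (h' : SNsp L κ C E)
    (hAC : A ⊆ C) : SNsp L κ A E := by
  intro S hS hSκ
  obtain ⟨B, hB, hBκ, hN⟩ := h' S hS hSκ
  obtain ⟨B', hB', hBκ', hN'⟩ := h B hB hBκ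
  exact ⟨B', hB', hBκ', fun k b c hb hc hbc => hN k b c (fun i => hAC (hb i)) (fun i => hAC (hc i))
    (hN' k b c hb hc hbc)⟩

end SNsp

variable (L 𝔐) in
/-- The standing assumptions on the monster model and the cardinals. -/
structure Setting (κbar κ lam : Cardinal.{w}) : Prop where
  sat : IsSaturated L 𝔐 κbar
  nip : NIP L 𝔐
  reg : κ.IsRegular
  card_lt : Cardinal.lift.{w} (max ℵ₀ L.card) < Cardinal.lift.{max u v} κ
  aleph0_le : ℵ₀ ≤ lam
  pow : ∀ θ : Cardinal.{w}, θ ≠ 0 → θ < κ → lam = lam ^ θ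
  lt_bar : lam < κbar

/-! ### Cardinal arithmetic and the number of formulas -/

namespace Setting

variable {κbar κ lam : Cardinal.{w}} (S : Setting L 𝔐 κbar κ lam)

include S

theorem aleph0_lt : ℵ₀ < κ := by
  have h : Cardinal.lift.{w} ℵ₀ ≤ Cardinal.lift.{w} (max ℵ₀ L.card) := lift_le.2 (le_max_left _ _)
  have := h.trans_lt S.card_lt
  rw [lift_aleph0, ← lift_aleph0.{max u v, w}, Cardinal.lift_lt] at this
  exact this

/-- Otherwise θ = λ would be allowed, and λ = λ^λ contradicts Cantor's theorem. -/
theorem le_lam : κ ≤ lam := by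
  by_contra! h
  have h1 := S.pow lam (aleph0_pos.trans_le S.aleph0_le).ne' h
  have h2 := Cardinal.cantor' lam (one_lt_aleph0.trans_le S.aleph0_le)
  exact h2.ne h1

theorem le_bar : κ ≤ κbar := S.le_lam.trans S.lt_bar.le

theorem aleph0_le_bar : ℵ₀ ≤ κbar := S.aleph0_le.trans S.lt_bar.le

theorem two_pow_le {θ : Cardinal.{w}} (h : θ < κ) : 2 ^ θ ≤ lam := by
  rcases eq_or_ne θ 0 with rfl | h0
  · simpa using one_lt_aleph0.le.trans S.aleph0_le
  · rw [S.pow θ h0 h]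
    exact Cardinal.power_le_power_right ((natCast_lt_aleph0 (n := 2)).le.trans S.aleph0_le)

/-- The number of definable sets. -/
theorem exists_index (ι : Type) [Countable ι] (B : Set 𝔐) :
    ∃ (K : Type w) (f : K → Set (ι → 𝔐)), (#B < κ → #K < κ) ∧ (#B ≤ lam → #K ≤ lam) ∧
      ∀ Y, B.Definable L Y ↔ Y ∈ range f := by
  have hle : #(L.Formula (B ⊕ ι)) ≤ max ℵ₀ (Cardinal.lift.{max u v} #(B ⊕ ι) + Cardinal.lift.{w} L.card) := by
    refine le_trans ?_ BoundedFormula.card_le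
    exact Cardinal.mk_le_of_injective (f := fun φ => (⟨0, φ⟩ : Σ n, L.BoundedFormula (B ⊕ ι) n))
      (fun a b h => by simpa using h)
  obtain ⟨l, hl⟩ := Cardinal.mem_range_lift_of_le (S.card_lt.le)
  have hlκ : l < κ := by
    have := S.card_lt
    rw [← hl] at this
    exact Cardinal.lift_lt.1 this
  have hLl : Cardinal.lift.{w} L.card ≤ Cardinal.lift.{max u v} l := by
    rw [hl]; exact lift_le.2 (le_max_right _ _)
  have hι : #ι ≤ ℵ₀ := Cardinal.mk_le_aleph0
  have hle2 : #(L.Formula (B ⊕ ι)) ≤ Cardinal.lift.{max u v} (max ℵ₀ ((#B + ℵ₀) + l)) := by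
    refine hle.trans ?_
    rw [lift_max, lift_aleph0, lift_add, lift_add, lift_aleph0]
    refine max_le_max le_rfl (add_le_add ?_ hLl)
    rw [Cardinal.mk_sum, lift_add]
    refine add_le_add ?_ ?_
    · simp
    · simp [hι]
  obtain ⟨c, hc⟩ := Cardinal.mem_range_lift_of_le hle2
  have hcle : c ≤ max ℵ₀ ((#B + ℵ₀) + l) := by
    rw [← hc] at hle2
    exact Cardinal.lift_le.1 hle2
  rw [← Cardinal.mk_out c, ← Cardinal.mk_uLift, Cardinal.eq] at hc
  obtain ⟨e⟩ := hc
  refine ⟨c.out, fun k => {v | (e ⟨k⟩).Realize (Sum.elim (Subtype.val : B → 𝔐) v)}, ?_, ?_, ?_⟩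
  · intro hB
    rw [Cardinal.mk_out]
    exact hcle.trans_lt (max_lt S.aleph0_lt
      (add_lt_of_lt S.reg.aleph0_le (add_lt_of_lt S.reg.aleph0_le hB S.aleph0_lt) hlκ))
  · intro hB
    rw [Cardinal.mk_out]
    exact hcle.trans (max_le S.aleph0_le
      (add_le_of_le S.aleph0_le (add_le_of_le S.aleph0_le hB S.aleph0_le) (hlκ.le.trans S.le_lam)))
  · intro Y
    rw [definable_iff_exists_formula_sum]
    constructor
    · rintro ⟨φ, rfl⟩
      refine ⟨(e.symm φ).down, ?_⟩
      change {v | (e (e.symm φ)).Realize (Sum.elim (Subtype.val : B → 𝔐) v)} = _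
      rw [e.apply_symm_apply]
    · rintro ⟨k, rfl⟩
      exact ⟨_, rfl⟩

end Setting

end DependentThy

/-! ### Nonsplitting extensions of types over small sets -/

namespace DependentThy

open FirstOrder.Language Set

variable {L : FirstOrder.Language.{u, v}} {𝔐 : Type w} [L.Structure 𝔐]

/-- Exponential growth beats the polynomial bound of Sauer and Shelah; `J` is the number of steps
after which `NIP.exists_finite_base` reaches a contradiction. -/
theorem exists_mul_pow_lt_two_pow (C r d : ℕ) : ∃ J : ℕ, C * (J * r + 1) ^ d < 2 ^ J := by
  have h := tendsto_pow_const_div_const_pow_of_one_lt d (r := 2) one_lt_two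
  have hpos : (0 : ℝ) < 1 / ((C + 1) * (r + 1) ^ d) := by positivity
  obtain ⟨J, hJ, hJ1⟩ := ((h.eventually (gt_mem_nhds hpos)).and (Filter.eventually_ge_atTop 1)).exists
  refine ⟨J, ?_⟩
  have h2 : (0 : ℝ) < 2 ^ J := by positivity
  rw [div_lt_div_iff₀ h2 (by positivity), one_mul] at hJ
  have h3 : (J * r + 1 : ℝ) ≤ J * (r + 1) := by
    have : (1 : ℝ) ≤ J := by exact_mod_cast hJ1
    linarith
  have h4 : (C : ℝ) * (J * r + 1) ^ d ≤ J ^ d * ((C + 1) * (r + 1) ^ d) := by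
    calc (C : ℝ) * (J * r + 1) ^ d ≤ (C + 1) * (J * (r + 1)) ^ d := by gcongr; linarith
      _ = _ := by rw [mul_pow]; ring
  have := h4.trans_lt hJ
  exact_mod_cast this

theorem card_shatterer_le {α : Type*} [DecidableEq α] [Fintype α] (𝒜 : Finset (Finset α)) (d : ℕ)
    (h : ∀ s, 𝒜.Shatters s → s.card ≤ d) : 𝒜.card ≤ (d + 1) * (Fintype.card α + 1) ^ d := by
  have hd : 𝒜.vcDim ≤ d := Finset.sup_le fun s hs => h s (Finset.mem_shatterer.1 hs)
  refine (Finset.card_le_card_shatterer 𝒜).trans (Finset.card_shatterer_le_sum_vcDim.trans ?_)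
  calc ∑ k ∈ Finset.Iic 𝒜.vcDim, (Fintype.card α).choose k
      ≤ ∑ k ∈ Finset.Iic 𝒜.vcDim, (Fintype.card α + 1) ^ d := by
        refine Finset.sum_le_sum fun k hk => ?_
        refine (Nat.choose_le_pow _ _).trans ?_
        refine (Nat.pow_le_pow_left (Nat.le_succ _) k).trans ?_
        exact Nat.pow_le_pow_right (Nat.succ_pos _) ((Finset.mem_Iic.1 hk).trans hd)
    _ = (𝒜.vcDim + 1) * (Fintype.card α + 1) ^ d := by simp
    _ ≤ _ := by gcongr

/-- This is the finite core of the existence of nonsplitting extensions. If no `e` works, choose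
counterexamples (b_j, c_j) over growing finite sets E_j. Every `y ∈ Y` separates b_j from c_j in
some family, and b_j, c_j have the same type over E_j, so each pattern of membership at b_0, …,
b_{j-1} realized in `Y` has at least two continuations at b_j. This gives 2^J patterns on J·r
points, too many for families of bounded VC-dimension. -/
theorem NIP.exists_finite_base (hnip : NIP L 𝔐) {D : Set 𝔐} {ι : Type} [Finite ι]
    {Y : Set (ι → 𝔐)} (hY : D.Definable L Y) (hne : Y.Nonempty) {r : ℕ} (n : Fin r → ℕ)
    (X : ∀ i, Set (Fin (n i) ⊕ ι → 𝔐)) (hX : ∀ i, (∅ : Set 𝔐).Definable L (X i)) :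
    ∃ e : Finset 𝔐, (e : Set 𝔐) ⊆ D ∧ ∀ b c : ∀ i, Fin (n i) → 𝔐, (∀ i j, b i j ∈ D) →
      (∀ i j, c i j ∈ D) → (∀ i, EqTp L (e : Set 𝔐) (b i) (c i)) →
      ∃ y ∈ Y, ∀ i, Sum.elim (b i) y ∈ X i ↔ Sum.elim (c i) y ∈ X i := by
  classical
  by_contra! hcon
  obtain ⟨e0, he0, hY0⟩ := definable_iff_finitely_definable.1 hY
  choose B C hB hC hBC hbad using hcon
  -- Only the entries of `B` are added, since the patterns counted below mention only the tuples
  -- b_j; this makes the patterns before stage j definable over E_j. The parameters of `Y` enter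
  -- through `e0`.
  let next : {e : Finset 𝔐 // (e : Set 𝔐) ⊆ D} → {e : Finset 𝔐 // (e : Set 𝔐) ⊆ D} := fun e =>
    ⟨e.1 ∪ (Finset.univ : Finset (Σ i, Fin (n i))).image (fun p => B e.1 e.2 p.1 p.2), by
      intro x hx
      simp only [Finset.coe_union, Finset.coe_image, mem_union, mem_image] at hx
      rcases hx with hx | ⟨p, -, rfl⟩
      exacts [e.2 hx, hB _ _ _ _]⟩
  let E : ℕ → {e : Finset 𝔐 // (e : Set 𝔐) ⊆ D} := fun j => Nat.rec ⟨e0, he0⟩ (fun _ e => next e) j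
  have hEs : ∀ j, E (j + 1) = next (E j) := fun j => rfl
  have hEmono : Monotone fun j => ((E j).1 : Set 𝔐) := by
    refine monotone_nat_of_le_succ fun j => ?_
    rw [hEs]
    intro x hx
    simp only [next, Finset.coe_union]
    exact Or.inl hx
  let b : ∀ (j : ℕ) (i : Fin r), Fin (n i) → 𝔐 := fun j i => B (E j).1 (E j).2 i
  let c : ∀ (j : ℕ) (i : Fin r), Fin (n i) → 𝔐 := fun j i => C (E j).1 (E j).2 i
  have hbE : ∀ j j' i k, j < j' → b j i k ∈ ((E j').1 : Set 𝔐) := by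
    intro j j' i k hj
    refine hEmono (Nat.succ_le_of_lt hj) ?_
    change _ ∈ ((E (j + 1)).1 : Set 𝔐)
    rw [hEs]
    simp only [next, Finset.coe_union, Finset.coe_image]
    exact Or.inr ⟨⟨i, k⟩, by simp, rfl⟩
  choose N hN using fun i => hnip _ _ _ ((hX i).preimage_comp (Sum.swap : Fin (n i) ⊕ ι → ι ⊕ Fin (n i)))
  obtain ⟨J, hJ⟩ := exists_mul_pow_lt_two_pow (∑ i, N i + 1) r (∑ i, N i)
  let P : ℕ → (ι → 𝔐) → Finset (Fin J × Fin r) := fun j y =>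
    Finset.univ.filter fun p => (p.1 : ℕ) < j ∧ Sum.elim (b p.1 p.2) y ∈ X p.2
  have hP : ∀ j y p, p ∈ P j y ↔ (p.1 : ℕ) < j ∧ Sum.elim (b p.1 p.2) y ∈ X p.2 := by
    intro j y p; simp [P]
  have hPdef : ∀ j p, ((E j).1 : Set 𝔐).Definable L {y | P j y = p} := by
    intro j p
    have : {y | P j y = p} = ⋂ q : Fin J × Fin r, {y | q ∈ P j y ↔ q ∈ p} := by
      ext y; simp [Finset.ext_iff]
    rw [this]
    refine definable_iInter_of_finite fun q => ?_
    by_cases hq : (q.1 : ℕ) < j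
    · have h1 := definable_fiber (D := ((E j).1 : Set 𝔐)) (b := b q.1 q.2) (fun i => hbE _ _ _ _ hq)
        ((hX q.2).mono (empty_subset _))
      by_cases hqp : q ∈ p
      · convert h1 using 1; ext y; simp [hP, hq, hqp]
      · convert h1.compl using 1; ext y; simp [hP, hq, hqp]
    · by_cases hqp : q ∈ p
      · convert definable_empty using 1; ext y; simp [hP, hq, hqp]
      · convert definable_univ using 1; ext y; simp [hP, hq, hqp]
  let 𝒜 : ℕ → Finset (Finset (Fin J × Fin r)) := fun j => Finset.univ.filter fun p => ∃ y ∈ Y, P j y = p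
  have h𝒜 : ∀ j p, p ∈ 𝒜 j ↔ ∃ y ∈ Y, P j y = p := by intro j p; simp [𝒜]
  have hcard : ∀ j ≤ J, 2 ^ j ≤ (𝒜 j).card := by
    intro j
    induction j with
    | zero =>
      intro _
      obtain ⟨y, hy⟩ := hne
      exact Finset.card_pos.2 ⟨P 0 y, (h𝒜 _ _).2 ⟨y, hy, rfl⟩⟩
    | succ j ih =>
      intro hj
      have hres : ∀ y, (P (j + 1) y).filter (fun p => (p.1 : ℕ) < j) = P j y := by
        intro y
        ext p
        simp only [Finset.mem_filter, hP]
        constructor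
        · rintro ⟨⟨_, h⟩, h'⟩; exact ⟨h', h⟩
        · rintro ⟨h, h'⟩; exact ⟨⟨by omega, h'⟩, h⟩
      have h1 := Finset.mul_card_image_le_card_of_maps_to (s := 𝒜 (j + 1)) (t := 𝒜 j)
        (f := fun s => s.filter (fun p => (p.1 : ℕ) < j)) (by
          intro s hs
          obtain ⟨y, hy, rfl⟩ := (h𝒜 _ _).1 hs
          rw [hres]
          exact (h𝒜 _ _).2 ⟨y, hy, rfl⟩) 2 (by
          intro p hp
          obtain ⟨y, hy, rfl⟩ := (h𝒜 _ _).1 hp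
          obtain ⟨i, hi⟩ := hbad (E j).1 (E j).2 y hy
          have hdef : ∀ Z : Set (Fin (n i) ⊕ ι → 𝔐), (∅ : Set 𝔐).Definable L Z →
              ((E j).1 : Set 𝔐).Definable L {z : Fin (n i) → 𝔐 | ∃ y', Sum.elim z y' ∈
                Z ∩ ({v | v ∘ Sum.inr ∈ Y} ∩ {v | v ∘ Sum.inr ∈ {y' | P j y' = P j y}})} := by
            intro Z hZ
            refine Definable.exists_of_finite ((hZ.mono (empty_subset _)).inter (Definable.inter ?_ ?_))
            · exact (hY0.mono (hEmono (Nat.zero_le j))).preimage_comp _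
            · exact (hPdef j _).preimage_comp _
          -- The truth value of `X i` at (c_j, y) is transferred to (b_j, y') by equality of types
          -- over E_j, keeping the earlier pattern. As `y` separates b_j from c_j in the family `i`,
          -- the patterns of `y` and `y'` differ at stage j.
          have hy' : ∃ y' ∈ Y, P j y' = P j y ∧
              (Sum.elim (b j i) y' ∈ X i ↔ Sum.elim (c j i) y ∈ X i) := by
            by_cases hc : Sum.elim (c j i) y ∈ X i
            · obtain ⟨y', h, h', h''⟩ := (hBC (E j).1 (E j).2 i _ (hdef _ (hX i))).2 ⟨y, hc, hy, rfl⟩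
              exact ⟨y', h', h'', iff_of_true h hc⟩
            · obtain ⟨y', h, h', h''⟩ := (hBC (E j).1 (E j).2 i _ (hdef _ (hX i).compl)).2 ⟨y, hc, hy, rfl⟩
              exact ⟨y', h', h'', iff_of_false h hc⟩
          obtain ⟨y', hy'Y, hy'P, hy'i⟩ := hy'
          refine Nat.succ_le_of_lt (Finset.one_lt_card.2 ⟨P (j + 1) y, ?_, P (j + 1) y', ?_, ?_⟩)
          · simp only [Finset.mem_filter, h𝒜, hres, and_true]; exact ⟨y, hy, rfl⟩
          · simp only [Finset.mem_filter, h𝒜, hres, hy'P, and_true]; exact ⟨y', hy'Y, rfl⟩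
          · intro heq
            have h2 := Finset.ext_iff.1 heq (⟨j, hj⟩, i)
            simp only [hP, Nat.lt_succ_self, true_and] at h2
            have hi' : ¬ (Sum.elim (b j i) y ∈ X i ↔ Sum.elim (c j i) y ∈ X i) := fun h => by
              rcases hi with ⟨h1, h2⟩ | ⟨h1, h2⟩
              exacts [h2 (h.1 h1), h1 (h.2 h2)]
            tauto)
      rw [pow_succ']
      exact (Nat.mul_le_mul_left 2 (ih (by omega))).trans h1
  have h2 := card_shatterer_le (𝒜 J) (∑ i, N i) (by
    intro s hs
    by_contra! hlt
    -- A shattered set with more than ∑ N i points has more than `N i` points with the same second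
    -- coordinate `i`, which shatters the single family `X i`.
    rw [Finset.card_eq_sum_card_fiberwise (f := Prod.snd) (t := Finset.univ) (by simp)] at hlt
    obtain ⟨i, -, hi⟩ := Finset.exists_lt_of_sum_lt hlt
    have : Fintype.card (Fin (N i)) ≤ Fintype.card (s.filter (fun a => a.2 = i)) := by
      rw [Fintype.card_fin, Fintype.card_coe]
      exact hi.le
    obtain ⟨g⟩ := Function.Embedding.nonempty_of_card_le this
    have hgs : ∀ t, (g t).1 ∈ s ∧ (g t).1.2 = i := fun t => Finset.mem_filter.1 (g t).2
    obtain ⟨s0, hs0⟩ := hN i (fun t => b (g t).1.1 i)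
    obtain ⟨u, hu, hsu⟩ := hs (t := (Finset.univ.filter (· ∈ s0)).image fun t => (g t).1) (by
      intro x hx
      obtain ⟨t, -, rfl⟩ := Finset.mem_image.1 hx
      exact (hgs t).1)
    obtain ⟨y, hy, rfl⟩ := (h𝒜 _ _).1 hu
    refine hs0 y fun t => ?_
    have h3 : (g t).1 ∈ P J y ↔ t ∈ s0 := by
      have := Finset.ext_iff.1 hsu (g t).1
      rw [Finset.mem_inter] at this
      rw [← (and_iff_right (hgs t).1 : _ ↔ (g t).1 ∈ P J y), this]
      simp only [Finset.mem_image, Finset.mem_filter, Finset.mem_univ, true_and]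
      constructor
      · rintro ⟨t', ht', h⟩
        rwa [← g.injective (Subtype.ext h)]
      · intro h; exact ⟨t, h, rfl⟩
    rw [← h3, hP]
    have h4 : (g t).1 = ((g t).1.1, i) := Prod.ext rfl (hgs t).2
    have h5 : ((g t).1.1 : ℕ) < J := (g t).1.1.2
    rw [and_iff_right h5]
    have h6 : (Sum.elim y (b (g t).1.1 i)) ∘ Sum.swap = Sum.elim (b (g t).1.1 i) y := by
      funext z; rcases z with z | z <;> rfl
    rw [mem_preimage, h6]
    have h7 : ∀ i', i' = i → (Sum.elim (b (g t).1.1 i') y ∈ X i' ↔ Sum.elim (b (g t).1.1 i) y ∈ X i) := by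
      rintro _ rfl; rfl
    exact h7 _ (hgs t).2)
  have h3 := (hcard J le_rfl).trans h2
  simp only [Fintype.card_prod, Fintype.card_fin] at h3
  omega

/-- Types over small sets have extensions which do not split over a small set. -/
theorem Setting.exists_nsp {κbar κ lam : Cardinal.{w}} (S : Setting L 𝔐 κbar κ lam) {D B : Set 𝔐}
    (hD : #D < κbar) (hBD : B ⊆ D) (hB : #B < κ) {ι : Type} [Finite ι] (a : ι → 𝔐) :
    ∃ a', EqTp L B a' a ∧ ∃ B' ⊆ D, B ⊆ B' ∧ #B' < κ ∧ Nsp L D B' (range a') := by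
  classical
  obtain ⟨K0, f0, hK0, -, hf0⟩ := S.exists_index ι B
  choose K f hK _ hf using fun n => S.exists_index (Fin n ⊕ ι) (∅ : Set 𝔐)
  -- A finite part of the requirements on `a'` involves one `B`-definable set containing `a` and a
  -- finite list of ∅-definable families. There are fewer than κ such kinds, so the union `B'` of
  -- their finite bases is small.
  let Kind := {k : K0 // a ∈ f0 k} × List (Σ n : ULift.{w} ℕ, K n.down)
  have hKind : #Kind < κ := by
    have h1 : #(Σ n : ULift.{w} ℕ, K n.down) < κ := by
      rw [Cardinal.mk_sigma]
      refine Cardinal.sum_lt_of_isRegular S.reg (by simpa using S.aleph0_lt) fun n => hK _ ?_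
      simpa using S.reg.pos
    rw [Cardinal.mk_prod, Cardinal.lift_id, Cardinal.lift_id]
    refine Cardinal.mul_lt_of_lt S.reg.aleph0_le ((Cardinal.mk_subtype_le _).trans_lt (hK0 hB)) ?_
    exact (Cardinal.mk_list_le_max _).trans_lt (max_lt S.aleph0_lt h1)
  have hbase := fun k : Kind => S.nip.exists_finite_base (D := D) (Y := f0 k.1.1)
    (((hf0 _).2 ⟨_, rfl⟩).mono hBD) ⟨a, k.1.2⟩ (r := k.2.length) (fun i => (k.2.get i).1.down)
    (fun i => f _ (k.2.get i).2) (fun i => (hf _ _).2 ⟨_, rfl⟩)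
  choose e he hek using hbase
  let B' := B ∪ ⋃ k, (e k : Set 𝔐)
  have hB'D : B' ⊆ D := union_subset hBD (iUnion_subset he)
  have hB'κ : #B' < κ := by
    refine (Cardinal.mk_union_le _ _).trans_lt (Cardinal.add_lt_of_lt S.reg.aleph0_le hB ?_)
    rw [Cardinal.card_iUnion_lt_iff_forall_of_isRegular S.reg hKind]
    exact fun k => (Finset.finite_toSet _).lt_aleph0.trans_le S.reg.aleph0_le
  let V1 : Set (Set (ι → 𝔐)) := {Y | B.Definable L Y ∧ a ∈ Y}
  let V2 : Set (Set (ι → 𝔐)) := {Y | ∃ (n : ℕ) (X : Set (Fin n ⊕ ι → 𝔐)) (b c : Fin n → 𝔐),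
    (∅ : Set 𝔐).Definable L X ∧ (∀ i, b i ∈ D) ∧ (∀ i, c i ∈ D) ∧ EqTp L B' b c ∧
    Y = {y | Sum.elim b y ∈ X ↔ Sum.elim c y ∈ X}}
  have hV : (⋂₀ (V1 ∪ V2)).Nonempty := by
    refine exists_mem_of_fip S.sat S.aleph0_le_bar hD ?_ ?_
    · rintro Y (⟨hY, -⟩ | ⟨n, X, b, c, hX, hb, hc, -, rfl⟩)
      · exact hY.mono hBD
      · have h1 := definable_fiber (D := D) hb (hX.mono (empty_subset _))
        have h2 := definable_fiber (D := D) hc (hX.mono (empty_subset _))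
        convert (h1.inter h2).union (h1.compl.inter h2.compl) using 1
        ext y
        simp only [mem_ofPred_eq, mem_union, mem_inter_iff, mem_compl_iff]
        tauto
    · intro t ht htf
      have h1 : B.Definable L (⋂₀ (t ∩ V1)) ∧ a ∈ ⋂₀ (t ∩ V1) := by
        refine ⟨?_, fun Y hY => hY.2.2⟩
        have hfin : Finite ↑(t ∩ V1) := htf.inter_of_left V1
        rw [sInter_eq_iInter]
        exact definable_iInter_of_finite fun Y => Y.2.2.1
      obtain ⟨k0, hk0⟩ := (hf0 _).1 h1.1
      have hex : ∃ l : List (Set (ι → 𝔐)), ∀ Y, Y ∈ l ↔ Y ∈ t ∩ V2 := by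
        have hfin : (t ∩ V2).Finite := htf.inter_of_left V2
        exact ⟨hfin.toFinset.toList, fun Y => by simp⟩
      obtain ⟨l, hl⟩ := hex
      have hl2 : ∀ i : Fin l.length, l.get i ∈ V2 := fun i => ((hl _).1 (l.get_mem i)).2
      choose n X b c hX hb hc hbc hY using hl2
      choose g hg using fun i => (hf (n i) _).1 (hX i)
      let l' : List (Σ n : ULift.{w} ℕ, K n.down) := List.ofFn fun i => ⟨⟨n i⟩, g i⟩
      let k : Kind := ⟨⟨k0, by rw [hk0]; exact h1.2⟩, l'⟩
      have hlen : l'.length = l.length := by simp [l']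
      have hget : ∀ i : Fin l'.length, l'.get i = ⟨⟨n (i.cast hlen)⟩, g (i.cast hlen)⟩ := by
        intro i; simp only [l', List.get_ofFn]
      have hnk : ∀ i : Fin l'.length, (l'.get i).1.down = n (i.cast hlen) := fun i => by rw [hget]
      obtain ⟨y, hy, hyk⟩ := hek k
        (fun i => b (i.cast hlen) ∘ Fin.cast (hnk i)) (fun i => c (i.cast hlen) ∘ Fin.cast (hnk i))
        (fun i j => hb _ _) (fun i j => hc _ _) (fun i => by
          refine EqTp.comp ?_ _
          exact (hbc _).mono (fun x hx => Or.inr (mem_iUnion.2 ⟨k, hx⟩)))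
      refine ⟨y, fun Y hYt => ?_⟩
      rcases ht hYt with hY1 | hY2
      · have : y ∈ ⋂₀ (t ∩ V1) := by rw [← hk0]; exact hy
        exact this Y ⟨hYt, hY1⟩
      · obtain ⟨i, rfl⟩ := List.get_of_mem ((hl Y).2 ⟨hYt, hY2⟩)
        rw [hY i]
        have h3 := hyk (i.cast hlen.symm)
        -- The arity stored in the list `l'` equals `n i` only propositionally; this removes the
        -- casts.
        have aux : ∀ (p : Σ n : ULift.{w} ℕ, K n.down) (hp : p = ⟨⟨n i⟩, g i⟩) (z : Fin (n i) → 𝔐)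
            (hh : p.1.down = n i), (Sum.elim (z ∘ Fin.cast hh) y ∈ f _ p.2 ↔ Sum.elim z y ∈ X i) := by
          rintro _ rfl z _
          rw [← hg i]; rfl
        exact (aux _ (hget _) (b i) (hnk _)).symm.trans (h3.trans (aux _ (hget _) (c i) (hnk _)))
  obtain ⟨a', ha'⟩ := hV
  refine ⟨a', (EqTp.of_imp fun Y hY haY => ha' Y (Or.inl ⟨hY, haY⟩)).symm, B', hB'D,
    subset_union_left, hB'κ, ?_⟩
  rw [Nsp.range_iff]
  intro k b c hb hc hbc X hX
  exact ha' _ (Or.inr ⟨k, X, b, c, hX, hb, hc, hbc, rfl⟩)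

end DependentThy

namespace DependentThy

open FirstOrder.Language Set

variable {L : FirstOrder.Language.{u, v}} {𝔐 : Type w} [L.Structure 𝔐]
variable {κbar κ lam : Cardinal.{w}}

/-! ### Unique nonsplitting extensions over saturated sets -/

section Extension

theorem KSat.realize (S : Setting L 𝔐 κbar κ lam) {M B : Set 𝔐} (hM : KSat L κ M) (hB : B ⊆ M)
    (hBκ : #B < κ) {ι : Type*} [Finite ι] (a : ι → 𝔐) :
    ∃ a' : ι → 𝔐, (∀ i, a' i ∈ M) ∧ EqTp L B a' a :=
  hM.exists_finite S.sat S.reg.aleph0_le S.le_bar hB hBκ a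

/-- Every tuple of `D` has a copy in `M` with the same type over `B`, and nonsplitting makes the
truth values at the tuple those at its copy. -/
theorem Nsp.unique (S : Setting L 𝔐 κbar κ lam) {M B D : Set 𝔐} (hM : KSat L κ M) (hB : B ⊆ M)
    (hBκ : #B < κ) (hMD : M ⊆ D) {ι : Type*} {a a' : ι → 𝔐} (ha : Nsp L D B (range a))
    (ha' : Nsp L D B (range a')) (h : EqTp L M a a') : EqTp L D a a' := by
  rw [EqTp.iff_finite_params]
  intro n d hd
  obtain ⟨d', hd', hdd⟩ := hM.realize S hB hBκ d
  have h1 := range_iff.1 ha n d' d (fun i => hMD (hd' i)) hd hdd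
  have h2 := range_iff.1 ha' n d' d (fun i => hMD (hd' i)) hd hdd
  exact h1.symm.trans ((EqTp.iff_finite_params.1 h n d' hd').trans h2)

/-- The extension is forced: a formula with parameters `d` from `D` holds of it exactly when `a`
satisfies the formula at a copy of `d` in `M` over `B`. Nonsplitting over `M` makes this independent
of the copy, and copies of joint tuples make the conditions closed under intersection. -/
theorem Nsp.exists_extend (S : Setting L 𝔐 κbar κ lam) {M B D : Set 𝔐} (hM : KSat L κ M)
    (hB : B ⊆ M) (hBκ : #B < κ) (hMD : M ⊆ D) (hD : #D < κbar) {ι : Type*} [Finite ι] {a : ι → 𝔐}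
    (ha : Nsp L M B (range a)) : ∃ a' : ι → 𝔐, EqTp L M a' a ∧ Nsp L D B (range a') := by
  let V : Set (Set (ι → 𝔐)) := {Y | ∃ (γ : Type) (_ : Finite γ) (d d' : γ → 𝔐) (X : Set (γ ⊕ ι → 𝔐)),
    (∅ : Set 𝔐).Definable L X ∧ (∀ i, d i ∈ D) ∧ (∀ i, d' i ∈ M) ∧ EqTp L B d' d ∧
    Sum.elim d' a ∈ X ∧ Y = {y | Sum.elim d y ∈ X}}
  have ha2 : ∀ {γ : Type} [Finite γ] {b c : γ → 𝔐}, (∀ i, b i ∈ M) → (∀ i, c i ∈ M) → EqTp L B b c →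
      EqTp L ∅ (Sum.elim b a) (Sum.elim c a) := by
    intro γ _ b c hb hc hbc
    have := ha.eqTp hb hc hbc
    rw [← empty_union (range a), EqTp.union_range_iff] at this
    exact this.sum_swap
  have hne : (⋂₀ V).Nonempty := by
    refine exists_mem_of_directed S.sat S.aleph0_le_bar hD ?_ ?_ ?_ ?_
    · rintro _ ⟨γ, _, d, d', X, hX, hd, -, -, -, rfl⟩
      exact definable_fiber hd (hX.mono (empty_subset _))
    · exact ⟨Set.univ, Empty, inferInstance, Empty.elim, Empty.elim, Set.univ, definable_univ,
        fun i => i.elim, fun i => i.elim, EqTp.iff_finite_vars.2 (fun n f => by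
          rw [Subsingleton.elim (Empty.elim : Empty → 𝔐) Empty.elim]; exact EqTp.refl _ _), trivial, rfl⟩
    · rintro _ ⟨γ, _, d, d', X, hX, hd, hd', hdd, hmem, rfl⟩
      exact ((hdd.mono (empty_subset _)) _ hX.exists_of_finite).1 ⟨a, hmem⟩
    · rintro _ ⟨γ, _, d, d', X, hX, hd, hd', hdd, hmem, rfl⟩ _
        ⟨γ', _, e, e', X', hX', he, he', hee, hmem', rfl⟩
      obtain ⟨f, hf, hfd⟩ := hM.realize S hB hBκ (Sum.elim d e)
      refine ⟨γ ⊕ γ', inferInstance, Sum.elim d e, f,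
        {v | v ∘ (Sum.map Sum.inl id : γ ⊕ ι → _) ∈ X} ∩
        {v | v ∘ (Sum.map Sum.inr id : γ' ⊕ ι → _) ∈ X'},
        (hX.preimage_comp _).inter (hX'.preimage_comp _), ?_, hf, hfd, ⟨?_, ?_⟩, ?_⟩
      · rintro (i | i)
        exacts [hd i, he i]
      · have h1 := ha2 (fun i => hf _) hd' (((hfd.comp Sum.inl).trans (EqTp.refl B d)).trans hdd.symm)
        have h2 := (h1 X hX).2 hmem
        change _ ∘ _ ∈ X
        rw [show (Sum.elim f a ∘ Sum.map Sum.inl id : γ ⊕ ι → 𝔐) = Sum.elim (f ∘ Sum.inl) a by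
          funext z; rcases z with z | z <;> rfl]
        exact h2
      · have h1 := ha2 (fun i => hf _) he' (((hfd.comp Sum.inr).trans (EqTp.refl B e)).trans hee.symm)
        have h2 := (h1 X' hX').2 hmem'
        change _ ∘ _ ∈ X'
        rw [show (Sum.elim f a ∘ Sum.map Sum.inr id : γ' ⊕ ι → 𝔐) = Sum.elim (f ∘ Sum.inr) a by
          funext z; rcases z with z | z <;> rfl]
        exact h2
      · ext y
        simp only [mem_inter_iff, mem_ofPred_eq]
        rw [show (Sum.elim (Sum.elim d e) y ∘ Sum.map Sum.inl id : γ ⊕ ι → 𝔐) = Sum.elim d y by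
            funext z; rcases z with z | z <;> rfl,
          show (Sum.elim (Sum.elim d e) y ∘ Sum.map Sum.inr id : γ' ⊕ ι → 𝔐) = Sum.elim e y by
            funext z; rcases z with z | z <;> rfl]
  obtain ⟨a', ha'⟩ := hne
  refine ⟨a', ?_, ?_⟩
  · refine (EqTp.of_imp fun Y hY haY => ?_).symm
    obtain ⟨k, b, X, hb, hX, rfl⟩ := definable_iff_fiber.1 hY
    exact ha' _ ⟨Fin k, inferInstance, b, b, X, hX, fun i => hMD (hb i), hb, EqTp.refl _ _, haY, rfl⟩
  · rw [range_iff]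
    intro k b c hb hc hbc
    refine EqTp.of_imp fun X hX hbX => by_contra fun hcX => ?_
    obtain ⟨c', hc', hcc⟩ := hM.realize S hB hBκ c
    by_cases h : Sum.elim c' a ∈ X
    · exact hcX (ha' _ ⟨Fin k, inferInstance, c, c', X, hX, hc, hc', hcc, h, rfl⟩)
    · exact ha' _ ⟨Fin k, inferInstance, b, c', Xᶜ, hX.compl, hb, hc', hcc.trans hbc.symm, h, rfl⟩ hbX

end Extension

/-! ### Morley sequences -/

section Morley

variable {ι : Type}

/-- The entries of the tuples `d j` for `j < i`. -/
def prev (d : ℕ → ι → 𝔐) (i : ℕ) : Set 𝔐 := ⋃ j < i, range (d j)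

theorem mem_prev {d : ℕ → ι → 𝔐} {i j : ℕ} (h : j < i) (k : ι) : d j k ∈ prev d i :=
  mem_biUnion (show j ∈ {j | j < i} from h) (mem_range_self k)

theorem prev_succ (d : ℕ → ι → 𝔐) (i : ℕ) : prev d (i + 1) = prev d i ∪ range (d i) := by
  ext x
  simp only [prev, mem_iUnion, mem_union, Nat.lt_succ_iff_lt_or_eq]
  constructor
  · rintro ⟨j, hj | rfl, h⟩
    exacts [Or.inl ⟨j, hj, h⟩, Or.inr h]
  · rintro (⟨j, hj, h⟩ | h)
    exacts [⟨j, Or.inl hj, h⟩, ⟨i, Or.inr rfl, h⟩]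

theorem prev_subset {d : ℕ → ι → 𝔐} {D : Set 𝔐} (h : ∀ i k, d i k ∈ D) (i : ℕ) : prev d i ⊆ D := by
  simp only [prev, iUnion_subset_iff, range_subset_iff]
  exact fun j _ k => h j k

/-- Recursion along ℕ in which the next tuple may depend on the finite set of entries chosen before
it. -/
theorem exists_seq_prev [Finite ι] {M : Set 𝔐} {Q : ℕ → Set 𝔐 → (ι → 𝔐) → Prop}
    (h : ∀ i (e : Set 𝔐), e.Finite → e ⊆ M → ∃ x : ι → 𝔐, (∀ k, x k ∈ M) ∧ Q i e x) :
    ∃ d : ℕ → ι → 𝔐, (∀ i k, d i k ∈ M) ∧ ∀ i, Q i (prev d i) (d i) := by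
  choose x hxM hx using h
  let E : ℕ → {e : Set 𝔐 // e.Finite ∧ e ⊆ M} := fun i => Nat.rec ⟨∅, finite_empty, empty_subset _⟩
    (fun i e => ⟨e.1 ∪ range (x i e.1 e.2.1 e.2.2), e.2.1.union (finite_range _),
      union_subset e.2.2 (range_subset_iff.2 (hxM _ _ _ _))⟩) i
  let d : ℕ → ι → 𝔐 := fun i => x i (E i).1 (E i).2.1 (E i).2.2
  have hE : ∀ i, (E i).1 = prev d i := by
    intro i
    induction i with
    | zero => simp [E, prev]
    | succ i ih => rw [prev_succ, ← ih]
  refine ⟨d, fun i k => hxM _ _ _ _ _, fun i => ?_⟩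
  rw [← hE]
  exact hx _ _ _ _

/-- The concatenation of the first `k` tuples of a sequence. -/
def concat (d : ℕ → ι → 𝔐) (k : ℕ) : Fin k × ι → 𝔐 := fun p => d p.1 p.2

/-- Since `a` does not split over `B`, equality of the types of the two initial segments over `B`
persists when `a` is appended to both; the next terms look like `a` over their own initial segments.
-/
theorem concat_step {D B : Set 𝔐} (hBD : B ⊆ D) {d d' : ℕ → ι → 𝔐} {k : ℕ} {a : ι → 𝔐}
    (ha : Nsp L D B (range a)) (hd : ∀ i < k, ∀ j, d i j ∈ D) (hd' : ∀ i < k, ∀ j, d' i j ∈ D)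
    (hda : EqTp L (B ∪ prev d k) (d k) a) (hda' : EqTp L (B ∪ prev d' k) (d' k) a)
    (h : EqTp L B (concat d k) (concat d' k)) :
    EqTp L B (concat d (k + 1)) (concat d' (k + 1)) := by
  have h1 := ha.eqTp_union hBD (fun p : Fin k × ι => hd _ p.1.2 p.2)
    (fun p => hd' _ p.1.2 p.2) h
  rw [union_comm, EqTp.union_range_iff] at h1
  have key : ∀ {e : ℕ → ι → 𝔐}, EqTp L (B ∪ prev e k) (e k) a →
      EqTp L B (Sum.elim (concat e k) (e k)) (Sum.elim (concat e k) a) := by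
    intro e he
    rw [← EqTp.union_range_iff]
    refine he.mono (union_subset_union_right _ ?_)
    rintro _ ⟨p, rfl⟩
    exact mem_prev p.1.2 _
  have h2 := (key hda).trans (h1.sum_swap.trans (key hda').symm)
  have h3 := h2.comp (fun p : Fin (k + 1) × ι =>
    if hp : (p.1 : ℕ) < k then (Sum.inl (⟨p.1, hp⟩, p.2) : (Fin k × ι) ⊕ ι) else Sum.inr p.2)
  have aux : ∀ e : ℕ → ι → 𝔐, (Sum.elim (concat e k) (e k)) ∘ (fun p : Fin (k + 1) × ι =>
    if hp : (p.1 : ℕ) < k then (Sum.inl (⟨p.1, hp⟩, p.2) : (Fin k × ι) ⊕ ι) else Sum.inr p.2) =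
      concat e (k + 1) := by
    intro e
    funext p
    by_cases hp : (p.1 : ℕ) < k
    · simp [hp, concat]
    · have : (p.1 : ℕ) = k := by have := p.1.2; omega
      simp [concat, this]
  rwa [aux, aux] at h3

/-- A sequence whose members look alternatively like `a` or `a'`, which have the same
Morley sequences, is indiscernible. -/
theorem indisc_of_mixed {D B : Set 𝔐} (hBD : B ⊆ D) {a a' : ι → 𝔐} (ha : Nsp L D B (range a))
    (ha' : Nsp L D B (range a')) {c c' : ℕ → ι → 𝔐} {K : ℕ} (hc : ∀ i k, c i k ∈ D)
    (hc' : ∀ i k, c' i k ∈ D)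
    (hca : ∀ i < K, EqTp L (B ∪ prev c i) (c i) a) (hca' : ∀ i < K, EqTp L (B ∪ prev c' i) (c' i) a')
    (hcc : ∀ k ≤ K, EqTp L B (concat c k) (concat c' k)) {d : ℕ → ι → 𝔐} (hd : ∀ i k, d i k ∈ D)
    (hda : ∀ i < K, EqTp L (B ∪ prev d i) (d i) a ∨ EqTp L (B ∪ prev d i) (d i) a') :
    Indisc L B d K := by
  -- The type of an initial segment does not depend on which terms look like `a` and which like
  -- `a'`: at each step one compares with `c` or with `c'`, and these have initial segments of the
  -- same type.
  have key : ∀ (k : ℕ) (e : ℕ → ι → 𝔐), k ≤ K → (∀ i k, e i k ∈ D) →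
      (∀ i < k, EqTp L (B ∪ prev e i) (e i) a ∨ EqTp L (B ∪ prev e i) (e i) a') →
      EqTp L B (concat e k) (concat c k) := by
    intro k e
    induction k with
    | zero =>
      intro _ _ _
      rw [show concat e 0 = concat c 0 from funext fun p => p.1.elim0]
      exact EqTp.refl _ _
    | succ k ih =>
      intro hk he hea
      have h1 := ih (by omega) he (fun i hi => hea i (by omega))
      rcases hea k (by omega) with h | h
      · exact concat_step hBD ha (fun i _ j => he i j) (fun i _ j => hc i j) h (hca k (by omega)) h1
      · refine (concat_step hBD ha' (fun i _ j => he i j) (fun i _ j => hc' i j) h (hca' k (by omega))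
          (h1.trans (hcc k (by omega)))).trans (hcc _ hk).symm
  have key2 : ∀ (k : ℕ) (f : Fin k → ℕ), StrictMono f → (∀ i, f i < K) →
      EqTp L B (fun p : Fin k × ι => d (f p.1) p.2) (concat c k) := by
    intro k f hf hfK
    have hk : k ≤ K := by
      have := Fintype.card_le_of_injective (fun i => (⟨f i, hfK i⟩ : Fin K))
        (fun i j h => hf.injective (by simpa using h))
      simpa using this
    -- The increasing subsequence, continued beyond its length by the irrelevant value `d 0`.
    let e : ℕ → ι → 𝔐 := fun i => if h : i < k then d (f ⟨i, h⟩) else d 0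
    have he : ∀ i (h : i < k), e i = d (f ⟨i, h⟩) := fun i h => by simp [e, h]
    have h1 := key k e hk (fun i j => by simp only [e]; split_ifs <;> exact hd _ _) (fun i hi => by
      have hp : prev e i ⊆ prev d (f ⟨i, hi⟩) := by
        simp only [prev, iUnion_subset_iff]
        intro j hj
        rw [he j (hj.trans hi)]
        exact subset_biUnion_of_mem (u := fun j => range (d j))
          (show f ⟨j, _⟩ ∈ {x | x < f ⟨i, hi⟩} from hf hj)
      rw [he i hi]
      rcases hda _ (hfK ⟨i, hi⟩) with h | h
      · exact Or.inl (h.mono (union_subset_union_right _ hp))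
      · exact Or.inr (h.mono (union_subset_union_right _ hp)))
    convert h1 using 1
    funext p
    simp only [concat]
    rw [he _ p.1.2]
  intro k f g hf hg hfK hgK
  exact (key2 k f hf hfK).trans (key2 k g hg hgK).symm

theorem indisc_of_morley {D B : Set 𝔐} (hBD : B ⊆ D) {a : ι → 𝔐} (ha : Nsp L D B (range a))
    {d : ℕ → ι → 𝔐} {K : ℕ} (hd : ∀ i k, d i k ∈ D)
    (hda : ∀ i < K, EqTp L (B ∪ prev d i) (d i) a) : Indisc L B d K :=
  indisc_of_mixed hBD ha ha hd hd hda hda (fun _ _ => EqTp.refl _ _) hd fun i hi => Or.inl (hda i hi)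

end Morley

/-! ### Counting small-nonsplitting types -/

section Counting

/-- For each of the at most λ cardinal bounds θ < κ there are at most λ^θ ≤ λ subsets. -/
theorem Setting.mk_small_subsets_le (S : Setting L 𝔐 κbar κ lam) {M : Set 𝔐} (hM : #M ≤ lam) :
    #{B : Set 𝔐 // B ⊆ M ∧ #B < κ} ≤ lam := by
  have h1 : {B : Set 𝔐 | B ⊆ M ∧ #B < κ} ⊆
      ⋃ i : κ.ord.ToType, {B : Set 𝔐 | B ⊆ M ∧ #B ≤ #(Set.Iio i)} := by
    rintro B ⟨hB, hBκ⟩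
    have : (#B).ord < Ordinal.type (α := κ.ord.ToType) (· < ·) := by
      rw [Ordinal.type_toType]
      exact Cardinal.ord_lt_ord.2 hBκ
    refine mem_iUnion.2 ⟨Ordinal.enum (α := κ.ord.ToType) (· < ·) ⟨(#B).ord, this⟩, hB, ?_⟩
    change #B ≤ (Ordinal.typein (α := κ.ord.ToType) (· < ·) (Ordinal.enum _ _)).card
    rw [Ordinal.typein_enum, Cardinal.card_ord]
  change #{B : Set 𝔐 | B ⊆ M ∧ #B < κ} ≤ lam
  refine (Cardinal.mk_le_mk_of_subset h1).trans ((Cardinal.mk_iUnion_le _).trans ?_)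
  refine Cardinal.mul_le_of_le S.aleph0_le ?_ (ciSup_le' fun i => ?_)
  · rw [Cardinal.mk_toType, Cardinal.card_ord]; exact S.le_lam
  · refine (Cardinal.mk_bounded_subset_le M _).trans ?_
    have hi : #(Set.Iio i) < κ := (Cardinal.mk_Iio_lt i (by simp)).trans_eq (by simp)
    refine (Cardinal.power_le_power_right (max_le hM S.aleph0_le)).trans ?_
    rcases eq_or_ne #(Set.Iio i) 0 with h | h
    · rw [h, power_zero]; exact one_lt_aleph0.le.trans S.aleph0_le
    · exact (S.pow _ h hi).symm.le

variable {ι : Type} [Finite ι]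

theorem KSat.exists_morley (S : Setting L 𝔐 κbar κ lam) {M B : Set 𝔐} (hM : KSat L κ M)
    (hB : B ⊆ M) (hBκ : #B < κ) (a : ℕ → ι → 𝔐) : ∃ d : ℕ → ι → 𝔐, (∀ i k, d i k ∈ M) ∧
      ∀ i, EqTp L (B ∪ prev d i) (d i) (a i) :=
  exists_seq_prev (Q := fun i e x => EqTp L (B ∪ e) x (a i)) fun _ _ he heM =>
    hM.realize S (union_subset hB heM) ((Cardinal.mk_union_le _ _).trans_lt
      (Cardinal.add_lt_of_lt S.reg.aleph0_le hBκ (he.lt_aleph0.trans_le S.reg.aleph0_le))) _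

/-- A nonsplitting type over a saturated set is determined by its Morley sequences. -/
theorem Nsp.eqTp_of_morley (S : Setting L 𝔐 κbar κ lam) {M B : Set 𝔐} (hM : KSat L κ M)
    (hB : B ⊆ M) (hBκ : #B < κ) {a a' : ι → 𝔐} (ha : Nsp L M B (range a))
    (ha' : Nsp L M B (range a')) {c c' : ℕ → ι → 𝔐} (hc : ∀ i k, c i k ∈ M) (hc' : ∀ i k, c' i k ∈ M)
    (hca : ∀ i, EqTp L (B ∪ prev c i) (c i) a) (hca' : ∀ i, EqTp L (B ∪ prev c' i) (c' i) a')
    (hcc : ∀ k, EqTp L B (concat c k) (concat c' k)) : EqTp L M a a' := by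
  classical
  refine EqTp.of_imp fun Y hY haY => by_contra fun haY' => ?_
  obtain ⟨n, e, X, he, hX, rfl⟩ := definable_iff_fiber.1 hY
  obtain ⟨K, hK⟩ := S.nip.exists_alternation_bound hX
  -- If `a` and `a'` differ on the instance of `X` at `e`, imitate them alternately over `B` and `e`
  -- inside `M`. The sequence is indiscernible over `B`, yet `X` at `e` alternates along it.
  obtain ⟨d, hd, hda⟩ := hM.exists_morley S (B := B ∪ range e)
    (union_subset hB (range_subset_iff.2 he)) (mk_union_range_lt S.reg.aleph0_le hBκ e)
    (fun i => if Even i then a else a')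
  have hind : Indisc L B d K := by
    refine indisc_of_mixed hB ha ha' hc hc' (fun i _ => hca i) (fun i _ => hca' i) (fun k _ => hcc k)
      hd fun i _ => ?_
    have h := (hda i).mono (union_subset_union_left (prev d i) subset_union_left)
    by_cases hi : Even i
    · exact Or.inl (by simpa [hi] using h)
    · exact Or.inr (by simpa [hi] using h)
  refine hK d (hind.mono (empty_subset _)) e True fun i _ => ?_
  have h := ((hda i).mono (union_subset_union_left (prev d i) subset_union_right)).mono
    subset_union_left
  have h2 := (h _ (definable_fiber (D := range e) (fun i => mem_range_self i)
    (hX.mono (empty_subset _)))).trans Iff.rfl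
  change (Sum.elim e (d i) ∈ X ↔ _) at h2
  rw [h2]
  by_cases hi : Even i
  · simpa [hi] using haY
  · simpa [hi] using haY'

/-- There are few small-nonsplitting types over a saturated set. -/
theorem KSat.exists_representatives (S : Setting L 𝔐 κbar κ lam) {M : Set 𝔐} (hM : KSat L κ M)
    (hMl : #M ≤ lam) (ι : Type) [Finite ι] :
    ∃ (R : Type w) (B : R → Set 𝔐) (a : R → ι → 𝔐), #R ≤ lam ∧
      (∀ r, B r ⊆ M ∧ #(B r) < κ ∧ Nsp L M (B r) (range (a r))) ∧
      ∀ B' ⊆ M, #B' < κ → ∀ a' : ι → 𝔐, Nsp L M B' (range a') →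
        ∃ r, B r = B' ∧ EqTp L M (a r) a' := by
  classical
  let Sm := {B : Set 𝔐 // B ⊆ M ∧ #B < κ}
  choose K f hKκ _ hf using fun (B : Sm) (n : ℕ) => S.exists_index (Fin n × ι) B.1
  -- A code is the type over `B` of a Morley sequence, recorded through the indexing of the
  -- `B`-definable sets; for each `B` there are at most λ codes, as 2^θ ≤ λ for θ < κ.
  let Code : Sm → Type w := fun B => Set (Σ n : ULift.{w} ℕ, K B n.down)
  have hCode : ∀ B, #(Code B) ≤ lam := by
    intro B
    rw [Cardinal.mk_set]
    refine S.two_pow_le ?_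
    rw [Cardinal.mk_sigma]
    exact Cardinal.sum_lt_of_isRegular S.reg (by simpa using S.aleph0_lt) fun n => hKκ _ _ B.2.2
  let P : (Σ B : Sm, Code B) → (ι → 𝔐) → Prop := fun p a => Nsp L M p.1.1 (range a) ∧
    ∃ c : ℕ → ι → 𝔐, (∀ i k, c i k ∈ M) ∧ (∀ i, EqTp L (p.1.1 ∪ prev c i) (c i) a) ∧
      p.2 = {z | concat c z.1.down ∈ f p.1 z.1.down z.2}
  let R := {p : Σ B : Sm, Code B // ∃ a, P p a}
  choose a ha using fun r : R => r.2
  refine ⟨R, fun r => r.1.1.1, a, ?_, fun r => ⟨r.1.1.2.1, r.1.1.2.2, (ha r).1⟩, ?_⟩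
  · refine (Cardinal.mk_subtype_le _).trans ?_
    rw [Cardinal.mk_sigma]
    refine (Cardinal.sum_le_mk_mul_iSup _).trans ?_
    exact Cardinal.mul_le_of_le S.aleph0_le (S.mk_small_subsets_le hMl) (ciSup_le' hCode)
  · intro B' hB' hBκ a' ha'
    obtain ⟨c, hc, hca⟩ := hM.exists_morley S hB' hBκ (fun _ => a')
    let r : R := ⟨⟨⟨B', hB', hBκ⟩, {z | concat c z.1.down ∈ f ⟨B', hB', hBκ⟩ z.1.down z.2}⟩,
      a', ha', c, hc, hca, rfl⟩
    refine ⟨r, rfl, ?_⟩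
    obtain ⟨c', hc', hca', heq⟩ := (ha r).2
    refine Nsp.eqTp_of_morley S hM hB' hBκ (ha r).1 ha' hc' hc hca' hca fun k X hX => ?_
    obtain ⟨z, rfl⟩ := (hf ⟨B', hB', hBκ⟩ k X).1 hX
    exact (Set.ext_iff.1 heq ⟨⟨k⟩, z⟩).symm

end Counting

end DependentThy

namespace DependentThy

open FirstOrder.Language Set

variable {L : FirstOrder.Language.{u, v}} {𝔐 : Type w} [L.Structure 𝔐]
variable {κbar κ lam : Cardinal.{w}}

/-! ### Constructions along well-orders -/

section Con

variable (L) in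
/-- Constructibility over `A` along an arbitrary well-order. -/
def Con (κ : Cardinal.{w}) (A C : Set 𝔐) : Prop :=
  ∃ (I : Type w) (r : I → I → Prop) (_ : IsWellOrder I r) (a : I → 𝔐), C = A ∪ range a ∧
    ∀ i, ∃ B ⊆ A ∪ a '' {j | r j i}, #B < κ ∧ Nsp L (A ∪ a '' {j | r j i}) B {a i}

/-- Ordinals are exchanged for arbitrary well-orders, so that constructions can be concatenated by
lexicographic sums without ordinal arithmetic. -/
theorem nspLE_iff_con {A C : Set 𝔐} : NspLE L κ A C ↔ Con L κ A C := by
  have hU : ∀ x : 𝔐, range (fun _ : Unit => x) = {x} := fun x => range_const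
  constructor
  · rintro ⟨𝒜, rfl⟩
    let e : Set.Iio 𝒜.length ≃o 𝒜.length.ToType := Ordinal.ToType.mk
    have hst : ∀ i, stage A 𝒜.elt (e.symm i) = A ∪ (fun i => 𝒜.elt (e.symm i)) '' {j | j < i} := by
      intro i
      unfold stage
      congr 1
      ext z
      constructor
      · rintro ⟨γ, hγ, rfl⟩
        refine ⟨e γ, ?_, by simp⟩
        rw [mem_ofPred_eq, ← e.symm.lt_iff_lt, e.symm_apply_apply]
        exact hγ
      · rintro ⟨j, hj, rfl⟩
        exact ⟨e.symm j, e.symm.lt_iff_lt.2 hj, rfl⟩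
    refine ⟨𝒜.length.ToType, (· < ·), inferInstance, fun i => 𝒜.elt (e.symm i), ?_, fun i => ?_⟩
    · unfold stage
      congr 1
      ext z
      constructor
      · rintro ⟨γ, hγ, rfl⟩
        exact ⟨e γ, by simp⟩
      · rintro ⟨j, rfl⟩
        exact ⟨e.symm j, (e.symm j).2, rfl⟩
    · refine ⟨𝒜.base (e.symm i), ?_, 𝒜.card_base_lt _, ?_⟩
      · rw [← hst]; exact 𝒜.base_subset _
      · have := 𝒜.doesNotSplit (e.symm i)
        rw [Nsp.doesNotSplit_iff, hU] at this
        rw [← hst]; exact this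
  · rintro ⟨I, r, _, a, rfl, h⟩
    choose B hB hBκ hN using h
    let e := Ordinal.enum r
    have hst : ∀ β : Set.Iio (Ordinal.type r), stage A (fun β : Set.Iio (Ordinal.type r) => a (e β)) β = A ∪ a '' {j | r j (e β)} := by
      intro β
      unfold stage
      congr 1
      ext z
      constructor
      · rintro ⟨γ, hγ, rfl⟩
        exact ⟨e γ, e.map_rel_iff.2 hγ, rfl⟩
      · rintro ⟨j, hj, rfl⟩
        refine ⟨e.symm j, ?_, by simp⟩
        have : r (e (e.symm j)) (e β) := by simpa using hj
        exact e.map_rel_iff.1 this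
    refine ⟨⟨Ordinal.type r, fun β => a (e β), fun β => B (e β), ?_, fun β => hBκ _, ?_⟩, ?_⟩
    · intro β
      rw [hst]; exact hB _
    · intro β
      rw [Nsp.doesNotSplit_iff, hU, hst]; exact hN _
    · unfold stage
      congr 1
      ext z
      constructor
      · rintro ⟨j, rfl⟩
        exact ⟨e.symm j, (e.symm j).2, by simp⟩
      · rintro ⟨γ, hγ, rfl⟩
        exact ⟨e γ, rfl⟩

theorem Con.subset {A C : Set 𝔐} (h : Con L κ A C) : A ⊆ C := by
  obtain ⟨I, r, _, a, rfl, -⟩ := h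
  exact subset_union_left

theorem Con.refl (A : Set 𝔐) : Con L κ A A :=
  ⟨PEmpty, emptyRelation, inferInstance, PEmpty.elim, by rw [range_eq_empty, union_empty], fun i => i.elim⟩

/-- The entries are added one at a time; by `Nsp.split` each has a nonsplitting type once the
earlier entries are put into its base. -/
theorem Con.of_finite (hκ : ℵ₀ ≤ κ) {D B : Set 𝔐} (hB : B ⊆ D) (hBκ : #B < κ) {ι : Type*} [Finite ι]
    {d : ι → 𝔐} (hd : Nsp L D B (range d)) : Con L κ D (D ∪ range d) := by
  obtain ⟨n, ⟨e⟩⟩ := Finite.exists_equiv_fin ι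
  let a : ULift.{w} (Fin n) → 𝔐 := fun i => d (e.symm i.down)
  have ha : range a = range d := by
    ext x
    constructor
    · rintro ⟨i, rfl⟩; exact ⟨_, rfl⟩
    · rintro ⟨i, rfl⟩; exact ⟨⟨e i⟩, by simp [a]⟩
  refine ⟨ULift.{w} (Fin n), (· < ·), inferInstance, a, by rw [ha], fun i => ?_⟩
  refine ⟨B ∪ a '' {j | j < i}, union_subset_union_left _ hB, ?_, ?_⟩
  · exact (Cardinal.mk_union_le _ _).trans_lt (Cardinal.add_lt_of_lt hκ hBκ
      ((Set.toFinite _).lt_aleph0.trans_le hκ))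
  · refine Nsp.split (hd.mono Subset.rfl Subset.rfl ?_)
    rw [← ha]
    exact union_subset (image_subset_range _ _) (singleton_subset_iff.2 ⟨i, rfl⟩)

theorem Sigma.lex_wf {ι : Type*} {α : ι → Type*} {r : ι → ι → Prop} {s : ∀ i, α i → α i → Prop}
    (hr : WellFounded r) (hs : ∀ i, WellFounded (s i)) : WellFounded (Sigma.Lex r s) := by
  have h : ∀ i (a : α i), Acc (Sigma.Lex r s) ⟨i, a⟩ := by
    intro i
    induction i using hr.induction with
    | _ i ih =>
      intro a
      induction a using (hs i).induction with
      | _ a iha =>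
        constructor
        rintro ⟨j, b⟩ hlt
        cases hlt with
        | left _ _ h => exact ih j h b
        | right _ _ h => exact iha b h
  exact ⟨fun ⟨i, a⟩ => h i a⟩

/-- Unions of well-ordered chains of constructions. -/
theorem Con.iUnion {I : Type w} {r : I → I → Prop} [hI : IsWellOrder I r] {A : Set 𝔐} {C : I → Set 𝔐}
    (h : ∀ i, Con L κ (A ∪ ⋃ j, ⋃ (_ : r j i), C j) ((A ∪ ⋃ j, ⋃ (_ : r j i), C j) ∪ C i)) :
    Con L κ A (A ∪ ⋃ i, C i) := by
  choose J s hs a ha hN using h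
  -- `C j` may contain points of earlier stages besides those listed by `a j`; by well-founded
  -- induction the unions nevertheless agree.
  have hD : ∀ i, A ∪ ⋃ j, ⋃ (_ : r j i), C j = A ∪ ⋃ j, ⋃ (_ : r j i), range (a j) := by
    intro i
    induction i using hI.wf.induction with
    | _ i ih =>
      apply subset_antisymm
      · refine union_subset subset_union_left (iUnion₂_subset fun j hj => ?_)
        have h1 : C j ⊆ _ ∪ range (a j) := subset_union_right.trans (ha j).subset
        refine h1.trans (union_subset ?_ ?_)
        · rw [ih j hj]
          exact union_subset_union_right _ (iUnion₂_subset fun k hk =>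
            subset_iUnion₂_of_subset k (_root_.trans hk hj) Subset.rfl)
        · exact fun x hx => Or.inr (mem_iUnion₂.2 ⟨j, hj, hx⟩)
      · refine union_subset subset_union_left (iUnion₂_subset fun j hj => ?_)
        have h1 : range (a j) ⊆ _ ∪ C j := subset_union_right.trans (ha j).symm.subset
        refine h1.trans (union_subset (union_subset_union_right _ (iUnion₂_subset fun k hk =>
            subset_iUnion₂_of_subset k (_root_.trans hk hj) Subset.rfl)) ?_)
        exact fun x hx => Or.inr (mem_iUnion₂.2 ⟨j, hj, hx⟩)
  let b : (Σ i, J i) → 𝔐 := fun p => a p.1 p.2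
  refine ⟨Σ i, J i, Sigma.Lex r s, { wf := Sigma.lex_wf hI.wf fun i => (hs i).wf }, b, ?_, ?_⟩
  · have hb : range b = ⋃ i, range (a i) := by
      ext x; simp [b]
    rw [hb]
    apply subset_antisymm
    · refine union_subset subset_union_left (iUnion_subset fun j => ?_)
      have h1 : C j ⊆ _ ∪ range (a j) := subset_union_right.trans (ha j).subset
      refine h1.trans (union_subset ?_ ?_)
      · rw [hD]
        exact union_subset_union_right _ (iUnion₂_subset fun k _ => subset_iUnion (fun i => range (a i)) k)
      · exact subset_union_of_subset_right (subset_iUnion (fun i => range (a i)) j) _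
    · refine union_subset subset_union_left (iUnion_subset fun j => ?_)
      have h1 : range (a j) ⊆ _ ∪ C j := subset_union_right.trans (ha j).symm.subset
      refine h1.trans (union_subset ?_ ?_)
      · exact union_subset_union_right _ (iUnion₂_subset fun k _ => subset_iUnion C k)
      · exact subset_union_of_subset_right (subset_iUnion C j) _
  · rintro ⟨i, p⟩
    have hst : A ∪ b '' {q | Sigma.Lex r s q ⟨i, p⟩} =
        (A ∪ ⋃ j, ⋃ (_ : r j i), C j) ∪ a i '' {q | s i q p} := by
      rw [hD, union_assoc]
      congr 1
      ext x
      constructor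
      · rintro ⟨⟨j, q⟩, hq, rfl⟩
        cases hq with
        | left _ _ h => exact Or.inl (mem_iUnion₂.2 ⟨j, h, mem_range_self q⟩)
        | right _ _ h => exact Or.inr ⟨q, h, rfl⟩
      · rintro (hx | ⟨q, hq, rfl⟩)
        · obtain ⟨j, hj, q, rfl⟩ := mem_iUnion₂.1 hx
          exact ⟨⟨j, q⟩, Sigma.Lex.left _ _ hj, rfl⟩
        · exact ⟨⟨i, q⟩, Sigma.Lex.right _ _ hq, rfl⟩
    rw [hst]
    exact hN i p

theorem Con.trans {A C E : Set 𝔐} (h : Con L κ A C) (h' : Con L κ C E) : Con L κ A E := by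
  let F : ULift.{w} Bool → Set 𝔐 := fun b => if b.down then E else C
  have h1 := Con.iUnion (L := L) (κ := κ) (r := fun a b : ULift.{w} Bool => a < b) (A := A) (C := F) (by
    have hf : (A ∪ ⋃ j, ⋃ (_ : j < (⟨false⟩ : ULift.{w} Bool)), F j) = A := by
      refine union_eq_left.2 (iUnion₂_subset fun j hj => ?_)
      rcases j with ⟨_ | _⟩
      · exact absurd hj (lt_irrefl _)
      · exact absurd hj (by rw [ULift.up_lt]; decide)
    have ht : (A ∪ ⋃ j, ⋃ (_ : j < (⟨true⟩ : ULift.{w} Bool)), F j) = C := by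
      apply subset_antisymm
      · refine union_subset h.subset (iUnion₂_subset fun j hj => ?_)
        rcases j with ⟨_ | _⟩
        · simp [F]
        · exact absurd hj (lt_irrefl _)
      · refine subset_union_of_subset_right ?_ _
        refine subset_iUnion₂_of_subset ⟨false⟩ (by rw [ULift.up_lt]; decide) ?_
        simp [F]
    rintro ⟨_ | _⟩
    · rw [hf]; simpa [F, union_eq_right.2 h.subset] using h
    · rw [ht]; simpa [F, union_eq_right.2 h'.subset] using h')
  convert h1 using 1
  apply subset_antisymm
  · refine subset_union_of_subset_right (subset_iUnion_of_subset ⟨true⟩ (by simp [F])) _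
  · refine union_subset (h.subset.trans h'.subset) (iUnion_subset ?_)
    rintro ⟨_ | _⟩
    · simpa [F] using h'.subset
    · simp [F]

/-- Close the indices used by `S` under the dependence of a step on its base. The closure `Λ` is
small, and the part in `A` of the bases met, with `S ∩ A`, is a small set `B0`. Two tuples of `A`
with the same type over `B0` keep the same type when the elements indexed by `Λ` are added one after
the other in the order of the construction. -/
theorem Con.sNsp (hκ : κ.IsRegular) {A C : Set 𝔐} (h : Con L κ A C) : SNsp L κ A C := by
  classical
  obtain ⟨I, r, hI, a, rfl, h⟩ := h
  choose B hB hBκ hN using h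
  have hsup : ∀ i, ∃ Γ : Set I, #Γ < κ ∧ (∀ j ∈ Γ, r j i) ∧ B i ⊆ A ∪ a '' Γ := by
    intro i
    have : ∀ x : ↑(B i \ A), ∃ j, r j i ∧ a j = x := by
      rintro ⟨x, hx, hxA⟩
      rcases hB i hx with h | ⟨j, hj, rfl⟩
      exacts [absurd h hxA, ⟨j, hj, rfl⟩]
    choose g hg hga using this
    refine ⟨range g, mk_range_le.trans_lt ((Cardinal.mk_le_mk_of_subset sdiff_subset).trans_lt (hBκ i)), ?_, ?_⟩
    · rintro _ ⟨x, rfl⟩; exact hg x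
    · intro x hx
      by_cases hxA : x ∈ A
      · exact Or.inl hxA
      · exact Or.inr ⟨g ⟨x, hx, hxA⟩, mem_range_self _, hga _⟩
  choose Γ hΓκ hΓr hΓB using hsup
  -- The steps on which step `i` depends, directly or not. By well-founded induction and regularity
  -- of κ there are fewer than κ of them.
  let hull : I → Set I := fun i => {j | Relation.ReflTransGen (fun x y => y ∈ Γ x) i j}
  have hhull : ∀ i, #(hull i) < κ := by
    intro i
    induction i using hI.wf.induction with
    | _ i ih =>
      have h1 : hull i ⊆ {i} ∪ ⋃ j : Γ i, hull j := by
        intro k hk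
        rcases Relation.ReflTransGen.cases_head hk with h | ⟨j, hj, hjk⟩
        · exact Or.inl h.symm
        · exact Or.inr (mem_iUnion.2 ⟨⟨j, hj⟩, hjk⟩)
      refine (Cardinal.mk_le_mk_of_subset h1).trans_lt ((Cardinal.mk_union_le _ _).trans_lt
        (Cardinal.add_lt_of_lt hκ.aleph0_le ?_ ?_))
      · simpa using one_lt_aleph0.trans_le hκ.aleph0_le
      · rw [Cardinal.card_iUnion_lt_iff_forall_of_isRegular hκ (hΓκ i)]
        exact fun j => ih j (hΓr i j j.2)
  intro S hS hSκ
  have hpre : ∀ x : ↑(S \ A), ∃ j, a j = x := by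
    rintro ⟨x, hx, hxA⟩
    rcases hS hx with h | h
    exacts [absurd h hxA, h]
  choose g hg using hpre
  let Λ : Set I := ⋃ x, hull (g x)
  have hΛκ : #Λ < κ := by
    rw [Cardinal.card_iUnion_lt_iff_forall_of_isRegular hκ
      ((Cardinal.mk_le_mk_of_subset sdiff_subset).trans_lt hSκ)]
    exact fun x => hhull _
  have hΛ : ∀ i ∈ Λ, Γ i ⊆ Λ := by
    intro i hi j hj
    obtain ⟨x, hx⟩ := mem_iUnion.1 hi
    exact mem_iUnion.2 ⟨x, Relation.ReflTransGen.tail hx hj⟩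
  have hSΛ : S ⊆ A ∪ a '' Λ := by
    intro x hx
    by_cases hxA : x ∈ A
    · exact Or.inl hxA
    · exact Or.inr ⟨g ⟨x, hx, hxA⟩, mem_iUnion.2 ⟨⟨x, hx, hxA⟩, Relation.ReflTransGen.refl⟩, hg _⟩
  let B0 : Set 𝔐 := A ∩ (S ∪ ⋃ i : Λ, B i)
  refine ⟨B0, inter_subset_left, ?_, ?_⟩
  · refine (Cardinal.mk_le_mk_of_subset inter_subset_right).trans_lt
      ((Cardinal.mk_union_le _ _).trans_lt (Cardinal.add_lt_of_lt hκ.aleph0_le hSκ ?_))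
    rw [Cardinal.card_iUnion_lt_iff_forall_of_isRegular hκ hΛκ]
    exact fun i => hBκ _
  intro k b c hb hc hbc
  have step : ∀ i ∈ Λ, EqTp L (B0 ∪ a '' {j | j ∈ Λ ∧ r j i}) b c →
      EqTp L ({a i} ∪ (B0 ∪ a '' {j | j ∈ Λ ∧ r j i})) b c := by
    intro i hi h
    have hBi : B i ⊆ B0 ∪ a '' {j | j ∈ Λ ∧ r j i} := by
      intro x hx
      rcases hΓB i hx with hxA | ⟨j, hj, rfl⟩
      · exact Or.inl ⟨hxA, Or.inr (mem_iUnion.2 ⟨⟨i, hi⟩, hx⟩)⟩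
      · exact Or.inr ⟨j, ⟨hΛ i hi hj, hΓr i j hj⟩, rfl⟩
    refine ((hN i).mono Subset.rfl hBi Subset.rfl).eqTp_union ?_ (fun i => Or.inl (hb i))
      (fun i => Or.inl (hc i)) h
    exact union_subset_union inter_subset_left (image_mono fun j hj => hj.2)
  -- A formula mentions finitely many elements a_j, so it suffices to add the one of largest index
  -- to those before it.
  have main : ∀ (P : I → Prop), (∀ i ∈ Λ, P i → EqTp L (B0 ∪ a '' {j | j ∈ Λ ∧ r j i}) b c) →
      EqTp L (B0 ∪ a '' {j | j ∈ Λ ∧ P j}) b c := by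
    intro P hP
    rw [EqTp.iff_finite_params]
    intro n d hd
    have h1 : ∀ t : {t : Fin n // d t ∉ B0}, ∃ j, (j ∈ Λ ∧ P j) ∧ a j = d t := fun t =>
      (hd t).resolve_left t.2
    choose f hf hfa using h1
    rw [← EqTp.union_range_iff]
    rcases isEmpty_or_nonempty {t : Fin n // d t ∉ B0} with hE | hE
    · refine hbc.mono (union_subset (empty_subset _) ?_)
      rintro _ ⟨t, rfl⟩
      by_contra h
      exact hE.elim ⟨t, h⟩
    -- A finite nonempty set of indices has a maximal element, here `f t0`.
    · obtain ⟨t0, ht0⟩ : ∃ t0, ∀ t, ¬ r (f t0) (f t) := by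
        have hwf : WellFounded (Function.swap (fun t t' => r (f t) (f t'))) :=
          haveI : IsTrans {t : Fin n // d t ∉ B0} (Function.swap (fun t t' => r (f t) (f t'))) :=
            ⟨fun _ _ _ h h' => _root_.trans (r := r) h' h⟩
          haveI : Std.Irrefl (Function.swap (fun t t' : {t : Fin n // d t ∉ B0} => r (f t) (f t'))) :=
            ⟨fun _ h => irrefl (r := r) _ h⟩
          Finite.wellFounded_of_trans_of_irrefl _
        obtain ⟨t0, -, h⟩ := hwf.has_min Set.univ univ_nonempty
        exact ⟨t0, fun t => h t trivial⟩
      refine (step (f t0) (hf t0).1 (hP _ (hf t0).1 (hf t0).2)).mono (union_subset (empty_subset _) ?_)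
      rintro _ ⟨t, rfl⟩
      by_cases ht : d t ∈ B0
      · exact Or.inr (Or.inl ht)
      · rcases trichotomous_of r (f ⟨t, ht⟩) (f t0) with h | h | h
        · exact Or.inr (Or.inr ⟨f ⟨t, ht⟩, ⟨(hf _).1, h⟩, hfa _⟩)
        · refine Or.inl ?_
          rw [mem_singleton_iff, ← h]
          exact (hfa ⟨t, ht⟩).symm
        · exact absurd h (ht0 _)
  have hall : ∀ i ∈ Λ, EqTp L (B0 ∪ a '' {j | j ∈ Λ ∧ r j i}) b c := by
    intro i
    induction i using hI.wf.induction with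
    | _ i ih =>
      intro _
      exact main (fun j => r j i) fun j hj hji => ih j hji hj
  refine (main (fun _ => True) fun i hi _ => hall i hi).mono ?_
  intro x hx
  rcases hSΛ hx with h | ⟨j, hj, rfl⟩
  · exact Or.inl ⟨h, Or.inl hx⟩
  · exact Or.inr ⟨j, ⟨hj, trivial⟩, rfl⟩

end Con

end DependentThy

namespace DependentThy

open FirstOrder.Language Set

variable {L : FirstOrder.Language.{u, v}} {𝔐 : Type w} [L.Structure 𝔐]
variable {κbar κ lam : Cardinal.{w}}

/-! ### Transfinite chains of constructions -/

section Chains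

/-- `P i` and `R i` are the unions available before step `i`, while `F i` and `G i` result from it.
Only the first component must grow by constructions; the second serves for the larger model N, which
merely has to grow. -/
theorem Setting.exists_chain (S : Setting L 𝔐 κbar κ lam) {I : Type w} [LinearOrder I]
    [WellFoundedLT I] (hI : #I ≤ lam) {D0 E0 : Set 𝔐} (hD0 : #D0 ≤ lam) (hE0 : #E0 ≤ lam)
    {Q : I → Set 𝔐 → Set 𝔐 → Set 𝔐 → Set 𝔐 → Prop}
    (step : ∀ i D E, D0 ⊆ D → E0 ⊆ E → #D ≤ lam → #E ≤ lam → ∃ D' E', D ⊆ D' ∧ E ⊆ E' ∧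
      Con L κ D D' ∧ #D' ≤ lam ∧ #E' ≤ lam ∧ Q i D E D' E') :
    ∃ (P R F G : I → Set 𝔐), (∀ i, D0 ⊆ P i ∧ E0 ⊆ R i ∧ P i ⊆ F i ∧ R i ⊆ G i ∧ Con L κ (P i) (F i) ∧
        Q i (P i) (R i) (F i) (G i)) ∧
      (∀ i j, i < j → F i ⊆ P j ∧ G i ⊆ R j) ∧ Con L κ D0 (D0 ∪ ⋃ i, F i) ∧
      (∀ i, Con L κ (F i) (D0 ∪ ⋃ i, F i)) ∧ #↑(D0 ∪ ⋃ i, F i) ≤ lam ∧ #↑(E0 ∪ ⋃ i, G i) ≤ lam := by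
  classical
  choose! D' E' h using step
  let FG : I → Set 𝔐 × Set 𝔐 := WellFoundedLT.fix (fun i rec =>
    (D' i (D0 ∪ ⋃ j, ⋃ (hj : j < i), (rec j hj).1) (E0 ∪ ⋃ j, ⋃ (hj : j < i), (rec j hj).2),
      E' i (D0 ∪ ⋃ j, ⋃ (hj : j < i), (rec j hj).1) (E0 ∪ ⋃ j, ⋃ (hj : j < i), (rec j hj).2)))
  let F : I → Set 𝔐 := fun i => (FG i).1
  let G : I → Set 𝔐 := fun i => (FG i).2
  let P : I → Set 𝔐 := fun i => D0 ∪ ⋃ j, ⋃ (_ : j < i), F j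
  let R : I → Set 𝔐 := fun i => E0 ∪ ⋃ j, ⋃ (_ : j < i), G j
  have hFG : ∀ i, FG i = (D' i (P i) (R i), E' i (P i) (R i)) := fun i => WellFoundedLT.fix_eq _ _
  have hF : ∀ i, F i = D' i (P i) (R i) := fun i => congrArg Prod.fst (hFG i)
  have hG : ∀ i, G i = E' i (P i) (R i) := fun i => congrArg Prod.snd (hFG i)
  have hcard : ∀ (Z0 : Set 𝔐) (Z : I → Set 𝔐), #Z0 ≤ lam → (∀ i, #(Z i) ≤ lam) →
      #↑(Z0 ∪ ⋃ i, Z i) ≤ lam := by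
    intro Z0 Z h0 hZ
    refine (Cardinal.mk_union_le _ _).trans (Cardinal.add_le_of_le S.aleph0_le h0 ?_)
    exact (Cardinal.mk_iUnion_le _).trans (Cardinal.mul_le_of_le S.aleph0_le hI (ciSup_le' hZ))
  have hPsub : ∀ i, D0 ⊆ P i := fun i => subset_union_left
  have hRsub : ∀ i, E0 ⊆ R i := fun i => subset_union_left
  have hsize : ∀ i, #(P i) ≤ lam ∧ #(R i) ≤ lam ∧ #(F i) ≤ lam ∧ #(G i) ≤ lam := by
    intro i
    induction i using WellFoundedLT.induction with
    | _ i ih =>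
      have hP : #(P i) ≤ lam := by
        refine hcard D0 _ hD0 fun j => ?_
        by_cases hj : j < i
        · simpa [hj] using (ih j hj).2.2.1
        · simp [hj]
      have hR : #(R i) ≤ lam := by
        refine hcard E0 _ hE0 fun j => ?_
        by_cases hj : j < i
        · simpa [hj] using (ih j hj).2.2.2
        · simp [hj]
      obtain ⟨-, -, -, h4, h5, -⟩ := h i _ _ (hPsub i) (hRsub i) hP hR
      rw [hF, hG]
      exact ⟨hP, hR, h4, h5⟩
  have hstep : ∀ i, P i ⊆ F i ∧ R i ⊆ G i ∧ Con L κ (P i) (F i) ∧ Q i (P i) (R i) (F i) (G i) := by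
    intro i
    obtain ⟨h1, h2, h3, -, -, h6⟩ := h i _ _ (hPsub i) (hRsub i) (hsize i).1 (hsize i).2.1
    rw [hF, hG]
    exact ⟨h1, h2, h3, h6⟩
  have hlt : ∀ i j, i < j → F i ⊆ P j ∧ G i ⊆ R j := fun i j hij =>
    ⟨fun _ hx => Or.inr (mem_iUnion₂.2 ⟨i, hij, hx⟩), fun _ hx => Or.inr (mem_iUnion₂.2 ⟨i, hij, hx⟩)⟩
  refine ⟨P, R, F, G, fun i => ⟨hPsub i, hRsub i, (hstep i).1, (hstep i).2.1, (hstep i).2.2⟩, hlt, ?_, ?_,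
    hcard _ _ hD0 fun i => (hsize i).2.2.1, hcard _ _ hE0 fun i => (hsize i).2.2.2⟩
  · refine Con.iUnion (r := fun a b : I => a < b) fun i => ?_
    change Con L κ (P i) (P i ∪ F i)
    rw [union_eq_right.2 (hstep i).1]
    exact (hstep i).2.2.1
  · intro i
    -- The part of the chain above `i` is itself a chain of constructions, starting from `F i`.
    have h1 := Con.iUnion (L := L) (κ := κ) (r := fun a b : {j // i < j} => a < b) (A := F i)
      (C := fun j => F j) (by
      rintro ⟨j, hj⟩
      have h2 : F i ∪ ⋃ k : {j // i < j}, ⋃ (_ : k < ⟨j, hj⟩), F k = P j := by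
        apply subset_antisymm
        · exact union_subset (hlt i j hj).1 (iUnion₂_subset fun k hk => (hlt k j hk).1)
        · refine union_subset (subset_union_of_subset_left ((hPsub i).trans (hstep i).1) _)
            (iUnion₂_subset fun k hk => ?_)
          rcases lt_trichotomy k i with hki | rfl | hki
          · exact subset_union_of_subset_left ((hlt k i hki).1.trans (hstep i).1) _
          · exact subset_union_left
          · exact fun x hx => Or.inr (mem_iUnion₂.2 ⟨⟨k, hki⟩, hk, hx⟩)
      rw [h2, union_eq_right.2 (hstep j).1]
      exact (hstep j).2.2.1)
    convert h1 using 1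
    apply subset_antisymm
    · refine union_subset (subset_union_of_subset_left ((hPsub i).trans (hstep i).1) _)
        (iUnion_subset fun k => ?_)
      rcases lt_trichotomy k i with hki | rfl | hki
      · exact subset_union_of_subset_left ((hlt k i hki).1.trans (hstep i).1) _
      · exact subset_union_left
      · exact fun x hx => Or.inr (mem_iUnion.2 ⟨⟨k, hki⟩, hx⟩)
    · refine union_subset ?_ (iUnion_subset fun k => ?_)
      · exact subset_union_of_subset_right (subset_iUnion F i) _
      · exact subset_union_of_subset_right (subset_iUnion F k.1) _

/-- Many tasks can be achieved by a single construction. -/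
theorem Setting.exists_tasks (S : Setting L 𝔐 κbar κ lam) {J : Type w} (hJ : #J ≤ lam) {D0 : Set 𝔐}
    (hD0 : #D0 ≤ lam) {Task : J → Set 𝔐 → Prop}
    (step : ∀ j D, D0 ⊆ D → #D ≤ lam → ∃ D', D ⊆ D' ∧ Con L κ D D' ∧ #D' ≤ lam ∧ Task j D')
    (pers : ∀ j D D', D0 ⊆ D → D ⊆ D' → SNsp L κ D D' → Task j D → Task j D') :
    ∃ D, D0 ⊆ D ∧ Con L κ D0 D ∧ #D ≤ lam ∧ ∀ j, Task j D := by
  classical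
  let _ : LinearOrder J := linearOrderOfSTO WellOrderingRel
  have _ : WellFoundedLT J := ⟨WellOrderingRel.isWellOrder.wf⟩
  obtain ⟨P, R, F, G, h1, -, h3, h4, h5, -⟩ := S.exists_chain (I := J) hJ hD0 (E0 := ∅) (by simp)
    (Q := fun j _ _ D' _ => Task j D') (fun j D E hD _ hDl hEl => by
      obtain ⟨D', h1, h2, h3, h4⟩ := step j D hD hDl
      exact ⟨D', E, h1, Subset.rfl, h2, h3, hEl, h4⟩)
  refine ⟨_, subset_union_left, h3, h5, fun j => ?_⟩
  obtain ⟨h6, -, h7, -, -, h8⟩ := h1 j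
  exact pers j (F j) _ (h6.trans h7) (h4 j).subset ((h4 j).sNsp S.reg) h8

/-- κ is regular, so fewer than κ stages are bounded by a single one. -/
theorem exists_subset_of_small (hκ : κ.IsRegular) {F : κ.ord.ToType → Set 𝔐}
    (hF : ∀ i j, i < j → F i ⊆ F j) {B : Set 𝔐} (hB : B ⊆ ⋃ i, F i) (hBκ : #B < κ) :
    ∃ i, B ⊆ F i := by
  choose g hg using fun x : B => mem_iUnion.1 (hB x.2)
  by_contra! hcon
  have hcof : ¬ #(range g) < κ := by
    intro h
    have h1 : ∃ i, ∀ x, g x < i := by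
      have h2 : ¬ IsCofinal (range g) := fun hc => by
        have := Order.cof_le hc
        rw [← Ordinal.cof_type, Ordinal.type_toType, hκ.cof_ord] at this
        exact this.not_gt h
      simp only [IsCofinal, not_forall, not_exists, not_and, not_le] at h2
      obtain ⟨i, hi⟩ := h2
      exact ⟨i, fun x => hi _ (mem_range_self x)⟩
    obtain ⟨i, hi⟩ := h1
    exact hcon i fun x hx => hF _ _ (hi ⟨x, hx⟩) (hg ⟨x, hx⟩)
  exact hcof (mk_range_le.trans_lt hBκ)

/-- Iterating a step `κ` many times. -/
theorem Setting.exists_rounds (S : Setting L 𝔐 κbar κ lam) {D0 E0 : Set 𝔐} (hD0 : #D0 ≤ lam)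
    (hE0 : #E0 ≤ lam) {Q : Set 𝔐 → Set 𝔐 → Set 𝔐 → Set 𝔐 → Prop}
    (step : ∀ D E, D0 ⊆ D → E0 ⊆ E → #D ≤ lam → #E ≤ lam → ∃ D' E', D ⊆ D' ∧ E ⊆ E' ∧
      Con L κ D D' ∧ #D' ≤ lam ∧ #E' ≤ lam ∧ Q D E D' E') :
    ∃ D E, D0 ⊆ D ∧ E0 ⊆ E ∧ Con L κ D0 D ∧ #D ≤ lam ∧ #E ≤ lam ∧
      ∀ B ⊆ D, #B < κ → ∀ B' ⊆ E, #B' < κ → ∃ P R F G, B ⊆ P ∧ B' ⊆ R ∧ P ⊆ F ∧ R ⊆ G ∧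
        F ⊆ D ∧ G ⊆ E ∧ Con L κ P F ∧ Con L κ F D ∧ Q P R F G := by
  have hI : #κ.ord.ToType ≤ lam := by rw [Cardinal.mk_toType, Cardinal.card_ord]; exact S.le_lam
  obtain ⟨P, R, F, G, h1, h2, h3, h4, h5, h6⟩ := S.exists_chain (I := κ.ord.ToType) hI hD0 hE0
    (Q := fun _ => Q) fun _ => step
  refine ⟨_, _, subset_union_left, subset_union_left, h3, h5, h6, ?_⟩
  have hlim : ∀ i : κ.ord.ToType, ∃ j, i < j := by
    have := Cardinal.noMaxOrder S.reg.aleph0_le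
    exact fun i => exists_gt i
  have hne : Nonempty κ.ord.ToType := by
    rw [← Cardinal.mk_ne_zero_iff, Cardinal.mk_toType, Cardinal.card_ord]
    exact S.reg.pos.ne'
  have aux : ∀ (Z0 : Set 𝔐) (Z : κ.ord.ToType → Set 𝔐), (∀ i, Z0 ⊆ Z i) → (∀ i j, i < j → Z i ⊆ Z j) →
      ∀ B ⊆ Z0 ∪ ⋃ i, Z i, #B < κ → ∃ i, B ⊆ Z i := by
    intro Z0 Z hZ0 hZ B hB hBκ
    refine exists_subset_of_small S.reg hZ ?_ hBκ
    rwa [union_eq_right.2] at hB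
    exact subset_iUnion_of_subset (Classical.arbitrary _) (hZ0 _)
  intro B hB hBκ B' hB' hBκ'
  obtain ⟨i, hi⟩ := aux D0 F (fun i => (h1 i).1.trans (h1 i).2.2.1)
    (fun i j hij => (h2 i j hij).1.trans (h1 j).2.2.1) B hB hBκ
  obtain ⟨i', hi'⟩ := aux E0 G (fun i => (h1 i).2.1.trans (h1 i).2.2.2.1)
    (fun i j hij => (h2 i j hij).2.trans (h1 j).2.2.2.1) B' hB' hBκ'
  obtain ⟨j, hj⟩ := hlim (max i i')
  refine ⟨P j, R j, F j, G j, hi.trans (h2 i j ((le_max_left _ _).trans_lt hj)).1,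
    hi'.trans (h2 i' j ((le_max_right _ _).trans_lt hj)).2, (h1 j).2.2.1, (h1 j).2.2.2.1, ?_, ?_,
    (h1 j).2.2.2.2.1, h4 j, (h1 j).2.2.2.2.2⟩
  · exact subset_union_of_subset_right (subset_iUnion F j) _
  · exact subset_union_of_subset_right (subset_iUnion G j) _

end Chains

/-! ### Constructible saturated extensions -/

section Saturated

/-- There are at most λ small subsets, and at most 2^θ ≤ λ types over each, for some θ < κ. -/
theorem Setting.exists_type_representatives (S : Setting L 𝔐 κbar κ lam) {D : Set 𝔐} (hD : #D ≤ lam) :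
    ∃ (R : Type w) (B : R → Set 𝔐) (a : R → Unit → 𝔐), #R ≤ lam ∧ (∀ r, B r ⊆ D ∧ #(B r) < κ) ∧
      ∀ B' ⊆ D, #B' < κ → ∀ a' : Unit → 𝔐, ∃ r, B r = B' ∧ EqTp L B' (a r) a' := by
  classical
  let Sm := {B : Set 𝔐 // B ⊆ D ∧ #B < κ}
  choose K f hKκ _ hf using fun B : Sm => S.exists_index Unit B.1
  let R := {p : Σ B : Sm, Set (K B) // ∃ a : Unit → 𝔐, p.2 = {z | a ∈ f p.1 z}}
  choose a ha using fun r : R => r.2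
  refine ⟨R, fun r => r.1.1.1, a, ?_, fun r => r.1.1.2, ?_⟩
  · refine (Cardinal.mk_subtype_le _).trans ?_
    rw [Cardinal.mk_sigma]
    refine (Cardinal.sum_le_mk_mul_iSup _).trans ?_
    refine Cardinal.mul_le_of_le S.aleph0_le (S.mk_small_subsets_le hD) (ciSup_le' fun B => ?_)
    rw [Cardinal.mk_set]
    exact S.two_pow_le (hKκ B B.2.2)
  · intro B' hB' hBκ a'
    let r : R := ⟨⟨⟨B', hB', hBκ⟩, {z | a' ∈ f ⟨B', hB', hBκ⟩ z}⟩, a', rfl⟩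
    refine ⟨r, rfl, fun X hX => ?_⟩
    obtain ⟨z, rfl⟩ := (hf ⟨B', hB', hBκ⟩ X).1 hX
    exact (Set.ext_iff.1 (ha r) z).symm

theorem Setting.mk_union_range_le (S : Setting L 𝔐 κbar κ lam) {ι : Type*} [Finite ι]
    {D : Set 𝔐} (hD : #D ≤ lam) (a : ι → 𝔐) : #↑(D ∪ range a) ≤ lam :=
  (Cardinal.mk_union_le _ _).trans (Cardinal.add_le_of_le S.aleph0_le hD
    ((Set.finite_range a).lt_aleph0.le.trans S.aleph0_le))

/-- Every set has a constructible saturated extension. -/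
theorem Setting.exists_kSat (S : Setting L 𝔐 κbar κ lam) {D : Set 𝔐} (hD : #D ≤ lam) :
    ∃ M, D ⊆ M ∧ Con L κ D M ∧ #M ≤ lam ∧ KSat L κ M := by
  obtain ⟨M, _, h1, -, h2, h3, -, h4⟩ := S.exists_rounds hD (E0 := ∅) (by simp)
    (Q := fun D _ D' _ => ∀ B ⊆ D, #B < κ → ∀ a : 𝔐, ∃ a' ∈ D', EqTp L B (fun _ : Unit => a') (fun _ => a))
    (by
      intro D E _ _ hD hE
      obtain ⟨R, B, a, hR, hB, hrep⟩ := S.exists_type_representatives hD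
      obtain ⟨D', hDD', hcon, hcard, htask⟩ := S.exists_tasks hR hD
        (Task := fun r D' => ∃ a' : Unit → 𝔐, (∀ i, a' i ∈ D') ∧ EqTp L (B r) a' (a r))
        (by
          intro r D' hDD' hD'
          obtain ⟨a', ha', B', hB', -, hBκ', hN⟩ := S.exists_nsp (hD'.trans_lt S.lt_bar)
            ((hB r).1.trans hDD') (hB r).2 (a r)
          exact ⟨D' ∪ range a', subset_union_left, Con.of_finite S.reg.aleph0_le hB' hBκ' hN,
            S.mk_union_range_le hD' a', a', fun i => Or.inr ⟨i, rfl⟩, ha'⟩)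
        (by
          rintro r D1 D2 _ h12 - ⟨a', ha', h⟩
          exact ⟨a', fun i => h12 (ha' i), h⟩)
      refine ⟨D', E, hDD', Subset.rfl, hcon, hcard, hE, fun B' hB' hBκ' x => ?_⟩
      obtain ⟨r, rfl, hr⟩ := hrep B' hB' hBκ' (fun _ => x)
      obtain ⟨a', ha', h⟩ := htask r
      exact ⟨a' (), ha' _, h.trans hr⟩)
  refine ⟨M, h1, h2, h3, fun B hB hBκ a => ?_⟩
  obtain ⟨P, R, F, G, hBP, -, -, -, hF, -, -, -, hQ⟩ := h4 B hB hBκ ∅ (empty_subset _) (by simpa using S.reg.pos)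
  obtain ⟨a', ha', h⟩ := hQ B hBP hBκ a
  exact ⟨a', hF ha', h⟩

end Saturated

end DependentThy

namespace DependentThy

open FirstOrder.Language Set

variable {L : FirstOrder.Language.{u, v}} {𝔐 : Type w} [L.Structure 𝔐]
variable {κbar κ lam : Cardinal.{w}}

theorem EqTp.iff_finite_subset {ι : Type*} {D : Set 𝔐} {a b : ι → 𝔐} :
    EqTp L D a b ↔ ∀ A : Set 𝔐, A.Finite → A ⊆ D → EqTp L A a b := by
  constructor
  · exact fun h A _ hA => h.mono hA
  · intro h X hX
    obtain ⟨A0, hA0, hX'⟩ := definable_iff_finitely_definable.1 hX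
    exact h A0 A0.finite_toSet hA0 X hX'

/-! ### Reducedness for finite tuples, and deciding formulas -/

section Red

variable (L) in
/-- The type of `c` over `M` has a unique extension over each finite set whose type over `M` does
not split over a small set. -/
def Red (κ : Cardinal.{w}) {ι : Type*} (M : Set 𝔐) (c : ι → 𝔐) : Prop :=
  ∀ E : Set 𝔐, E.Finite → (∃ B ⊆ M, #B < κ ∧ Nsp L M B E) →
    ∀ c' : ι → 𝔐, EqTp L M c' c → EqTp L (M ∪ E) c' c

theorem Red.eqTp_of_sNsp {ι : Type*} {M M' : Set 𝔐} {c c' : ι → 𝔐} (h : Red L κ M c)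
    (hκ : ℵ₀ ≤ κ) (hS : SNsp L κ M M') (hc : EqTp L M c' c) : EqTp L M' c' c := by
  rw [EqTp.iff_finite_subset]
  intro A hA hAM
  obtain ⟨B, hB, hBκ, hN⟩ := hS A hAM (hA.lt_aleph0.trans_le hκ)
  exact (h A hA ⟨B, hB, hBκ, hN⟩ c' hc).mono subset_union_right

/-- Nonsplitting is transitive: over `M` control first `B ∪ A`, then `E` through its base `B`. -/
theorem SNsp.extend_finite (hκ : ℵ₀ ≤ κ) {M M' E B A : Set 𝔐} (hS : SNsp L κ M M') (hMM : M ⊆ M')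
    (hB : B ⊆ M') (hBκ : #B < κ) (hN : Nsp L M' B E) (hA : A.Finite) (hAM : A ⊆ M') :
    ∃ B' ⊆ M, #B' < κ ∧ Nsp L M B' (E ∪ (B ∪ A)) := by
  have hBA : B ∪ A ⊆ M' := union_subset hB hAM
  obtain ⟨B', hB', hBκ', hN'⟩ := hS (B ∪ A) hBA ((Cardinal.mk_union_le _ _).trans_lt
    (Cardinal.add_lt_of_lt hκ hBκ (hA.lt_aleph0.trans_le hκ)))
  refine ⟨B', hB', hBκ', fun k b c hb hc hbc => ?_⟩
  exact (hN.mono Subset.rfl subset_union_left Subset.rfl).eqTp_union hBA (fun i => hMM (hb i))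
    (fun i => hMM (hc i)) (hN' k b c hb hc hbc)

/-- A finite set of small-nonsplitting type over `M'`, with finitely many points of `M'`, again has
a small-nonsplitting type over `M`; so uniqueness over `M` handles parameters from `M'` and from `E`
simultaneously. -/
theorem Red.mono {ι : Type*} {M M' : Set 𝔐} {c : ι → 𝔐} (h : Red L κ M c) (hκ : ℵ₀ ≤ κ)
    (hMM : M ⊆ M') (hS : SNsp L κ M M') : Red L κ M' c := by
  rintro E hE ⟨B, hB, hBκ, hN⟩ c' hc
  rw [EqTp.iff_finite_subset]
  intro A hA hAM
  obtain ⟨B', hB', hBκ', hN'⟩ := hS.extend_finite hκ hMM hB hBκ hN (hA.inter_of_left M') inter_subset_right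
  have h1 := h (E ∪ (A ∩ M')) (hE.union (hA.inter_of_left M')) ⟨B', hB', hBκ',
    hN'.mono Subset.rfl Subset.rfl (union_subset_union_right _ subset_union_right)⟩ c' (hc.mono hMM)
  refine h1.mono fun x hx => ?_
  rcases hAM hx with h | h
  exacts [Or.inr (Or.inr ⟨hx, h⟩), Or.inr (Or.inl h)]

/-- Compactness form of entailment: if all realizations of the type of `d` over `F` are in the
definable set `Z`, then so is some `F`-definable set containing `d`. -/
theorem Setting.exists_definable_subset (S : Setting L 𝔐 κbar κ lam) {F D : Set 𝔐} (hF : F ⊆ D)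
    (hD : #D < κbar) {ι : Type*} [Finite ι] {d : ι → 𝔐} {Z : Set (ι → 𝔐)} (hZ : D.Definable L Z)
    (h : ∀ y, EqTp L F y d → y ∈ Z) : ∃ χ : Set (ι → 𝔐), F.Definable L χ ∧ d ∈ χ ∧ χ ⊆ Z := by
  by_contra! hcon
  have hne : (⋂₀ {Y | ∃ χ : Set (ι → 𝔐), F.Definable L χ ∧ d ∈ χ ∧ Y = χ ∩ Zᶜ}).Nonempty := by
    refine exists_mem_of_directed S.sat S.aleph0_le_bar hD ?_ ⟨_, Set.univ, definable_univ, trivial, rfl⟩ ?_ ?_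
    · rintro _ ⟨χ, hχ, -, rfl⟩
      exact (hχ.mono hF).inter hZ.compl
    · rintro _ ⟨χ, hχ, hd, rfl⟩
      obtain ⟨x, hx, hxZ⟩ := not_subset.1 (hcon χ hχ hd)
      exact ⟨x, hx, hxZ⟩
    · rintro _ ⟨χ, hχ, hd, rfl⟩ _ ⟨χ', hχ', hd', rfl⟩
      exact ⟨χ ∩ χ', hχ.inter hχ', ⟨hd, hd'⟩, by rw [inter_inter_inter_comm, inter_self]⟩
  obtain ⟨y, hy⟩ := hne
  exact (hy _ ⟨Set.univ, definable_univ, trivial, rfl⟩).2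
    (h y (EqTp.of_imp fun X hX hd => (hy _ ⟨X, hX, hd, rfl⟩).1).symm)

/-- Deciding an external formula on the nonsplitting extensions of a type. -/
theorem Setting.exists_decide (S : Setting L 𝔐 κbar κ lam) {M D B : Set 𝔐} (hM : KSat L κ M)
    (hMD : M ⊆ D) (hD : #D ≤ lam) (hB : B ⊆ M) (hBκ : #B < κ) {γ ι : Type} [Finite γ] [Finite ι]
    {a : ι → 𝔐} (ha : Nsp L M B (range a)) {X : Set (γ ⊕ ι → 𝔐)} (hX : (∅ : Set 𝔐).Definable L X)
    (c : γ → 𝔐) : ∃ D', D ⊆ D' ∧ Con L κ D D' ∧ #D' ≤ lam ∧ ∃ s : Prop, ∀ d : ι → 𝔐, EqTp L M d a →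
      Nsp L D' B (range d) → (Sum.elim c d ∈ X ↔ s) := by
  by_contra! hcon
  obtain ⟨K, hK⟩ := S.nip.exists_alternation_bound hX
  -- If no extension decides `X` at `c`, realizations on which it alternates can be chosen
  -- successively. Constructibility of the part already chosen is a premise of the condition,
  -- because `exists_seq_prev` quantifies over all finite sets; it is verified afterwards.
  obtain ⟨d, -, hd⟩ := exists_seq_prev (ι := ι) (M := Set.univ) (Q := fun i e x => Con L κ D (D ∪ e) →
      EqTp L M x a ∧ Nsp L (D ∪ e) B (range x) ∧ (Sum.elim c x ∈ X ↔ Even i)) (by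
    intro i e he _
    by_cases hcon' : Con L κ D (D ∪ e)
    · obtain ⟨x, h1, h2, h3⟩ := hcon (D ∪ e) subset_union_left hcon'
        ((Cardinal.mk_union_le _ _).trans (Cardinal.add_le_of_le S.aleph0_le hD
          (he.lt_aleph0.le.trans S.aleph0_le))) (¬ Even i)
      refine ⟨x, fun _ => trivial, fun _ => ⟨h1, h2, ?_⟩⟩
      tauto
    · exact ⟨a, fun _ => trivial, fun h => absurd h hcon'⟩)
  have hcond : ∀ i, Con L κ D (D ∪ prev d i) := by
    intro i
    induction i with
    | zero => simpa [prev] using Con.refl D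
    | succ i ih =>
      obtain ⟨-, h2, -⟩ := hd i ih
      rw [prev_succ, ← union_assoc]
      exact ih.trans (Con.of_finite S.reg.aleph0_le (hB.trans (hMD.trans subset_union_left)) hBκ h2)
  let W : Set 𝔐 := D ∪ ⋃ i, range (d i)
  have hW : #W ≤ lam := by
    refine (Cardinal.mk_union_le _ _).trans (Cardinal.add_le_of_le S.aleph0_le hD ?_)
    have : (⋃ i, range (d i)).Countable := countable_iUnion fun i => (finite_range _).countable
    exact this.le_aleph0.trans S.aleph0_le
  have hMW : M ⊆ W := hMD.trans subset_union_left
  -- By uniqueness of nonsplitting extensions all `d i` follow one type over `W`. They form a Morley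
  -- sequence of it, hence are indiscernible and cannot alternate `K` times.
  obtain ⟨a', haa', hNa'⟩ := Nsp.exists_extend S hM hB hBκ hMW (hW.trans_lt S.lt_bar) ha
  have hdW : ∀ i k, d i k ∈ W := fun i k => Or.inr (mem_iUnion.2 ⟨i, mem_range_self k⟩)
  have hmor : ∀ i < K, EqTp L (B ∪ prev d i) (d i) a' := by
    intro i _
    obtain ⟨h1, h2, -⟩ := hd i (hcond i)
    have h3 := Nsp.unique S hM hB hBκ (subset_union_left (t := prev d i))
      (h2.mono (union_subset_union_left _ hMD) Subset.rfl Subset.rfl)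
      (hNa'.mono (union_subset hMW (prev_subset hdW i)) Subset.rfl Subset.rfl) (h1.trans haa'.symm)
    exact h3.mono (union_subset_union_left _ hB)
  refine hK d ((indisc_of_morley (hB.trans hMW) hNa' hdW hmor).mono (empty_subset _)) c True fun i _ => ?_
  simpa using (hd i (hcond i)).2.2

end Red

/-! ### The hierarchy of rich sets -/

section Good

variable (L) in
/-- Iterated richness: `M` is saturated, reduced with respect to `N`, and filled up by smaller
sets with the same properties over which types are realized in `M`. -/
def Good (κ : Cardinal.{w}) : ℕ → Set 𝔐 → Set 𝔐 → Prop
  | 0, N, M => KSat L κ M ∧ ∀ (m : ℕ) (c : Fin m → 𝔐), (∀ i, c i ∈ N) → Red L κ M c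
  | k + 1, N, M => (KSat L κ M ∧ ∀ (m : ℕ) (c : Fin m → 𝔐), (∀ i, c i ∈ N) → Red L κ M c) ∧
    ∀ B ⊆ M, #B < κ → ∃ M' ⊆ M, B ⊆ M' ∧ Good κ k N M' ∧ SNsp L κ M' M ∧
      ∀ (n : ℕ) (a : Fin n → 𝔐), Nsp L M B (range a) → ∃ d : Fin n → 𝔐, (∀ i, d i ∈ M) ∧ EqTp L M' d a

theorem Good.zero {k : ℕ} {N M : Set 𝔐} (h : Good L κ k N M) :
    KSat L κ M ∧ ∀ (m : ℕ) (c : Fin m → 𝔐), (∀ i, c i ∈ N) → Red L κ M c := by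
  cases k with
  | zero => exact h
  | succ k => exact h.1

theorem Good.anti {N N' : Set 𝔐} (hN : N' ⊆ N) : ∀ {k : ℕ} {M : Set 𝔐}, Good L κ k N M → Good L κ k N' M
  | 0, _, h => ⟨h.1, fun m c hc => h.2 m c fun i => hN (hc i)⟩
  | k + 1, _, h => ⟨⟨h.1.1, fun m c hc => h.1.2 m c fun i => hN (hc i)⟩, fun B hB hBκ => by
      obtain ⟨M', h1, h2, h3, h4⟩ := h.2 B hB hBκ
      exact ⟨M', h1, h2, h3.anti hN, h4⟩⟩

theorem Good.pred {N : Set 𝔐} : ∀ {k : ℕ} {M : Set 𝔐}, Good L κ (k + 1) N M → Good L κ k N M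
  | 0, _, h => h.1
  | k + 1, _, h => ⟨h.1, fun B hB hBκ => by
      obtain ⟨M', h1, h2, h3, h4⟩ := h.2 B hB hBκ
      exact ⟨M', h1, h2, h3.pred, h4⟩⟩

/-- Realizing all small-nonsplitting types over a saturated set. -/
theorem Setting.exists_realize_types (S : Setting L 𝔐 κbar κ lam) {M : Set 𝔐} (hM : KSat L κ M)
    (hMl : #M ≤ lam) : ∃ D, M ⊆ D ∧ Con L κ M D ∧ #D ≤ lam ∧ ∀ B ⊆ M, #B < κ → ∀ (n : ℕ) (a : Fin n → 𝔐),
      Nsp L M B (range a) → ∃ d : Fin n → 𝔐, (∀ i, d i ∈ D) ∧ EqTp L M d a := by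
  choose R B a hR hB hrep using fun n : ℕ => hM.exists_representatives S hMl (Fin n)
  obtain ⟨D, h1, h2, h3, h4⟩ := S.exists_tasks (J := Σ n : ULift.{w} ℕ, R n.down) (by
      rw [Cardinal.mk_sigma]
      refine (Cardinal.sum_le_mk_mul_iSup _).trans ?_
      exact Cardinal.mul_le_of_le S.aleph0_le (by simpa using S.aleph0_le) (ciSup_le' fun n => hR _)) hMl
    (Task := fun j D => ∃ d : Fin j.1.down → 𝔐, (∀ i, d i ∈ D) ∧ EqTp L M d (a _ j.2))
    (by
      rintro ⟨⟨n⟩, r⟩ D hMD hD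
      obtain ⟨hBM, hBκ, hN⟩ := hB n r
      obtain ⟨d, h1, h2⟩ := Nsp.exists_extend S hM hBM hBκ hMD (hD.trans_lt S.lt_bar) hN
      exact ⟨D ∪ range d, subset_union_left, Con.of_finite S.reg.aleph0_le (hBM.trans hMD) hBκ h2,
        S.mk_union_range_le hD d, d, fun i => Or.inr ⟨i, rfl⟩, h1⟩)
    (by
      rintro j D1 D2 _ h12 - ⟨a', ha', h⟩
      exact ⟨a', fun i => h12 (ha' i), h⟩)
  refine ⟨D, h1, h2, h3, fun B' hB' hBκ' n a' ha' => ?_⟩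
  obtain ⟨r, rfl, hr⟩ := hrep n B' hB' hBκ' a' ha'
  obtain ⟨d, hd, h⟩ := h4 ⟨⟨n⟩, r⟩
  exact ⟨d, hd, h.trans hr⟩

/-- Deciding all external formulas over `N` on small-nonsplitting types over `M`. -/
theorem Setting.exists_decide_all (S : Setting L 𝔐 κbar κ lam) {M N : Set 𝔐} (hM : KSat L κ M)
    (hMl : #M ≤ lam) (hN : #N ≤ lam) : ∃ D, M ⊆ D ∧ Con L κ M D ∧ #D ≤ lam ∧
      ∀ B ⊆ M, #B < κ → ∀ (n m : ℕ) (a : Fin n → 𝔐), Nsp L M B (range a) →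
      ∀ X : Set (Fin m ⊕ Fin n → 𝔐), (∅ : Set 𝔐).Definable L X → ∀ c : Fin m → 𝔐, (∀ i, c i ∈ N) →
      ∃ s : Prop, ∀ d : Fin n → 𝔐, EqTp L M d a → Nsp L D B (range d) → (Sum.elim c d ∈ X ↔ s) := by
  choose R B a hR hB hrep using fun n : ℕ => hM.exists_representatives S hMl (Fin n)
  choose K f _ hK hf using fun p : ℕ × ℕ => S.exists_index (Fin p.1 ⊕ Fin p.2) (∅ : Set 𝔐)
  have hK' := fun p => hK p (by simp)
  obtain ⟨D, h1, h2, h3, h4⟩ := S.exists_tasks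
    (J := Σ p : ULift.{w} (ℕ × ℕ), R p.down.2 × K p.down × (Fin p.down.1 → N)) (by
      rw [Cardinal.mk_sigma]
      refine (Cardinal.sum_le_mk_mul_iSup _).trans ?_
      refine Cardinal.mul_le_of_le S.aleph0_le (by simpa using S.aleph0_le) (ciSup_le' fun n => ?_)
      rw [Cardinal.mk_prod, Cardinal.mk_prod, Cardinal.lift_id, Cardinal.lift_id, Cardinal.lift_id,
        Cardinal.lift_id]
      refine Cardinal.mul_le_of_le S.aleph0_le (hR _) (Cardinal.mul_le_of_le S.aleph0_le (hK' _) ?_)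
      rw [Cardinal.mk_arrow]
      simp only [Cardinal.mk_fin, Cardinal.lift_natCast, Cardinal.lift_uzero]
      refine (Cardinal.power_le_power_right hN).trans ?_
      exact Cardinal.power_nat_le S.aleph0_le) hMl
    (Task := fun j D => ∃ s : Prop, ∀ d : Fin j.1.down.2 → 𝔐, EqTp L M d (a _ j.2.1) →
      Nsp L D (B _ j.2.1) (range d) → (Sum.elim (fun i => (j.2.2.2 i : 𝔐)) d ∈ f _ j.2.2.1 ↔ s))
    (by
      rintro ⟨⟨p⟩, r, z, c⟩ D hMD hD
      obtain ⟨hBM, hBκ, hN⟩ := hB p.2 r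
      exact S.exists_decide hM hMD hD hBM hBκ hN ((hf p _).2 ⟨z, rfl⟩) _)
    (by
      rintro j D1 D2 _ h12 - ⟨s, h⟩
      exact ⟨s, fun d hd hN => h d hd (hN.mono h12 Subset.rfl Subset.rfl)⟩)
  refine ⟨D, h1, h2, h3, fun B' hB' hBκ' n m a' ha' X hX c hc => ?_⟩
  obtain ⟨r, rfl, hr⟩ := hrep n B' hB' hBκ' a' ha'
  obtain ⟨z, rfl⟩ := (hf (m, n) X).1 hX
  obtain ⟨s, hs⟩ := h4 ⟨⟨(m, n)⟩, r, z, fun i => ⟨c i, hc i⟩⟩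
  exact ⟨s, fun d hd hN => hs d (hd.trans hr.symm) hN⟩

/-- Every set has a constructible saturated extension which is reduced with respect to `N`. -/
theorem Setting.exists_good_zero (S : Setting L 𝔐 κbar κ lam) {D N : Set 𝔐} (hD : #D ≤ lam)
    (hN : #N ≤ lam) : ∃ M, D ⊆ M ∧ Con L κ D M ∧ #M ≤ lam ∧ Good L κ 0 N M := by
  obtain ⟨M, _, h1, -, h2, h3, -, h4⟩ := S.exists_rounds hD (E0 := ∅) (by simp)
    (Q := fun D _ F _ => ∃ M', D ⊆ M' ∧ M' ⊆ F ∧ KSat L κ M' ∧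
      ∀ B ⊆ M', #B < κ → ∀ (n m : ℕ) (a : Fin n → 𝔐), Nsp L M' B (range a) →
      ∀ X : Set (Fin m ⊕ Fin n → 𝔐), (∅ : Set 𝔐).Definable L X → ∀ c : Fin m → 𝔐, (∀ i, c i ∈ N) →
      ∃ s : Prop, ∀ d : Fin n → 𝔐, EqTp L M' d a → Nsp L F B (range d) → (Sum.elim c d ∈ X ↔ s))
    (by
      intro D E _ _ hD hE
      obtain ⟨M', hDM, hcon, hMl, hM⟩ := S.exists_kSat hD
      obtain ⟨F, hMF, hcon', hF, h⟩ := S.exists_decide_all hM hMl hN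
      exact ⟨F, E, hDM.trans hMF, Subset.rfl, hcon.trans hcon', hF, hE, M', hDM, hMF, hM, h⟩)
  have h5 : ∀ B ⊆ M, #B < κ → ∃ M' F, B ⊆ M' ∧ M' ⊆ F ∧ F ⊆ M ∧ KSat L κ M' ∧
      ∀ B ⊆ M', #B < κ → ∀ (n m : ℕ) (a : Fin n → 𝔐), Nsp L M' B (range a) →
      ∀ X : Set (Fin m ⊕ Fin n → 𝔐), (∅ : Set 𝔐).Definable L X → ∀ c : Fin m → 𝔐, (∀ i, c i ∈ N) →
      ∃ s : Prop, ∀ d : Fin n → 𝔐, EqTp L M' d a → Nsp L F B (range d) → (Sum.elim c d ∈ X ↔ s) := by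
    intro B hB hBκ
    obtain ⟨P, _, F, _, hBP, -, -, -, hF, -, -, -, M', hPM, hMF, hQ⟩ :=
      h4 B hB hBκ ∅ (empty_subset _) (by simpa using S.reg.pos)
    exact ⟨M', F, hBP.trans hPM, hMF, hF, hQ⟩
  refine ⟨M, h1, h2, h3, ?_, ?_⟩
  · intro B hB hBκ a
    obtain ⟨M', F, hBM, hMF, hF, hM', -⟩ := h5 B hB hBκ
    obtain ⟨a', ha', h⟩ := hM' B hBM hBκ a
    exact ⟨a', hF (hMF ha'), h⟩
  · rintro m c hc E hE ⟨B, hB, hBκ, hNsp⟩ c' hcc'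
    -- Choose a stage `M' ⊆ F ⊆ M` with the base of `d` in `M'`. The type of `d` over `F` yields
    -- both its type over `M'` and its nonsplitting over `F`, so it decides `X` at `c`.
    have key : ∀ (n : ℕ) (d : Fin n → 𝔐) (B : Set 𝔐), B ⊆ M → #B < κ → Nsp L M B (range d) →
        EqTp L ∅ (Sum.elim c' d) (Sum.elim c d) := by
      intro n d B hB hBκ hNd
      obtain ⟨M', F, hBM, hMF, hF, hM', hdec⟩ := h5 B hB hBκ
      refine (EqTp.of_imp fun X hX hcX => by_contra fun hcX' => ?_).symm
      obtain ⟨s, hs⟩ := hdec B hBM hBκ n m d (hNd.mono (hMF.trans hF) Subset.rfl Subset.rfl) X hX c hc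
      have hNF : Nsp L F B (range d) := hNd.mono hF Subset.rfl Subset.rfl
      have hs' : s := (hs d (EqTp.refl _ _) hNF).1 hcX
      obtain ⟨χ, hχ, hdχ, hχZ⟩ := S.exists_definable_subset (F := F) (D := F ∪ range c) subset_union_left
        ((S.mk_union_range_le ((Cardinal.mk_le_mk_of_subset hF).trans h3) c).trans_lt S.lt_bar) (d := d)
        (Z := {y | Sum.elim c y ∈ X})
        (definable_fiber (fun i => mem_union_right F (mem_range_self i)) (hX.mono (empty_subset _)))
        (fun y hy => (hs y (hy.mono hMF) (hNF.congr hy.symm)).2 hs')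
      -- By compactness one `F`-definable `χ` around `d` lies in the fibre of `X` over `c`. This
      -- inclusion is a property of `c` over `F`, hence is shared by `c'`.
      have hdef : F.Definable L {z : Fin m → 𝔐 | ∀ y : Fin n → 𝔐, Sum.elim z y ∈
          {v | v ∘ Sum.inr ∈ χ}ᶜ ∪ X} :=
        Definable.forall_of_finite ((hχ.preimage_comp _).compl.union (hX.mono (empty_subset _)))
      have h6 := ((hcc'.mono hF) _ hdef).2 (by
        intro y
        by_cases hy : y ∈ χ
        · exact Or.inr (hχZ hy)
        · exact Or.inl hy)
      rcases h6 d with h | h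
      · exact h hdχ
      · exact hcX' h
    rw [EqTp.iff_finite_params]
    intro n d hd
    have hSN : SNsp L κ M M := fun S' hS' hSκ' => ⟨S', hS', hSκ', fun _ _ _ _ _ h => h⟩
    obtain ⟨B', hB', hBκ', hN'⟩ := hSN.extend_finite S.reg.aleph0_le Subset.rfl hB hBκ hNsp
      ((finite_range d).inter_of_left M) inter_subset_right
    refine (key n d B' hB' hBκ' (hN'.mono Subset.rfl Subset.rfl ?_)).sum_swap
    rintro _ ⟨i, rfl⟩
    rcases hd i with h | h
    · exact Or.inr (Or.inr ⟨mem_range_self i, h⟩)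
    · exact Or.inl h

/-- Saturation and reducedness of `M` are inherited from the sets `M'`; this is the form in which a
chain delivers the next level. -/
theorem Good.of_subsets (S : Setting L 𝔐 κbar κ lam) {N M : Set 𝔐} (k : ℕ)
    (h : ∀ B ⊆ M, #B < κ → ∃ M' ⊆ M, B ⊆ M' ∧ Good L κ k N M' ∧ SNsp L κ M' M ∧
      ∀ B ⊆ M', #B < κ → ∀ (n : ℕ) (a : Fin n → 𝔐), Nsp L M' B (range a) →
        ∃ d : Fin n → 𝔐, (∀ i, d i ∈ M) ∧ EqTp L M' d a) : Good L κ (k + 1) N M := by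
  refine ⟨⟨?_, ?_⟩, ?_⟩
  · intro B hB hBκ a
    obtain ⟨M', hMM, hBM, hg, -⟩ := h B hB hBκ
    obtain ⟨a', ha', h'⟩ := hg.zero.1 B hBM hBκ a
    exact ⟨a', hMM ha', h'⟩
  · intro m c hc
    obtain ⟨M', hMM, -, hg, hS, -⟩ := h ∅ (empty_subset _) (by simpa using S.reg.pos)
    exact (hg.zero.2 m c hc).mono S.reg.aleph0_le hMM hS
  · intro B hB hBκ
    obtain ⟨M', hMM, hBM, hg, hS, hreal⟩ := h B hB hBκ
    exact ⟨M', hMM, hBM, hg, hS, fun n a ha => hreal B hBM hBκ n a (ha.mono hMM Subset.rfl Subset.rfl)⟩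

theorem Setting.exists_good (S : Setting L 𝔐 κbar κ lam) {N : Set 𝔐} (hN : #N ≤ lam) (k : ℕ) :
    ∀ {D : Set 𝔐}, #D ≤ lam → ∃ M, D ⊆ M ∧ Con L κ D M ∧ #M ≤ lam ∧ Good L κ k N M := by
  induction k with
  | zero => exact fun hD => S.exists_good_zero hD hN
  | succ k ih =>
    intro D hD
    obtain ⟨M, _, h1, -, h2, h3, -, h4⟩ := S.exists_rounds hD (E0 := ∅) (by simp)
      (Q := fun D _ F _ => ∃ M', D ⊆ M' ∧ M' ⊆ F ∧ Good L κ k N M' ∧ SNsp L κ M' F ∧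
        ∀ B ⊆ M', #B < κ → ∀ (n : ℕ) (a : Fin n → 𝔐), Nsp L M' B (range a) →
          ∃ d : Fin n → 𝔐, (∀ i, d i ∈ F) ∧ EqTp L M' d a)
      (by
        intro D E _ _ hD hE
        obtain ⟨M', hDM, hcon, hMl, hM⟩ := ih hD
        obtain ⟨F, hMF, hcon', hF, h⟩ := S.exists_realize_types hM.zero.1 hMl
        exact ⟨F, E, hDM.trans hMF, Subset.rfl, hcon.trans hcon', hF, hE, M', hDM, hMF, hM,
          hcon'.sNsp S.reg, h⟩)
    refine ⟨M, h1, h2, h3, Good.of_subsets S k fun B hB hBκ => ?_⟩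
    obtain ⟨P, _, F, _, hBP, -, -, -, hF, -, -, hcon, M', hPM, hMF, hg, hSN, hreal⟩ :=
      h4 B hB hBκ ∅ (empty_subset _) (by simpa using S.reg.pos)
    refine ⟨M', hMF.trans hF, hBP.trans hPM, hg, hSN.trans (hcon.sNsp S.reg) hMF, ?_⟩
    intro B hB hBκ n a ha
    obtain ⟨d, hd, hda⟩ := hreal B hB hBκ n a ha
    exact ⟨d, fun i => hF (hd i), hda⟩

/-- The pair of sets underlying a nice pair. -/
theorem Setting.exists_good_pair (S : Setting L 𝔐 κbar κ lam) {A A' : Set 𝔐} (hA : #A ≤ lam)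
    (hA' : #A' ≤ lam) : ∃ M N, A ⊆ M ∧ A' ⊆ N ∧ M ⊆ N ∧ Con L κ A M ∧ #M ≤ lam ∧ #N ≤ lam ∧
      KSat L κ N ∧ ∀ C ⊆ N, #C < κ → ∀ k, Good L κ k C M := by
  obtain ⟨M, N, h1, h2, h3, h4, h5, h6⟩ := S.exists_rounds hA hA'
    -- `M` cannot be made good against `N`, which is still growing; each round treats the current
    -- `E`, at every level `k`. A small subset of `N` lies in some such `E`, which is why goodness
    -- is obtained against small subsets only.
    (Q := fun D E F G => F ⊆ G ∧ (∃ N', E ⊆ N' ∧ N' ⊆ G ∧ KSat L κ N') ∧ ∀ k : ℕ,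
      ∃ M', D ⊆ M' ∧ M' ⊆ F ∧ Good L κ k E M' ∧ SNsp L κ M' F ∧
        ∀ B ⊆ M', #B < κ → ∀ (n : ℕ) (a : Fin n → 𝔐), Nsp L M' B (range a) →
          ∃ d : Fin n → 𝔐, (∀ i, d i ∈ F) ∧ EqTp L M' d a)
    (by
      intro D E _ _ hD hE
      obtain ⟨F, hDF, hcon, hF, htask⟩ := S.exists_tasks (J := ULift.{w} ℕ) (by simpa using S.aleph0_le) hD
        (Task := fun k F => ∃ M', D ⊆ M' ∧ M' ⊆ F ∧ Good L κ k.down E M' ∧ SNsp L κ M' F ∧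
          ∀ B ⊆ M', #B < κ → ∀ (n : ℕ) (a : Fin n → 𝔐), Nsp L M' B (range a) →
            ∃ d : Fin n → 𝔐, (∀ i, d i ∈ F) ∧ EqTp L M' d a)
        (by
          intro k D' hDD' hD'
          obtain ⟨M', hDM, hcon, hMl, hM⟩ := S.exists_good hE k.down hD'
          obtain ⟨F, hMF, hcon', hF, h⟩ := S.exists_realize_types hM.zero.1 hMl
          exact ⟨F, hDM.trans hMF, hcon.trans hcon', hF, M', hDD'.trans hDM, hMF, hM, hcon'.sNsp S.reg, h⟩)
        (by
          rintro k D1 D2 _ h12 hS ⟨M', g1, g2, g3, g4, g5⟩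
          refine ⟨M', g1, g2.trans h12, g3, g4.trans hS g2, fun B hB hBκ n a ha => ?_⟩
          obtain ⟨d, hd, hda⟩ := g5 B hB hBκ n a ha
          exact ⟨d, fun i => h12 (hd i), hda⟩)
      obtain ⟨G, hEG, -, hG, hGs⟩ := S.exists_kSat (D := E ∪ F)
        ((Cardinal.mk_union_le _ _).trans (Cardinal.add_le_of_le S.aleph0_le hE hF))
      exact ⟨F, G, hDF, subset_union_left.trans hEG, hcon, hF, hG, subset_union_right.trans hEG,
        ⟨G, subset_union_left.trans hEG, Subset.rfl, hGs⟩, fun k => htask ⟨k⟩⟩)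
  refine ⟨M, N, h1, h2, ?_, h3, h4, h5, ?_, ?_⟩
  · intro x hx
    obtain ⟨P, R, F, G, hP, -, hPF, -, -, hGN, -, -, hFG, -⟩ := h6 {x} (by simpa using hx)
      (by simpa using one_lt_aleph0.trans_le S.reg.aleph0_le) ∅ (empty_subset _) (by simpa using S.reg.pos)
    exact hGN (hFG (hPF (hP rfl)))
  · intro B hB hBκ a
    obtain ⟨P, R, F, G, -, hR, -, -, -, hGN, -, -, -, ⟨N', hRN, hNG, hN'⟩, -⟩ :=
      h6 ∅ (empty_subset _) (by simpa using S.reg.pos) B hB hBκ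
    obtain ⟨a', ha', h⟩ := hN' B (hR.trans hRN) hBκ a
    exact ⟨a', hGN (hNG ha'), h⟩
  · intro C hC hCκ k
    -- `Good.of_subsets` produces level `k + 1`; going back down to `k` treats `k = 0` on the same
    -- footing.
    refine (Good.of_subsets S k fun B hB hBκ => ?_).pred
    obtain ⟨P, R, F, G, hBP, hCR, -, -, hFM, -, -, hcon, -, -, hk⟩ := h6 B hB hBκ C hC hCκ
    obtain ⟨M', hPM, hMF, hg, hSN, hreal⟩ := hk k
    refine ⟨M', hMF.trans hFM, hBP.trans hPM, hg.anti hCR, hSN.trans (hcon.sNsp S.reg) hMF, ?_⟩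
    intro B hB hBκ n a ha
    obtain ⟨d, hd, hda⟩ := hreal B hB hBκ n a ha
    exact ⟨d, fun i => hFM (hd i), hda⟩

end Good

end DependentThy

namespace DependentThy

open FirstOrder.Language Set

variable {L : FirstOrder.Language.{u, v}} {𝔐 : Type w} [L.Structure 𝔐]

/-! ### Honest definitions and projections of externally definable sets -/

section ExtDef

variable (L) in
/-- The trace of `Y` on `M` is, finitely approximately, the trace of an instance of an
`∅`-definable family. -/
def ExtDef {ι : Type} (M : Set 𝔐) (Y : Set (ι → 𝔐)) : Prop :=
  ∃ (γ : Type) (_ : Finite γ) (X : Set (γ ⊕ ι → 𝔐)), (∅ : Set 𝔐).Definable L X ∧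
    ∀ F : Set (ι → 𝔐), F.Finite → (∀ d ∈ F, ∀ i, d i ∈ M) →
      ∃ m : γ → 𝔐, ∀ d ∈ F, (d ∈ Y ↔ Sum.elim m d ∈ X)

variable {ι : Type} {M : Set 𝔐}

theorem ExtDef.of_definable {D : Set 𝔐} {Y : Set (ι → 𝔐)} (hY : D.Definable L Y) : ExtDef L M Y := by
  obtain ⟨k, b, X, -, hX, rfl⟩ := definable_iff_fiber.1 hY
  exact ⟨Fin k, inferInstance, X, hX, fun _ _ _ => ⟨b, fun _ _ => Iff.rfl⟩⟩

theorem ExtDef.compl {Y : Set (ι → 𝔐)} (hY : ExtDef L M Y) : ExtDef L M Yᶜ := by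
  obtain ⟨γ, hγ, X, hX, h⟩ := hY
  refine ⟨γ, hγ, Xᶜ, hX.compl, fun F hF hFM => ?_⟩
  obtain ⟨m, hm⟩ := h F hF hFM
  exact ⟨m, fun d hd => not_congr (hm d hd)⟩

theorem ExtDef.union {Y Y' : Set (ι → 𝔐)} (hY : ExtDef L M Y) (hY' : ExtDef L M Y') :
    ExtDef L M (Y ∪ Y') := by
  obtain ⟨γ, hγ, X, hX, h⟩ := hY
  obtain ⟨γ', hγ', X', hX', h'⟩ := hY'
  refine ⟨γ ⊕ γ', inferInstance, {v | v ∘ (Sum.map Sum.inl id : γ ⊕ ι → (γ ⊕ γ') ⊕ ι) ∈ X} ∪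
    {v | v ∘ (Sum.map Sum.inr id : γ' ⊕ ι → (γ ⊕ γ') ⊕ ι) ∈ X'},
    (hX.preimage_comp _).union (hX'.preimage_comp _), fun F hF hFM => ?_⟩
  obtain ⟨m, hm⟩ := h F hF hFM
  obtain ⟨m', hm'⟩ := h' F hF hFM
  refine ⟨Sum.elim m m', fun d hd => ?_⟩
  simp only [mem_union, mem_ofPred_eq, Sum.elim_comp_map, Sum.elim_comp_inl, Sum.elim_comp_inr,
    Function.comp_id]
  rw [hm d hd, hm' d hd]

/-- The sequence of pairs `(x, y), v`. -/
def pairCons {k : ℕ} (x y : ι → 𝔐) (v : Fin k × Bool × ι → 𝔐) : Fin (k + 1) × Bool × ι → 𝔐 :=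
  Sum.elim (fun p : Bool × ι => if p.1 then y p.2 else x p.2) v ∘
    fun p : Fin (k + 1) × Bool × ι => Fin.cases (motive := fun _ => (Bool × ι) ⊕ (Fin k × Bool × ι))
      (Sum.inl p.2) (fun i => Sum.inr (i, p.2)) p.1

theorem definable_pairCons [Finite ι] {k : ℕ} {x y : ι → 𝔐} (hx : ∀ i, x i ∈ M) (hy : ∀ i, y i ∈ M)
    {Γ : Set (Fin (k + 1) × Bool × ι → 𝔐)} (hΓ : M.Definable L Γ) :
    M.Definable L {v : Fin k × Bool × ι → 𝔐 | pairCons x y v ∈ Γ} :=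
  definable_fiber (fun p => by split_ifs; exacts [hy _, hx _]) (hΓ.preimage_comp _)

/-- `Γ` contains the generic sequences of pairs of the ultrafilter `u`. -/
def GenPairs (u : Ultrafilter (ι → 𝔐)) : (k : ℕ) → Set (Fin k × Bool × ι → 𝔐) → Prop
  | 0, Γ => (fun p => p.1.elim0) ∈ Γ
  | k + 1, Γ => ∀ᶠ x in (u : Filter (ι → 𝔐)), ∀ᶠ y in (u : Filter (ι → 𝔐)),
      GenPairs u k {v | pairCons x y v ∈ Γ}

theorem GenPairs.mono {u : Ultrafilter (ι → 𝔐)} : ∀ {k : ℕ} {Γ Γ' : Set (Fin k × Bool × ι → 𝔐)},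
    GenPairs u k Γ → Γ ⊆ Γ' → GenPairs u k Γ'
  | 0, _, _, h, hs => hs h
  | _ + 1, _, _, h, hs => by
    refine Filter.Eventually.mono h fun x hx => Filter.Eventually.mono hx fun y hy => ?_
    exact hy.mono fun v hv => hs hv

theorem GenPairs.inter {u : Ultrafilter (ι → 𝔐)} : ∀ {k : ℕ} {Γ Γ' : Set (Fin k × Bool × ι → 𝔐)},
    GenPairs u k Γ → GenPairs u k Γ' → GenPairs u k (Γ ∩ Γ')
  | 0, _, _, h, h' => ⟨h, h'⟩
  | _ + 1, _, _, h, h' => by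
    filter_upwards [h, h'] with x hx hx'
    filter_upwards [hx, hx'] with y hy hy'
    exact hy.inter hy'

theorem GenPairs.univ (u : Ultrafilter (ι → 𝔐)) : ∀ k : ℕ, GenPairs u k Set.univ
  | 0 => trivial
  | k + 1 => Filter.Eventually.of_forall fun _ => Filter.Eventually.of_forall fun _ => GenPairs.univ u k

theorem GenPairs.iInter {u : Ultrafilter (ι → 𝔐)} {k : ℕ} {J : Type*} [Finite J]
    {Γ : J → Set (Fin k × Bool × ι → 𝔐)} (h : ∀ j, GenPairs u k (Γ j)) : GenPairs u k (⋂ j, Γ j) := by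
  classical
  cases nonempty_fintype J
  have : ∀ s : Finset J, GenPairs u k (⋂ j ∈ s, Γ j) := by
    intro s
    induction s using Finset.induction_on with
    | empty => simpa using GenPairs.univ u k
    | insert a s _ ih => rw [Finset.set_biInter_insert]; exact (h a).inter ih
  simpa using this Finset.univ

/-- The sequence `x, v`. -/
def seqCons {k : ℕ} (x : ι → 𝔐) (v : Fin k × ι → 𝔐) : Fin (k + 1) × ι → 𝔐 :=
  fun p => Fin.cases (motive := fun _ => 𝔐) (x p.2) (fun i => v (i, p.2)) p.1

/-- `Z` contains the generic sequences of the ultrafilter `u`. -/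
def GenSeq (u : Ultrafilter (ι → 𝔐)) : (k : ℕ) → Set (Fin k × ι → 𝔐) → Prop
  | 0, Z => (fun p => p.1.elim0) ∈ Z
  | k + 1, Z => ∀ᶠ x in (u : Filter (ι → 𝔐)), GenSeq u k {v | seqCons x v ∈ Z}

theorem GenSeq.compl {u : Ultrafilter (ι → 𝔐)} : ∀ {k : ℕ} {Z : Set (Fin k × ι → 𝔐)},
    ¬ GenSeq u k Z → GenSeq u k Zᶜ
  | 0, _, h => h
  | _ + 1, _, h => by
    have h' := Ultrafilter.eventually_not.2 h
    exact Filter.Eventually.mono h' fun x hx => GenSeq.compl hx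

theorem genPairs_select {u : Ultrafilter (ι → 𝔐)} : ∀ {k : ℕ} (ε : Fin k → Bool) {Z : Set (Fin k × ι → 𝔐)},
    GenSeq u k Z → GenPairs u k {v | (fun p : Fin k × ι => v (p.1, ε p.1, p.2)) ∈ Z}
  | 0, _, Z, h => by
    change (fun p : Fin 0 × ι => _) ∈ Z
    convert (show (fun p => p.1.elim0) ∈ Z from h) using 1
  | k + 1, ε, Z, h => by
    have key : ∀ (x y : ι → 𝔐) (v : Fin k × Bool × ι → 𝔐),
        (fun p : Fin (k + 1) × ι => pairCons x y v (p.1, ε p.1, p.2)) =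
        seqCons (if ε 0 then y else x) (fun p : Fin k × ι => v (p.1, ε p.1.succ, p.2)) := by
      intro x y v
      funext p
      obtain ⟨j, i⟩ := p
      refine Fin.cases ?_ (fun j => ?_) j
      · simp only [pairCons, seqCons, Function.comp_apply, Fin.cases_zero, Sum.elim_inl]
        split_ifs <;> rfl
      · simp [pairCons, seqCons]
    have h2 : ∀ x : ι → 𝔐, GenSeq u k {v | seqCons x v ∈ Z} →
        GenPairs u k {v | seqCons x (fun p : Fin k × ι => v (p.1, ε p.1.succ, p.2)) ∈ Z} :=
      fun x hx => genPairs_select (fun j => ε j.succ) hx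
    cases hε : ε 0 with
    | false =>
      refine Filter.Eventually.mono h fun x hx => Filter.Eventually.of_forall fun y => ?_
      refine (h2 x hx).mono fun v hv => ?_
      change _ ∈ Z
      rw [key, hε]; exact hv
    | true =>
      refine Filter.Eventually.of_forall fun x => Filter.Eventually.mono h fun y hy => ?_
      refine (h2 y hy).mono fun v hv => ?_
      change _ ∈ Z
      rw [key, hε]; exact hv

variable (L) in
/-- `G` is covered, on finite subsets, by members of an `∅`-definable family with parameters in `M`
whose traces on `M` are contained in `Y`. -/
def Honest (M : Set 𝔐) (Y G : Set (ι → 𝔐)) : Prop :=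
  ∃ (γ : Type) (_ : Finite γ) (θ : Set (γ ⊕ ι → 𝔐)), (∅ : Set 𝔐).Definable L θ ∧
    ∀ X0 : Set (ι → 𝔐), X0.Finite → X0 ⊆ G → ∃ w : γ → 𝔐, (∀ i, w i ∈ M) ∧
      (∀ d ∈ X0, Sum.elim w d ∈ θ) ∧ ∀ d : ι → 𝔐, (∀ i, d i ∈ M) → Sum.elim w d ∈ θ → d ∈ Y

theorem Honest.mono {Y G G' : Set (ι → 𝔐)} (h : Honest L M Y G) (hG : G' ⊆ G) : Honest L M Y G' := by
  obtain ⟨γ, hγ, θ, hθ, h⟩ := h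
  exact ⟨γ, hγ, θ, hθ, fun X0 hX0 hX0G => h X0 hX0 (hX0G.trans hG)⟩

theorem Honest.empty (Y : Set (ι → 𝔐)) : Honest L M Y ∅ := by
  refine ⟨Empty, inferInstance, ∅, definable_empty, fun X0 _ hX0 => ⟨Empty.elim, fun i => i.elim, ?_, ?_⟩⟩
  · intro d hd; exact absurd (hX0 hd) (notMem_empty _)
  · intro d _ hd; exact absurd hd (notMem_empty _)

theorem Honest.union {Y G G' : Set (ι → 𝔐)} (h : Honest L M Y G) (h' : Honest L M Y G') :
    Honest L M Y (G ∪ G') := by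
  obtain ⟨γ, hγ, θ, hθ, h⟩ := h
  obtain ⟨γ', hγ', θ', hθ', h'⟩ := h'
  refine ⟨γ ⊕ γ', inferInstance, {v | v ∘ (Sum.map Sum.inl id : γ ⊕ ι → (γ ⊕ γ') ⊕ ι) ∈ θ} ∪
    {v | v ∘ (Sum.map Sum.inr id : γ' ⊕ ι → (γ ⊕ γ') ⊕ ι) ∈ θ'},
    (hθ.preimage_comp _).union (hθ'.preimage_comp _), fun X0 hX0 hX0G => ?_⟩
  obtain ⟨w, hw, h1, h2⟩ := h (X0 ∩ G) (hX0.inter_of_left G) inter_subset_right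
  obtain ⟨w', hw', h1', h2'⟩ := h' (X0 ∩ G') (hX0.inter_of_left G') inter_subset_right
  refine ⟨Sum.elim w w', ?_, ?_, ?_⟩
  · rintro (i | i)
    exacts [hw i, hw' i]
  · intro d hd
    simp only [mem_union, mem_ofPred_eq, Sum.elim_comp_map, Sum.elim_comp_inl, Sum.elim_comp_inr,
      Function.comp_id]
    rcases hX0G hd with h | h
    exacts [Or.inl (h1 d ⟨hd, h⟩), Or.inr (h1' d ⟨hd, h⟩)]
  · intro d hdM hd
    simp only [mem_union, mem_ofPred_eq, Sum.elim_comp_map, Sum.elim_comp_inl, Sum.elim_comp_inr,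
      Function.comp_id] at hd
    rcases hd with h | h
    exacts [h2 d hdM h, h2' d hdM h]

/-- Each ultrafilter concentrating on `Y` and on `M` contains an honest set. -/
theorem NIP.exists_honest_mem (hnip : NIP L 𝔐) [Finite ι] {Y : Set (ι → 𝔐)} (hY : ExtDef L M Y)
    {u : Ultrafilter (ι → 𝔐)} (huM : {x | ∀ i, x i ∈ M} ∈ u) (huY : Y ∈ u) :
    ∃ G ∈ u, Honest L M Y G := by
  classical
  -- An alternating sequence consists of pairs of points of `M`, the first outside `Y` and the
  -- second in `Y`. `R k` says that no `M`-definable property of generic sequences of `k` pairs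
  -- excludes these; NIP makes `R` fail somewhere.
  let Alt : ∀ k, (Fin k × Bool × ι → 𝔐) → Prop := fun k v => (∀ p, v p ∈ M) ∧
    ∀ j, (fun i => v (j, false, i)) ∉ Y ∧ (fun i => v (j, true, i)) ∈ Y
  let R : ℕ → Prop := fun k => ∀ Γ : Set (Fin k × Bool × ι → 𝔐), M.Definable L Γ → GenPairs u k Γ →
    ∃ v ∈ Γ, Alt k v
  have hR0 : R 0 := fun Γ _ hΓ => ⟨_, hΓ, fun p => p.1.elim0, fun j => j.elim0⟩
  have hRK : ∃ K, ¬ R K := by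
    obtain ⟨γ, hγ, X, hX, hXY⟩ := hY
    obtain ⟨K, hK⟩ := hnip γ ι X hX
    refine ⟨K, fun hR => ?_⟩
    let Z : Set (Fin K) → Set (Fin K × ι → 𝔐) := fun s => {v | ∃ m : γ → 𝔐, Sum.elim v m ∈
      (⋂ j : Fin K, {z : (Fin K × ι) ⊕ γ → 𝔐 |
        j ∈ s ↔ (z ∘ (Sum.elim Sum.inr (fun i => Sum.inl (j, i)) : γ ⊕ ι → _)) ∈ X})}
    have hZdef : ∀ s, (∅ : Set 𝔐).Definable L (Z s) := by
      intro s
      refine Definable.exists_of_finite (definable_iInter_of_finite fun j => ?_)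
      have h1 := hX.preimage_comp (Sum.elim Sum.inr (fun i => Sum.inl (j, i)) : γ ⊕ ι → (Fin K × ι) ⊕ γ)
      by_cases hj : j ∈ s
      · convert h1 using 1; ext z; simp [hj]
      · convert h1.compl using 1; ext z; simp [hj]
    have hZ : ∀ s v, v ∈ Z s ↔ ∃ m : γ → 𝔐, ∀ j, j ∈ s ↔ Sum.elim m (fun i => v (j, i)) ∈ X := by
      intro s v
      simp only [Z, mem_ofPred_eq, mem_iInter]
      refine exists_congr fun a => forall_congr' fun j => ?_
      have : (Sum.elim v a) ∘ (Sum.elim Sum.inr (fun i => Sum.inl (j, i)) : γ ⊕ ι → _) =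
          Sum.elim a (fun i => v (j, i)) := by
        funext z; rcases z with z | z <;> rfl
      rw [this]
    let sel : (Fin K → Bool) → (Fin K × Bool × ι → 𝔐) → (Fin K × ι → 𝔐) :=
      fun ε v => fun p => v (p.1, ε p.1, p.2)
    -- `Γ` says that all ways of selecting one point from each pair realize the same patterns of
    -- `X`. Generic sequences have this property, because both entries of a pair follow the same
    -- ultrafilter.
    let Γ : Set (Fin K × Bool × ι → 𝔐) := ⋂ q : Set (Fin K) × (Fin K → Bool),
      {v | sel q.2 v ∈ Z q.1 ↔ sel (fun _ => false) v ∈ Z q.1}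
    have hsel : ∀ ε s, M.Definable L {v | sel ε v ∈ Z s} := fun ε s =>
      ((hZdef s).mono (empty_subset _)).preimage_comp (fun p : Fin K × ι => (p.1, ε p.1, p.2))
    have hΓ : M.Definable L Γ := by
      refine definable_iInter_of_finite fun q => ?_
      convert ((hsel q.2 q.1).inter (hsel (fun _ => false) q.1)).union
        ((hsel q.2 q.1).compl.inter (hsel (fun _ => false) q.1).compl) using 1
      ext v
      simp only [mem_ofPred_eq, mem_union, mem_inter_iff, mem_compl_iff]
      tauto
    have hgen : GenPairs u K Γ := by
      refine GenPairs.iInter fun q => ?_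
      by_cases h : GenSeq u K (Z q.1)
      · exact ((genPairs_select q.2 h).inter (genPairs_select (fun _ => false) h)).mono
          fun v hv => iff_of_true hv.1 hv.2
      · have h' := GenSeq.compl h
        exact ((genPairs_select q.2 h').inter (genPairs_select (fun _ => false) h')).mono
          fun v hv => iff_of_false hv.1 hv.2
    obtain ⟨v, hvΓ, hvM, hv⟩ := hR Γ hΓ hgen
    obtain ⟨m, hm⟩ := hXY (range fun p : Fin K × Bool => fun i => v (p.1, p.2, i)) (finite_range _)
      (by rintro _ ⟨p, rfl⟩ i; exact hvM _)
    -- The pattern `s` is not realized on the first entries, but on an alternating sequence the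
    -- selection dictated by `s` realizes it.
    obtain ⟨s, hs⟩ := hK (fun j i => v (j, false, i))
    have h1 := mem_iInter.1 hvΓ (s, fun j => decide (j ∈ s))
    have h2 : sel (fun j => decide (j ∈ s)) v ∈ Z s := by
      rw [hZ]
      refine ⟨m, fun j => ?_⟩
      have h3 := hm _ ⟨(j, decide (j ∈ s)), rfl⟩
      simp only [sel]
      rw [← h3]
      by_cases hj : j ∈ s
      · simp only [hj, decide_true, true_iff]; exact (hv j).2
      · simp only [hj, decide_false, false_iff]; exact (hv j).1
    obtain ⟨m', hm'⟩ := (hZ _ _).1 (h1.1 h2)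
    exact hs m' hm'
  -- At the first failure some `Γ` excludes alternating sequences of length `k + 1`, while length
  -- `k` cannot be excluded.
  obtain ⟨k, hk, hk'⟩ : ∃ k, R k ∧ ¬ R (k + 1) := by
    by_contra! h
    obtain ⟨K, hK⟩ := hRK
    exact hK (Nat.rec hR0 (fun k hk => h k hk) K)
  simp only [R, not_forall, not_exists, not_and] at hk'
  obtain ⟨Γ, hΓ, hgen, hΓA⟩ := hk'
  obtain ⟨n, e, Γ0, he, hΓ0, rfl⟩ := definable_iff_fiber.1 hΓ
  -- The honest formula says that `x`, put in front of `y` and `v`, gives a sequence in `Γ`. Its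
  -- parameters are those of `Γ`, a point `y` of `Y`, and an alternating `v` of length `k`.
  refine ⟨_, Filter.inter_mem hgen huM, Fin n ⊕ (ι ⊕ (Fin k × Bool × ι)), inferInstance,
    {z | z ∘ (Sum.elim (fun i => Sum.inl (Sum.inl i)) (fun p : Fin (k + 1) × Bool × ι =>
      Fin.cases (motive := fun _ => (Fin n ⊕ (ι ⊕ (Fin k × Bool × ι))) ⊕ ι)
        (if p.2.1 then Sum.inl (Sum.inr (Sum.inl p.2.2)) else Sum.inr p.2.2)
        (fun i => Sum.inl (Sum.inr (Sum.inr (i, p.2)))) p.1)) ∈ Γ0},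
    hΓ0.preimage_comp _, fun X0 hX0 hX0G => ?_⟩
  have h1 : ∀ᶠ y in (u : Filter (ι → 𝔐)), ∀ x ∈ X0,
      GenPairs u k {v | Sum.elim e (pairCons x y v) ∈ Γ0} :=
    (Filter.eventually_all_finite hX0).2 fun x hx => (hX0G hx).1
  obtain ⟨y, hy, hyM, hyY⟩ : ∃ y, (∀ x ∈ X0, GenPairs u k {v | Sum.elim e (pairCons x y v) ∈ Γ0}) ∧
      (∀ i, y i ∈ M) ∧ y ∈ Y :=
    (h1.and ((Filter.eventually_of_mem huM fun _ h => h).and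
      (Filter.eventually_of_mem huY fun _ h => h))).exists
  have hfin : Finite X0 := hX0
  obtain ⟨v, hv, hvM, hvA⟩ := hk (⋂ x : X0, {v | Sum.elim e (pairCons x.1 y v) ∈ Γ0})
    (definable_iInter_of_finite fun x => definable_pairCons (hX0G x.2).2 hyM hΓ)
    (GenPairs.iInter fun x => hy x x.2)
  let w : Fin n ⊕ (ι ⊕ (Fin k × Bool × ι)) → 𝔐 := Sum.elim e (Sum.elim y v)
  have hw : ∀ x : ι → 𝔐, (Sum.elim w x) ∘ (Sum.elim (fun i => Sum.inl (Sum.inl i))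
      (fun p : Fin (k + 1) × Bool × ι =>
      Fin.cases (motive := fun _ => (Fin n ⊕ (ι ⊕ (Fin k × Bool × ι))) ⊕ ι)
        (if p.2.1 then Sum.inl (Sum.inr (Sum.inl p.2.2)) else Sum.inr p.2.2)
        (fun i => Sum.inl (Sum.inr (Sum.inr (i, p.2)))) p.1)) = Sum.elim e (pairCons x y v) := by
    intro x
    funext z
    rcases z with z | ⟨j, b, i⟩
    · rfl
    · refine Fin.cases ?_ (fun j => ?_) j
      · cases b <;> simp [pairCons, w]
      · simp [pairCons, w]
  refine ⟨w, ?_, ?_, ?_⟩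
  · rintro (i | i | p)
    exacts [he i, hyM i, hvM p]
  · intro x hx
    rw [mem_ofPred_eq, hw]
    exact mem_iInter.1 hv ⟨x, hx⟩
  -- If such an `x` in `M` were outside `Y`, then `(x, y), v` would be an alternating sequence of
  -- length `k + 1` in `Γ`.
  · intro x hxM hx
    rw [mem_ofPred_eq, hw] at hx
    by_contra hxY
    refine hΓA _ hx ⟨?_, ?_⟩
    · rintro ⟨j, b, i⟩
      refine Fin.cases ?_ (fun j => ?_) j
      · cases b
        · simpa [pairCons] using hxM i
        · simpa [pairCons] using hyM i
      · simpa [pairCons] using hvM (j, b, i)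
    · intro j
      refine Fin.cases ?_ (fun j => ?_) j
      · simpa [pairCons] using ⟨hxY, hyY⟩
      · simpa [pairCons] using hvA j

/-- Externally definable sets have honest definitions. -/
theorem NIP.exists_honest (hnip : NIP L 𝔐) [Finite ι] {Y : Set (ι → 𝔐)} (hY : ExtDef L M Y) :
    Honest L M Y (Y ∩ {x | ∀ i, x i ∈ M}) := by
  by_contra hcon
  -- Complements in `Y ∩ M` of honest sets form a filter, since honest sets are closed under finite
  -- unions. It is proper if `Y ∩ M` is not honest, and an ultrafilter above it contradicts the
  -- previous lemma.
  let f : Filter (ι → 𝔐) :=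
    { sets := {s | ∃ G, Honest L M Y G ∧ (Y ∩ {x | ∀ i, x i ∈ M}) \ G ⊆ s}
      univ_sets := ⟨∅, Honest.empty Y, subset_univ _⟩
      sets_of_superset := fun ⟨G, hG, hs⟩ hst => ⟨G, hG, hs.trans hst⟩
      inter_sets := fun ⟨G, hG, hs⟩ ⟨G', hG', hs'⟩ => ⟨G ∪ G', hG.union hG', fun x hx =>
        ⟨hs ⟨hx.1, fun h => hx.2 (Or.inl h)⟩, hs' ⟨hx.1, fun h => hx.2 (Or.inr h)⟩⟩⟩ }
  have hf : f.NeBot := by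
    refine ⟨fun h => ?_⟩
    have : (∅ : Set (ι → 𝔐)) ∈ f := by rw [h]; trivial
    obtain ⟨G, hG, hs⟩ := this
    exact hcon (hG.mono (by rwa [subset_empty_iff, sdiff_eq_empty] at hs))
  have hle : ∀ s ∈ f, s ∈ Ultrafilter.of f := fun s hs => Ultrafilter.of_le f hs
  have h0 : Y ∩ {x | ∀ i, x i ∈ M} ∈ f := ⟨∅, Honest.empty Y, sdiff_subset⟩
  obtain ⟨G, hGu, hG⟩ := hnip.exists_honest_mem hY (u := Ultrafilter.of f)
    (Filter.mem_of_superset (hle _ h0) inter_subset_right)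
    (Filter.mem_of_superset (hle _ h0) inter_subset_left)
  have h1 : (Y ∩ {x | ∀ i, x i ∈ M}) \ G ∈ f := ⟨G, hG, Subset.rfl⟩
  obtain ⟨x, hx, hx'⟩ := (Ultrafilter.of f).nonempty_of_mem (Filter.inter_mem hGu (hle _ h1))
  exact hx'.2 hx

/-- Externally definable sets are closed under projections. -/
theorem ExtDef.exists_proj (hnip : NIP L 𝔐) [Finite ι] {κ : Type} [Finite κ]
    (hM : ∀ X : Set (κ → 𝔐), M.Definable L X → X.Nonempty → ∃ a ∈ X, ∀ i, a i ∈ M)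
    {Y : Set (ι ⊕ κ → 𝔐)} (hY : ExtDef L M Y) :
    ExtDef L M {a : ι → 𝔐 | ∃ b : κ → 𝔐, (∀ i, b i ∈ M) ∧ Sum.elim a b ∈ Y} := by
  classical
  obtain ⟨γ, hγ, θ, hθ, h⟩ := hnip.exists_honest hY
  let f : γ ⊕ (ι ⊕ κ) → (γ ⊕ ι) ⊕ κ := Sum.elim (fun i => Sum.inl (Sum.inl i)) (Sum.map Sum.inr id)
  have hf : ∀ (w : γ → 𝔐) (a : ι → 𝔐) (b : κ → 𝔐), Sum.elim (Sum.elim w a) b ∘ f =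
      Sum.elim w (Sum.elim a b) := by
    intro w a b; funext z; rcases z with z | z | z <;> rfl
  refine ⟨γ, hγ, {v | ∃ b : κ → 𝔐, Sum.elim v b ∈ {z | z ∘ f ∈ θ}},
    Definable.exists_of_finite (hθ.preimage_comp f), fun F hF hFM => ?_⟩
  rcases F.eq_empty_or_nonempty with rfl | ⟨a0, ha0⟩
  · obtain ⟨w, -⟩ := h ∅ finite_empty (empty_subset _)
    exact ⟨w, fun d hd => absurd hd (notMem_empty _)⟩
  by_cases hne : Nonempty (κ → 𝔐)
  swap
  · obtain ⟨w, hw, -⟩ := h ∅ finite_empty (empty_subset _)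
    exact ⟨w, fun a _ => iff_of_false (fun ⟨b, _⟩ => hne ⟨b⟩) fun ⟨b, _⟩ => hne ⟨b⟩⟩
  have hb : ∀ a : ι → 𝔐, a ∈ {a : ι → 𝔐 | ∃ b : κ → 𝔐, (∀ i, b i ∈ M) ∧ Sum.elim a b ∈ Y} →
      ∃ b : κ → 𝔐, (∀ i, b i ∈ M) ∧ Sum.elim a b ∈ Y := fun a ha => ha
  choose! g hg using hb
  -- The honest formula need only cover one witness for each of the finitely many points.
  -- Conversely, a point satisfying its projection has a witness in `M`, and honesty puts the pair
  -- into `Y`.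
  obtain ⟨w, hw, h1, h2⟩ := h ((fun a => Sum.elim a (g a)) '' (F ∩ {a : ι → 𝔐 | ∃ b : κ → 𝔐,
      (∀ i, b i ∈ M) ∧ Sum.elim a b ∈ Y})) ((hF.inter_of_left _).image _) (by
    rintro _ ⟨a, ⟨haF, ha⟩, rfl⟩
    refine ⟨(hg a ha).2, ?_⟩
    rintro (i | i)
    exacts [hFM a haF i, (hg a ha).1 i])
  refine ⟨w, fun a ha => ⟨fun haY => ⟨g a, ?_⟩, ?_⟩⟩
  · change _ ∘ f ∈ θ
    rw [hf]
    exact h1 _ ⟨a, ⟨ha, haY⟩, rfl⟩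
  · intro hex
    have hdef : M.Definable L {b : κ → 𝔐 | Sum.elim (Sum.elim w a) b ∈ {z | z ∘ f ∈ θ}} :=
      definable_fiber (by rintro (i | i); exacts [hw i, hFM a ha i])
        ((hθ.mono (empty_subset _)).preimage_comp f)
    obtain ⟨b, hb, hbM⟩ := hM _ hdef hex
    change _ ∘ f ∈ θ at hb
    rw [hf] at hb
    exact ⟨b, hbM, h2 _ (by rintro (i | i); exacts [hFM a ha i, hbM i]) hb⟩

end ExtDef

end DependentThy

namespace DependentThy

open FirstOrder.Language Set

variable {L : FirstOrder.Language.{u, v}} {𝔐 : Type w} [L.Structure 𝔐]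
variable {κbar κ lam : Cardinal.{w}}

theorem ExtDef.comp {ι κ : Type} {M : Set 𝔐} {Y : Set (ι → 𝔐)} (hY : ExtDef L M Y) (f : ι → κ) :
    ExtDef L M {a : κ → 𝔐 | a ∘ f ∈ Y} := by
  obtain ⟨γ, hγ, X, hX, h⟩ := hY
  refine ⟨γ, hγ, {v | v ∘ (Sum.map id f) ∈ X}, hX.preimage_comp _, fun F hF hFM => ?_⟩
  obtain ⟨m, hm⟩ := h ((fun a => a ∘ f) '' F) (hF.image _) (by
    rintro _ ⟨a, ha, rfl⟩ i
    exact hFM a ha _)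
  refine ⟨m, fun d hd => (hm _ ⟨d, hd, rfl⟩).trans ?_⟩
  rw [mem_ofPred_eq, Sum.elim_comp_map, Function.comp_id]

/-- Tuples with the same type over `E` are indistinguishable to every tuple of `E`, hence to the
ultrafilter. -/
theorem Nsp.of_average {ι : Type*} [Finite ι] {D E : Set 𝔐} {U : Ultrafilter (ι → 𝔐)} {a : ι → 𝔐}
    (ha : ∀ X, D.Definable L X → (a ∈ X ↔ X ∈ U)) (hE : {v | ∀ i, v i ∈ E} ∈ U) :
    Nsp L D E (range a) := by
  rw [Nsp.range_iff]
  intro k b c hb hc hbc X hX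
  have h1 : ∀ b : Fin k → 𝔐, (∀ i, b i ∈ D) → (Sum.elim b a ∈ X ↔ {v | Sum.elim b v ∈ X} ∈ U) :=
    fun b hb => ha _ (definable_fiber hb (hX.mono (empty_subset _)))
  rw [h1 b hb, h1 c hc]
  have h2 : ∀ v : ι → 𝔐, (∀ i, v i ∈ E) → (Sum.elim b v ∈ X ↔ Sum.elim c v ∈ X) := by
    intro v hv
    have h3 := hbc _ (definable_fiber (D := E) hv
      ((hX.mono (empty_subset _)).preimage_comp (Sum.swap : Fin k ⊕ ι → ι ⊕ Fin k)))
    simpa only [mem_ofPred_eq, mem_preimage, Sum.elim_swap] using h3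
  constructor <;> intro h <;> filter_upwards [h, hE] with v hv hvE
  · exact (h2 v hvE).1 hv
  · exact (h2 v hvE).2 hv

theorem SNsp.refl (hκ : κ.IsRegular) (M : Set 𝔐) : SNsp L κ M M := (Con.refl M).sNsp hκ

/-! ### Formulas of the trace expansion are decided by nonsplitting types -/

section TraceFam

theorem exists_mem_of_meetsDefinable {M : Set 𝔐} (hM : L.MeetsDefinable M) {X : Set (Unit → 𝔐)}
    (hX : M.Definable L X) (hne : X.Nonempty) : ∃ a ∈ X, ∀ i, a i ∈ M := by
  obtain ⟨a, ha⟩ := hne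
  obtain ⟨y, hy, hyM⟩ := hM {y | (fun _ => y) ∈ X} ⟨a (), ha⟩
    (hX.preimage_comp (fun _ => (0 : Fin 1)))
  exact ⟨_, hy, fun _ => hyM⟩

theorem KSat.meetsDefinable (S : Setting L 𝔐 κbar κ lam) {M : Set 𝔐} (hM : KSat L κ M) :
    L.MeetsDefinable M := by
  rintro D ⟨x, hx⟩ hD
  obtain ⟨a, ha, haM⟩ := hM.exists_mem S.sat S.reg.aleph0_le S.le_bar hD ⟨fun _ => x, hx⟩
  exact ⟨a 0, ha, haM 0⟩

variable (L) in
/-- The families of sets defined in the expansions of the sets `M` by the traces of `C`-definable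
sets, by formulas in which quantifiers are nested to depth at most `k`. -/
inductive TraceFam (C : Set 𝔐) : ℕ → ∀ {ι : Type}, (Set 𝔐 → Set (ι → 𝔐)) → Prop
  | atom (k : ℕ) {ι : Type} (hι : Finite ι) {X : Set (ι → 𝔐)} (hX : C.Definable L X) :
      TraceFam C k fun _ => X
  | imp {k : ℕ} {ι : Type} (hι : Finite ι) {P Q : Set 𝔐 → Set (ι → 𝔐)} (hP : TraceFam C k P)
      (hQ : TraceFam C k Q) : TraceFam C k fun M => (P M)ᶜ ∪ Q M
  | all {k : ℕ} {ι : Type} (hι : Finite ι) {P : Set 𝔐 → Set (ι ⊕ Unit → 𝔐)}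
      (hP : TraceFam C k P) :
      TraceFam C (k + 1) fun M => {a | ∀ y : Unit → 𝔐, (∀ i, y i ∈ M) → Sum.elim a y ∈ P M}
  | comp {k : ℕ} {ι κ : Type} (hι : Finite ι) (hκ : Finite κ) (f : ι → κ) {P : Set 𝔐 → Set (ι → 𝔐)}
      (hP : TraceFam C k P) : TraceFam C k fun M => {a | a ∘ f ∈ P M}

theorem TraceFam.mono {C C' : Set 𝔐} (hC : C ⊆ C') {k : ℕ} {ι : Type} {P : Set 𝔐 → Set (ι → 𝔐)}
    (hP : TraceFam L C k P) : ∀ {k' : ℕ}, k ≤ k' → TraceFam L C' k' P := by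
  induction hP with
  | atom k hι hX => exact fun {k'} _ => .atom k' hι (hX.mono hC)
  | imp hι _ _ h1 h2 => exact fun hk => .imp hι (h1 hk) (h2 hk)
  | all hι _ h =>
    intro k' hk
    obtain ⟨j, rfl⟩ := Nat.exists_eq_add_of_le' hk
    exact .all hι (h (Nat.le_add_left _ _))
  | comp hι hκ f _ h => exact fun hk => .comp hι hκ f (h hk)

theorem TraceFam.extDef (hnip : NIP L 𝔐) {C : Set 𝔐} {k : ℕ} {ι : Type}
    {P : Set 𝔐 → Set (ι → 𝔐)} (hP : TraceFam L C k P) {M : Set 𝔐} (hM : L.MeetsDefinable M) :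
    ExtDef L M (P M) := by
  induction hP with
  | atom k hι hX => exact .of_definable hX
  | imp hι _ _ h1 h2 => exact h1.compl.union h2
  | @all k ι hι P _ h =>
    have := (ExtDef.exists_proj hnip (fun _ => exists_mem_of_meetsDefinable hM) h.compl).compl
    convert this using 1
    ext a
    simp only [mem_ofPred_eq, mem_compl_iff, not_exists, not_and, not_not]
  | comp _ hκ f _ h => exact h.comp f

variable (L) in
/-- Membership in the members of the family `P` over the extensions of `M` is constant near `a`. -/
def Decided (κ : Cardinal.{w}) (M : Set 𝔐) {ι : Type} (P : Set 𝔐 → Set (ι → 𝔐)) (a : ι → 𝔐) :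
    Prop :=
  ∃ σ : Set (ι → 𝔐), M.Definable L σ ∧ a ∈ σ ∧ ∃ p : Prop, ∀ M' : Set 𝔐, M ⊆ M' →
    L.MeetsDefinable M' → SNsp L κ M M' → ∀ d ∈ σ, (∀ i, d i ∈ M') → (d ∈ P M' ↔ p)

/-- By reducedness the types of `c` and `a` over `M` determine their joint type, so the set is
constant on the realizations of the type of `a`; compactness yields a single formula. -/
theorem Setting.decided_atom (S : Setting L 𝔐 κbar κ lam) {C M B : Set 𝔐}
    (hMl : #M ≤ lam) (hred : ∀ (m : ℕ) (c : Fin m → 𝔐), (∀ i, c i ∈ C) → Red L κ M c) {ι : Type}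
    [Finite ι] {X : Set (ι → 𝔐)} (hX : C.Definable L X) {a : ι → 𝔐} (hB : B ⊆ M) (hBκ : #B < κ)
    (ha : Nsp L M B (range a)) : Decided L κ M (fun _ => X) a := by
  obtain ⟨n, c, Y, hc, hY, rfl⟩ := definable_iff_fiber.1 hX
  have hMb : #M < κbar := hMl.trans_lt S.lt_bar
  have key : ∀ y, EqTp L M y a → (Sum.elim c y ∈ Y ↔ Sum.elim c a ∈ Y) := by
    intro y hy
    obtain ⟨c', hc'⟩ := hy.exists_extend S.sat S.aleph0_le_bar hMb c
    have h1 := (hred n c hc (range a) (finite_range a) ⟨B, hB, hBκ, ha⟩ c' hc'.sum_right.symm)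
    rw [EqTp.union_range_iff] at h1
    exact (hc'.trans h1).sum_swap Y (hY.mono (empty_subset _))
  by_cases h : Sum.elim c a ∈ Y
  · obtain ⟨χ, hχ, haχ, hχY⟩ := S.exists_definable_subset (subset_union_left (t := range c))
      ((S.mk_union_range_le hMl c).trans_lt S.lt_bar) (definable_fiber (D := M ∪ range c)
        (fun i => Or.inr (mem_range_self i)) (hY.mono (empty_subset _)))
      fun y hy => (key y hy).2 h
    exact ⟨χ, hχ, haχ, True, fun M' _ _ _ d hd _ => iff_true_intro (hχY hd)⟩
  · obtain ⟨χ, hχ, haχ, hχY⟩ := S.exists_definable_subset (subset_union_left (t := range c))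
      ((S.mk_union_range_le hMl c).trans_lt S.lt_bar) (definable_fiber (D := M ∪ range c)
        (fun i => Or.inr (mem_range_self i)) (hY.mono (empty_subset _)).compl)
      fun y hy => fun h' => h ((key y hy).1 h')
    exact ⟨χ, hχ, haχ, False, fun M' _ _ _ d hd _ => iff_false_intro (hχY hd)⟩

theorem Decided.imp {M : Set 𝔐} {ι : Type} {P Q : Set 𝔐 → Set (ι → 𝔐)} {a : ι → 𝔐}
    (hP : Decided L κ M P a) (hQ : Decided L κ M Q a) :
    Decided L κ M (fun M => (P M)ᶜ ∪ Q M) a := by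
  obtain ⟨σ, hσ, haσ, p, h⟩ := hP
  obtain ⟨τ, hτ, haτ, q, h'⟩ := hQ
  refine ⟨σ ∩ τ, hσ.inter hτ, ⟨haσ, haτ⟩, p → q, fun M' hM hM' hS d hd hdM => ?_⟩
  simp only [mem_union, mem_compl_iff, h M' hM hM' hS d hd.1 hdM, h' M' hM hM' hS d hd.2 hdM]
  tauto

theorem Decided.comp {M : Set 𝔐} {ι κ' : Type} [Finite κ'] {P : Set 𝔐 → Set (ι → 𝔐)} {a : κ' → 𝔐}
    {f : ι → κ'} (hP : Decided L κ M P (a ∘ f)) : Decided L κ M (fun M => {a | a ∘ f ∈ P M}) a := by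
  obtain ⟨σ, hσ, haσ, p, h⟩ := hP
  exact ⟨_, hσ.preimage_comp f, haσ, p, fun M' hM hM' hS d hd hdM =>
    h M' hM hM' hS _ hd fun i => hdM _⟩

/-- The family of sets obtained by universal quantification of the last variable. -/
def allFam {ι : Type} (P : Set 𝔐 → Set (ι ⊕ Unit → 𝔐)) (M : Set 𝔐) : Set (ι → 𝔐) :=
  {a | ∀ y : Unit → 𝔐, (∀ i, y i ∈ M) → Sum.elim a y ∈ P M}

variable {ι : Type} [Finite ι] {P : Set 𝔐 → Set (ι ⊕ Unit → 𝔐)} {M : Set 𝔐} {a : ι → 𝔐}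

/-- The value of `P` near `(a, b)` is found at a point of `M` and is false. Every point near `a` in
an extension has a partner there making it close to `(a, b)`, hence refuting the universal
statement. -/
theorem Decided.all_of_false (S : Setting L 𝔐 κbar κ lam) (hM : KSat L κ M) {b : Unit → 𝔐}
    (hP : Decided L κ M P (Sum.elim a b)) {τ : Set (ι ⊕ Unit → 𝔐)} (hτ : M.Definable L τ)
    (hab : Sum.elim a b ∈ τ) (hτP : ∀ d ∈ τ, (∀ i, d i ∈ M) → d ∉ P M) :
    Decided L κ M (allFam P) a := by
  obtain ⟨σ, hσ, haσ, p, h⟩ := hP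
  obtain ⟨d, hd, hdM⟩ := hM.exists_mem S.sat S.reg.aleph0_le S.le_bar (hσ.inter hτ) ⟨_, haσ, hab⟩
  have hp : ¬ p := fun hp =>
    hτP d hd.2 hdM ((h M Subset.rfl (hM.meetsDefinable S) (SNsp.refl S.reg M) d hd.1 hdM).2 hp)
  refine ⟨_, Definable.exists_of_finite hσ, ⟨b, haσ⟩, False, fun M' hM' hM'' hS d hd hdM => ?_⟩
  obtain ⟨y, hy, hyM⟩ := exists_mem_of_meetsDefinable hM'' (definable_fiber hdM (hσ.mono hM')) hd
  exact iff_false_intro fun hall => hp ((h M' hM' hM'' hS _ hy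
    (by rintro (i | i); exacts [hdM i, hyM i])).1 (hall y hyM))

/-- A pair in an extension of `M` has a small-nonsplitting type over `M`, so its value is decided
nearby and can be read off at a point of `M` whose first part still lies in `τ`. -/
theorem Decided.all_of_true (S : Setting L 𝔐 κbar κ lam) (hM : KSat L κ M)
    (hP : ∀ B ⊆ M, #B < κ → ∀ v, Nsp L M B (range v) → Decided L κ M P v)
    {τ : Set (ι → 𝔐)} (hτ : M.Definable L τ) (ha : a ∈ τ)
    (hτP : ∀ d ∈ τ, (∀ i, d i ∈ M) → d ∈ allFam P M) : Decided L κ M (allFam P) a := by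
  refine ⟨τ, hτ, ha, True, fun M' hM' hM'' hS d hd hdM => iff_true_intro fun y hyM => ?_⟩
  have hv : ∀ i, Sum.elim d y i ∈ M' := by rintro (i | i); exacts [hdM i, hyM i]
  obtain ⟨B, hB, hBκ, hN⟩ := hS (range (Sum.elim d y)) (range_subset_iff.2 hv)
    ((finite_range _).lt_aleph0.trans_le S.reg.aleph0_le)
  obtain ⟨σ, hσ, hvσ, p, h⟩ := hP B hB hBκ _ hN
  obtain ⟨w, hw, hwM⟩ := hM.exists_mem S.sat S.reg.aleph0_le S.le_bar
    (hσ.inter (hτ.preimage_comp (Sum.inl : ι → ι ⊕ Unit))) ⟨_, hvσ, hd⟩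
  refine (h M' hM' hM'' hS _ hvσ hv).2 ((h M Subset.rfl (hM.meetsDefinable S) (SNsp.refl S.reg M)
    w hw.1 hwM).1 ?_)
  have := hτP _ hw.2 (fun i => hwM _) (w ∘ Sum.inr) (fun i => hwM _)
  rwa [Sum.elim_comp_inl_inr] at this

/-- Counterexamples are given for single formulas, but one is needed for all `B`-formulas of the
type of `a` together. An average `w` of counterexamples, with witnesses included, does not split
over the small set of their entries. Hence `P` is decided near `w`, with value false, and a copy of
`w` in `M` over `B` and the deciding parameters is as required. -/
theorem Setting.exists_notMem_all (S : Setting L 𝔐 κbar κ lam) (hM : KSat L κ M) (hMl : #M ≤ lam)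
    (hP : ∀ B ⊆ M, #B < κ → ∀ v, Nsp L M B (range v) → Decided L κ M P v)
    (hcon : ∀ τ : Set (ι → 𝔐), M.Definable L τ → a ∈ τ →
      ∃ d ∈ τ, (∀ i, d i ∈ M) ∧ d ∉ allFam P M) {B : Set 𝔐} (hB : B ⊆ M) (hBκ : #B < κ) :
    ∃ d : ι → 𝔐, (∀ i, d i ∈ M) ∧ EqTp L B d a ∧ d ∉ allFam P M := by
  classical
  obtain ⟨K, f, hK, -, hf⟩ := S.exists_index ι B
  have h1 : ∀ k : {k : K // a ∈ f k}, ∃ v : ι ⊕ Unit → 𝔐, v ∘ Sum.inl ∈ f k ∧ (∀ i, v i ∈ M) ∧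
      v ∉ P M := by
    rintro ⟨k, hk⟩
    obtain ⟨d, hd, hdM, hdP⟩ := hcon (f k) (((hf _).2 ⟨k, rfl⟩).mono hB) hk
    simp only [allFam, mem_ofPred_eq, not_forall] at hdP
    obtain ⟨y, hyM, hy⟩ := hdP
    exact ⟨Sum.elim d y, hd, by rintro (i | i); exacts [hdM i, hyM i], hy⟩
  choose v hv hvM hvP using h1
  let E : Set 𝔐 := ⋃ k, range (v k)
  have hEM : E ⊆ M := iUnion_subset fun k => range_subset_iff.2 (hvM k)
  have hEκ : #E < κ := by
    refine (Cardinal.mk_iUnion_le_sum_mk).trans_lt ?_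
    refine (Cardinal.sum_le_sum _ (fun _ => ℵ₀) fun k => (finite_range (v k)).lt_aleph0.le).trans_lt ?_
    rw [Cardinal.sum_const, Cardinal.lift_id, Cardinal.lift_id]
    exact Cardinal.mul_lt_of_lt S.reg.aleph0_le ((Cardinal.mk_subtype_le _).trans_lt (hK hBκ))
      S.aleph0_lt
  -- The filter of tails along the `B`-definable neighbourhoods of `a`. That `f k` is one of them is
  -- stated inside the conclusion and is obtained at `j = k`.
  let g : Filter (ι ⊕ Unit → 𝔐) :=
    { sets := {s | ∃ k, ∀ j, f j ⊆ f k → a ∈ f k ∧ ∀ (h : a ∈ f j), v ⟨j, h⟩ ∈ s}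
      univ_sets := by
        obtain ⟨k, hk⟩ := (hf Set.univ).1 definable_univ
        exact ⟨k, fun j _ => ⟨by rw [hk]; trivial, fun _ => trivial⟩⟩
      sets_of_superset := fun ⟨k, hk⟩ hst => ⟨k, fun j hj => ⟨(hk j hj).1, fun h => hst ((hk j hj).2 h)⟩⟩
      inter_sets := by
        rintro s t ⟨k, hk⟩ ⟨l, hl⟩
        obtain ⟨m, hm⟩ := (hf (f k ∩ f l)).1 (((hf _).2 ⟨k, rfl⟩).inter ((hf _).2 ⟨l, rfl⟩))
        refine ⟨m, fun j hj => ?_⟩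
        rw [hm] at hj ⊢
        exact ⟨⟨(hk k Subset.rfl).1, (hl l Subset.rfl).1⟩, fun h =>
          ⟨(hk j (hj.trans inter_subset_left)).2 h, (hl j (hj.trans inter_subset_right)).2 h⟩⟩ }
  have hg : g.NeBot := by
    refine ⟨fun h => ?_⟩
    have : (∅ : Set (ι ⊕ Unit → 𝔐)) ∈ g := by rw [h]; trivial
    obtain ⟨k, hk⟩ := this
    exact (hk k Subset.rfl).2 (hk k Subset.rfl).1
  obtain ⟨w, hw⟩ := exists_average S.sat S.aleph0_le_bar (hMl.trans_lt S.lt_bar) (Ultrafilter.of g)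
  obtain ⟨k0, hk0⟩ := (hf Set.univ).1 definable_univ
  have hrange : range v ∈ g := ⟨k0, fun j _ => ⟨by rw [hk0]; trivial, fun h => ⟨_, rfl⟩⟩⟩
  have hrange' := Ultrafilter.of_le g hrange
  have hN : Nsp L M E (range w) := by
    refine Nsp.of_average hw (Filter.mem_of_superset hrange' ?_)
    rintro _ ⟨k, rfl⟩ i
    exact mem_iUnion.2 ⟨k, mem_range_self i⟩
  have hwa : EqTp L B (w ∘ Sum.inl) a := by
    refine (EqTp.of_imp fun X hX haX => ?_).symm
    refine (hw _ ((hX.mono hB).preimage_comp Sum.inl)).2 (Ultrafilter.of_le g ?_)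
    obtain ⟨k, rfl⟩ := (hf X).1 hX
    exact ⟨k, fun j hj => ⟨haX, fun h => hj (hv ⟨j, h⟩)⟩⟩
  obtain ⟨σ, hσ, hwσ, p, h⟩ := hP E hEM hEκ w hN
  have hdecM := h M Subset.rfl (hM.meetsDefinable S) (SNsp.refl S.reg M)
  have hp : ¬ p := by
    obtain ⟨_, hxσ, k, rfl⟩ := (Ultrafilter.of g).nonempty_of_mem
      (Filter.inter_mem ((hw σ hσ).1 hwσ) hrange')
    exact fun hp => hvP k ((hdecM _ hxσ (hvM k)).2 hp)
  obtain ⟨n, c, Y, hc, hY, rfl⟩ := definable_iff_fiber.1 hσ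
  obtain ⟨w', hw'M, hw'⟩ := hM.realize S (union_subset hB (range_subset_iff.2 hc))
    (mk_union_range_lt S.reg.aleph0_le hBκ c) w
  refine ⟨w' ∘ Sum.inl, fun i => hw'M _, ((hw'.mono subset_union_left).comp _).trans hwa,
    fun hall => hp ((hdecM w' ?_ hw'M).1 ?_)⟩
  · exact (hw' _ (definable_fiber (D := B ∪ range c) (fun i => Or.inr (mem_range_self i))
      (hY.mono (empty_subset _)))).2 hwσ
  · have := hall (w' ∘ Sum.inr) fun i => hw'M _
    rwa [Sum.elim_comp_inl_inr] at this

/-- The point `d` has a witness `y` in `M`, and the pair is decided over `M'` with value false.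
Extend the type of the pair over `M'` to `M` without splitting: by uniqueness its first part has the
type of `a` over `M`, so homogeneity turns the second part into a partner `b` of `a`. -/
theorem Setting.exists_mem_all (S : Setting L 𝔐 κbar κ lam) (hM : KSat L κ M) (hMl : #M ≤ lam)
    {M' : Set 𝔐} (hM' : KSat L κ M') (hM'M : M' ⊆ M) (hS : SNsp L κ M' M)
    (hP' : ∀ B ⊆ M', #B < κ → ∀ v, Nsp L M' B (range v) → Decided L κ M' P v)
    {B : Set 𝔐} (hB : B ⊆ M') (hBκ : #B < κ) (ha : Nsp L M B (range a)) {d : ι → 𝔐}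
    (hdM : ∀ i, d i ∈ M) (hda : EqTp L M' d a) (hd : d ∉ allFam P M) :
    ∃ b : Unit → 𝔐, (∃ B ⊆ M, #B < κ ∧ Nsp L M B (range (Sum.elim a b))) ∧
      ∃ τ : Set (ι ⊕ Unit → 𝔐), M.Definable L τ ∧ Sum.elim a b ∈ τ ∧
        ∀ d ∈ τ, (∀ i, d i ∈ M) → d ∉ P M := by
  simp only [allFam, mem_ofPred_eq, not_forall] at hd
  obtain ⟨y, hyM, hy⟩ := hd
  have hv : ∀ i, Sum.elim d y i ∈ M := by rintro (i | i); exacts [hdM i, hyM i]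
  obtain ⟨B1, hB1, hB1κ, hN⟩ := hS (range (Sum.elim d y)) (range_subset_iff.2 hv)
    ((finite_range _).lt_aleph0.trans_le S.reg.aleph0_le)
  obtain ⟨σ, hσ, hvσ, p, h⟩ := hP' B1 hB1 hB1κ _ hN
  have hdecM := h M hM'M (hM.meetsDefinable S) hS
  have hp : ¬ p := fun hp => hy ((hdecM _ hvσ hv).2 hp)
  obtain ⟨w, hw, hwN⟩ := hN.exists_extend S hM' hB1 hB1κ hM'M (hMl.trans_lt S.lt_bar)
  have hBB : #↑(B ∪ B1) < κ := (Cardinal.mk_union_le _ _).trans_lt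
    (Cardinal.add_lt_of_lt S.reg.aleph0_le hBκ hB1κ)
  have hwa : EqTp L M (w ∘ Sum.inl) a := by
    refine Nsp.unique S hM' (union_subset hB hB1) hBB hM'M
      (hwN.mono Subset.rfl subset_union_right (range_comp_subset_range _ _))
      (ha.mono Subset.rfl subset_union_left Subset.rfl) ?_
    exact (hw.comp Sum.inl).trans hda
  obtain ⟨b, hb⟩ := hwa.exists_extend S.sat S.aleph0_le_bar (hMl.trans_lt S.lt_bar) (w ∘ Sum.inr)
  rw [Sum.elim_comp_inl_inr] at hb
  refine ⟨b, ⟨B1, hB1.trans hM'M, hB1κ, hwN.congr hb⟩, σ, hσ.mono hM'M, ?_, fun d hd hdM hdP =>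
    hp ((hdecM d hd hdM).1 hdP)⟩
  exact ((hw.symm.trans (hb.mono hM'M)) σ hσ).1 hvσ

/-- If neither value is settled, then over each small set containing `B` the tuple `a` has copies in
`M` inside the universal set and copies outside it. Alternating them gives a Morley sequence, hence
an indiscernible one, on which an externally definable set alternates too often. -/
theorem Setting.decided_all (S : Setting L 𝔐 κbar κ lam) {C : Set 𝔐} {k : ℕ}
    (hg : Good L κ (k + 1) C M) (hMl : #M ≤ lam) (hext : ExtDef L M (allFam P M))
    (ih : ∀ M' ⊆ M, Good L κ k C M' → ∀ B ⊆ M', #B < κ → ∀ v, Nsp L M' B (range v) →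
      Decided L κ M' P v) {B : Set 𝔐} (hB : B ⊆ M) (hBκ : #B < κ) (ha : Nsp L M B (range a)) :
    Decided L κ M (allFam P) a := by
  classical
  have hM := hg.zero.1
  have hP := ih M Subset.rfl hg.pred
  by_contra hnot
  have hcon : ∀ τ : Set (ι → 𝔐), M.Definable L τ → a ∈ τ →
      ∃ d ∈ τ, (∀ i, d i ∈ M) ∧ d ∉ allFam P M := by
    intro τ hτ haτ
    by_contra! h
    exact hnot (.all_of_true S hM hP hτ haτ h)
  have hA : ¬ ∃ b : Unit → 𝔐, (∃ B ⊆ M, #B < κ ∧ Nsp L M B (range (Sum.elim a b))) ∧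
      ∃ τ : Set (ι ⊕ Unit → 𝔐), M.Definable L τ ∧ Sum.elim a b ∈ τ ∧
        ∀ d ∈ τ, (∀ i, d i ∈ M) → d ∉ P M := by
    rintro ⟨b, ⟨B', hB', hBκ', hN⟩, τ, hτ, hab, hτP⟩
    exact hnot (.all_of_false S hM (hP B' hB' hBκ' _ hN) hτ hab hτP)
  have hpos : ∀ e ⊆ M, B ⊆ e → #e < κ →
      ∃ d : ι → 𝔐, (∀ i, d i ∈ M) ∧ EqTp L e d a ∧ d ∈ allFam P M := by
    intro e he hBe heκ
    obtain ⟨M', hM'M, heM', hg', hS, hreal⟩ := hg.2 e he heκ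
    obtain ⟨n, ⟨f⟩⟩ := Finite.exists_equiv_fin ι
    obtain ⟨d, hdM, hda⟩ := hreal n (a ∘ f.symm)
      (ha.mono Subset.rfl hBe (range_comp_subset_range _ _))
    have hda' : EqTp L M' (d ∘ f) a := by
      have := hda.comp f
      rwa [Function.comp_assoc, f.symm_comp_self, Function.comp_id] at this
    refine ⟨d ∘ f, fun i => hdM _, hda'.mono heM', ?_⟩
    by_contra hd
    exact hA (S.exists_mem_all hM hMl hg'.zero.1 hM'M hS (ih M' hM'M hg') (hBe.trans heM') hBκ ha
      (fun i => hdM _) hda' hd)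
  obtain ⟨γ, hγ, X, hX, hXP⟩ := hext
  obtain ⟨K, hK⟩ := S.nip.exists_alternation_bound hX
  obtain ⟨d, hdM, hd⟩ := exists_seq_prev (M := M) (ι := ι)
    (Q := fun i e x => EqTp L (B ∪ e) x a ∧ (x ∈ allFam P M ↔ Even i)) (by
      intro i e he heM
      have heκ : #↑(B ∪ e) < κ := (Cardinal.mk_union_le _ _).trans_lt
        (Cardinal.add_lt_of_lt S.reg.aleph0_le hBκ (he.lt_aleph0.trans_le S.reg.aleph0_le))
      by_cases hi : Even i
      · obtain ⟨x, hx, hxa, hxP⟩ := hpos (B ∪ e) (union_subset hB heM) subset_union_left heκ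
        exact ⟨x, hx, hxa, iff_of_true hxP hi⟩
      · obtain ⟨x, hx, hxa, hxP⟩ := S.exists_notMem_all hM hMl hP hcon (union_subset hB heM) heκ
        exact ⟨x, hx, hxa, iff_of_false hxP hi⟩)
  obtain ⟨m, hm⟩ := hXP (d '' Iio K) ((finite_Iio K).image _) (by
    rintro _ ⟨i, -, rfl⟩ j
    exact hdM i j)
  refine hK d ((indisc_of_morley hB ha hdM fun i _ => (hd i).1).mono (empty_subset _)) m True
    fun i hi => ?_
  rw [← hm _ ⟨i, hi, rfl⟩, (hd i).2, true_iff]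

/-- Over a good set, traces of definable sets with quantifiers are decided by nonsplitting types. -/
theorem TraceFam.decided (S : Setting L 𝔐 κbar κ lam) {C : Set 𝔐} {k : ℕ} {ι : Type}
    {P : Set 𝔐 → Set (ι → 𝔐)} (hP : TraceFam L C k P) : Finite ι → ∀ M : Set 𝔐, Good L κ k C M →
      #M ≤ lam → ∀ B ⊆ M, #B < κ → ∀ a, Nsp L M B (range a) → Decided L κ M P a := by
  induction hP with
  | atom k hι hX =>
    intro _ M hg hMl B hB hBκ a ha
    exact S.decided_atom hMl hg.zero.2 hX hB hBκ ha
  | imp hι _ _ h1 h2 =>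
    intro _ M hg hMl B hB hBκ a ha
    exact (h1 hι M hg hMl B hB hBκ a ha).imp (h2 hι M hg hMl B hB hBκ a ha)
  | @all k ι hι P hP ih =>
    intro _ M hg hMl B hB hBκ a ha
    exact S.decided_all hg hMl ((TraceFam.all hι hP).extDef S.nip (hg.zero.1.meetsDefinable S))
      (fun M' hM' hg' => ih inferInstance M' hg' ((Cardinal.mk_le_mk_of_subset hM').trans hMl))
      hB hBκ ha
  | comp hι hκ f _ ih =>
    intro _ M hg hMl B hB hBκ a ha
    exact (ih hι M hg hMl B hB hBκ _
      (ha.mono Subset.rfl Subset.rfl (range_comp_subset_range _ _))).comp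

theorem TraceFam.mem_iff (S : Setting L 𝔐 κbar κ lam) {C : Set 𝔐} {k : ℕ} {ι : Type} [Finite ι]
    {P : Set 𝔐 → Set (ι → 𝔐)} (hP : TraceFam L C k P) {M M' : Set 𝔐} (hg : Good L κ k C M)
    (hMl : #M ≤ lam) (hMM : M ⊆ M') (hM' : L.MeetsDefinable M') (hS : SNsp L κ M M') {a : ι → 𝔐}
    (ha : ∀ i, a i ∈ M) : a ∈ P M ↔ a ∈ P M' := by
  obtain ⟨B, hB, hBκ, hN⟩ := SNsp.refl (L := L) S.reg M (range a) (range_subset_iff.2 ha)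
    ((finite_range _).lt_aleph0.trans_le S.reg.aleph0_le)
  obtain ⟨σ, -, haσ, p, h⟩ := hP.decided S inferInstance M hg hMl B hB hBκ a hN
  rw [h M Subset.rfl (hg.zero.1.meetsDefinable S) (SNsp.refl S.reg M) a haσ ha,
    h M' hMM hM' hS a haσ fun i => hMM (ha i)]

end TraceFam

end DependentThy

namespace DependentThy

open FirstOrder.Language Set

variable {L : FirstOrder.Language.{u, v}} {𝔐 : Type w} [L.Structure 𝔐]
variable {κbar κ lam : Cardinal.{w}}

/-! ### Reaching cardinality exactly λ -/

section Padding

theorem KSat.infinite [Infinite 𝔐] (hκ : ℵ₀ ≤ κ) {M : Set 𝔐} (hM : KSat L κ M) : M.Infinite := by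
  intro hfin
  obtain ⟨a, ha⟩ := hfin.infinite_compl.nonempty
  obtain ⟨a', ha', h⟩ := hM M Subset.rfl (hfin.lt_aleph0.trans_le hκ) a
  have := h.eq_of_mem fun _ => ha'
  exact ha (congrFun this () ▸ ha')

/-- A nonprincipal average of countably many distinct points of `D` lies outside `D` and does not
split over those points; κ is uncountable. -/
theorem Setting.exists_new (S : Setting L 𝔐 κbar κ lam) {D : Set 𝔐} (hD : #D ≤ lam)
    (hinf : D.Infinite) : ∃ a : Unit → 𝔐, a () ∉ D ∧ ∃ B ⊆ D, #B < κ ∧ Nsp L D B (range a) := by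
  let f := hinf.natEmbedding
  let g : ℕ → Unit → 𝔐 := fun n _ => f n
  obtain ⟨a, ha⟩ := exists_average S.sat S.aleph0_le_bar (hD.trans_lt S.lt_bar)
    ((Filter.hyperfilter ℕ).map g)
  refine ⟨a, fun haD => ?_, range fun n => (f n : 𝔐), range_subset_iff.2 fun n => (f n).2, ?_,
    Nsp.of_average ha ?_⟩
  · have h1 : D.Definable L {v : Unit → 𝔐 | v = a} := by
      refine ⟨(Term.var ()).equal (L.con (⟨a (), haD⟩ : D)).term, ?_⟩
      ext v
      simp only [mem_ofPred_eq, Formula.realize_equal, Term.realize_var, Term.realize_con]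
      exact ⟨fun h => congrFun h (), fun h => funext fun _ => h⟩
    have h2 := (ha _ h1).1 rfl
    have h3 : (g ⁻¹' {v | v = a}).Finite := by
      refine Set.Subsingleton.finite fun m hm n hn => ?_
      have : g m = g n := (show g m = a from hm).trans (show g n = a from hn).symm
      exact f.injective (Subtype.ext (congrFun this ()))
    exact Filter.notMem_hyperfilter_of_finite h3 h2
  · exact (countable_range _).le_aleph0.trans_lt S.aleph0_lt
  · exact Filter.mem_map.2 (Filter.univ_mem' fun n _ => ⟨n, rfl⟩)

/-- Every small set has a constructible extension of cardinality `lam`. -/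
theorem Setting.exists_con_mk_eq [Infinite 𝔐] (S : Setting L 𝔐 κbar κ lam) {A : Set 𝔐}
    (hA : #A ≤ lam) : ∃ D, A ⊆ D ∧ Con L κ A D ∧ #D = lam := by
  obtain ⟨M, hAM, hcon, hMl, hM⟩ := S.exists_kSat hA
  have hI : #lam.ord.ToType = lam := by simp
  obtain ⟨P, R, F, G, h1, h2, h3, -, h4, -⟩ := S.exists_chain (I := lam.ord.ToType) hI.le hMl
    (E0 := ∅) (by simp) (Q := fun _ D _ D' _ => ∃ a ∈ D', a ∉ D) (by
      intro i D E hD _ hDl hEl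
      obtain ⟨a, ha, B, hB, hBκ, hN⟩ := S.exists_new hDl ((hM.infinite S.reg.aleph0_le).mono hD)
      exact ⟨D ∪ range a, E, subset_union_left, Subset.rfl,
        Con.of_finite S.reg.aleph0_le hB hBκ hN, S.mk_union_range_le hDl a, hEl, a (),
        Or.inr (mem_range_self _), ha⟩)
  refine ⟨_, hAM.trans subset_union_left, hcon.trans h3, h4.antisymm ?_⟩
  choose a haF haP using fun i => (h1 i).2.2.2.2.2
  have hinj : Function.Injective a := by
    intro i j hij
    by_contra hne
    rcases lt_or_gt_of_ne hne with h | h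
    · exact haP j ((h2 i j h).1 (hij ▸ haF i))
    · exact haP i ((h2 j i h).1 (hij ▸ haF j))
  conv_lhs => rw [← hI]
  exact Cardinal.mk_le_of_injective (f := fun i => (⟨a i, Or.inr (mem_iUnion.2 ⟨i, haF i⟩)⟩ :
    ↑(M ∪ ⋃ i, F i))) fun i j hij => hinj (congrArg Subtype.val hij)

end Padding

/-! ### From finite tuples to reduced pairs -/

section Reduced

/-- Each formula in the type of `c` over `C` uses finitely many entries and, by uniqueness for
finite tuples and compactness, follows from a formula in the type over `M`. So every extension
contains that type, and equals it by consistency. -/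
theorem Setting.isReduced (S : Setting L 𝔐 κbar κ lam) {M N : Set 𝔐}
    (hred : ∀ (m : ℕ) (c : Fin m → 𝔐), (∀ i, c i ∈ N) → Red L κ M c) : IsReduced L κbar κ M N := by
  intro C hC hMC hle ι c _ hc
  have hS := (nspLE_iff_con.1 hle).sNsp S.reg
  refine ⟨tp L c C, ⟨⟨fun s hs => ⟨c, hs⟩, fun φ => em _⟩, ?_⟩, ?_⟩
  · intro φ hφ
    simp only [tp, mem_ofPred_eq, Formula.realize_relabel] at hφ ⊢
    convert hφ using 1
    funext z; rcases z with z | z <;> rfl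
  · rintro q ⟨⟨hfin, hcompl⟩, hext⟩
    have key : ∀ φ ∈ tp L c C, φ ∈ q := by
      intro φ hφ
      by_contra hnot
      have hneg := (hcompl φ).resolve_left hnot
      obtain ⟨n, f, ψ, hψ⟩ := exists_formula_finite_vars φ
      obtain ⟨χ, hχ, hcχ, hχψ⟩ := S.exists_definable_subset hMC hC (d := c ∘ f)
        (Z := {v | ψ.Realize (Sum.elim Subtype.val v)})
        (definable_iff_exists_formula_sum.2 ⟨ψ, rfl⟩) (by
          intro y hy
          have h1 := (hred n (c ∘ f) fun i => hc _).eqTp_of_sNsp S.reg.aleph0_le hS hy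
          exact (EqTp.iff_formula.1 h1 ψ).2 ((hψ c).2 hφ))
      obtain ⟨θ, rfl⟩ := definable_iff_exists_formula_sum.1 hχ
      have h1 : θ.relabel (Sum.map id f) ∈ tp L c M := by
        simp only [tp, mem_ofPred_eq, Formula.realize_relabel]
        convert hcχ using 1
        simp only [mem_ofPred_eq]
        congr!
        funext z; rcases z with z | z <;> rfl
      classical
      obtain ⟨d, hd⟩ := hfin {(θ.relabel (Sum.map id f)).relabel (Sum.map (inclusion hMC) id), φ.not}
        (by
          intro η hη
          rcases Finset.mem_insert.1 hη with rfl | hη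
          · exact hext _ h1
          · rwa [Finset.mem_singleton.1 hη])
      have h2 := hd _ (Finset.mem_insert_self _ _)
      have h3 := hd φ.not (by simp)
      simp only [tp, mem_ofPred_eq, Formula.realize_relabel, Formula.realize_not] at h2 h3
      refine h3 ((hψ d).1 (hχψ ?_))
      simp only [mem_ofPred_eq]
      convert h2 using 1
      funext z; rcases z with z | z <;> rfl
    refine Subset.antisymm (fun φ hφ => ?_) key
    by_contra hnot
    have hneg : φ.not ∈ q := key _ (by simpa [tp] using hnot)
    classical
    obtain ⟨d, hd⟩ := hfin {φ, φ.not} (by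
      intro η hη
      rcases Finset.mem_insert.1 hη with rfl | hη
      · exact hφ
      · rwa [Finset.mem_singleton.1 hη])
    have h2 := hd φ (by simp)
    have h3 := hd φ.not (by simp)
    simp only [tp, mem_ofPred_eq, Formula.realize_not] at h2 h3
    exact h3 h2

end Reduced

/-! ### Saturation of the resulting elementary substructures -/

section Saturated

/-- Elementary substructures satisfying the same types as the monster model over small sets are
saturated. -/
theorem Setting.isSaturated (S : Setting L 𝔐 κbar κ lam) (M : L.ElementarySubstructure 𝔐)
    (hM : KSat L κ (M : Set 𝔐)) : IsSaturated L M κ := by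
  intro A hA p ⟨hfin, hcompl⟩
  have hreal : ∀ (φ : L.Formula (A ⊕ Unit)) (c : Unit → M), φ ∈ tp L c A ↔
      φ.Realize (Sum.elim (fun a : A => ((a : M) : 𝔐)) (fun i => (c i : 𝔐))) := by
    intro φ c
    rw [tp, mem_ofPred_eq, ← M.subtype.map_formula, ElementarySubstructure.coe_subtype]
    congr!
    funext z; rcases z with z | z <;> rfl
  let B : Set 𝔐 := Subtype.val '' A
  have hBκ : #B < κ := Cardinal.mk_image_le.trans_lt hA
  have hBM : B ⊆ M := by rintro _ ⟨a, -, rfl⟩; exact a.2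
  have hdef : ∀ φ : L.Formula (A ⊕ Unit), B.Definable L {v : Unit → 𝔐 |
      φ.Realize (Sum.elim (fun a : A => ((a : M) : 𝔐)) v)} := by
    intro φ
    refine definable_iff_exists_formula_sum.2
      ⟨φ.relabel (Sum.map (fun a : A => ⟨((a : M) : 𝔐), mem_image_of_mem _ a.2⟩) id), ?_⟩
    ext v
    simp only [mem_ofPred_eq, Formula.realize_relabel]
    congr!
    funext z; rcases z with z | z <;> rfl
  obtain ⟨v, hv⟩ := exists_mem_of_fip S.sat S.aleph0_le_bar (D := B) (hBκ.trans_le S.le_bar)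
    (V := {X | ∃ φ ∈ p, X = {v : Unit → 𝔐 |
      φ.Realize (Sum.elim (fun a : A => ((a : M) : 𝔐)) v)}}) (by
      rintro _ ⟨φ, -, rfl⟩
      exact hdef φ) (by
      intro t ht htfin
      choose! g hg hgt using ht
      classical
      obtain ⟨c, hc⟩ := hfin (htfin.toFinset.image g) (by
        intro φ hφ
        obtain ⟨X, hX, rfl⟩ := Finset.mem_image.1 hφ
        exact hg (htfin.mem_toFinset.1 hX))
      refine ⟨fun i => c i, fun X hX => ?_⟩
      rw [hgt hX, mem_ofPred_eq, ← hreal]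
      exact hc _ (Finset.mem_image_of_mem _ (htfin.mem_toFinset.2 hX)))
  obtain ⟨a, haM, ha⟩ := hM.realize S hBM hBκ v
  have hsub : p ⊆ tp L (fun _ => ⟨a (), haM ()⟩) A := by
    intro φ hφ
    rw [hreal]
    exact (ha _ (hdef φ)).2 (hv _ ⟨φ, hφ, rfl⟩)
  refine ⟨⟨a (), haM ()⟩, hsub.antisymm fun φ hφ => ?_⟩
  refine (hcompl φ).resolve_right fun hnot => ?_
  have := hsub hnot
  simp only [tp, mem_ofPred_eq, Formula.realize_not] at this hφ
  exact this hφ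

end Saturated

end DependentThy

namespace DependentThy

open FirstOrder.Language Set

variable {L : FirstOrder.Language.{u, v}} {𝔐 : Type w} [L.Structure 𝔐]
variable {κbar κ lam : Cardinal.{w}}

/-! ### Formulas of the trace language -/

section Traces

theorem exists_term_of_traceLang {N : Set 𝔐} {β : Type} (t : (L.sum (traceLang L N)).Term β) :
    ∃ t' : L.Term β, ∀ (M : L.ElementarySubstructure 𝔐) (w : β → M),
      ((t.realize w : M) : 𝔐) = t'.realize fun i => (w i : 𝔐) := by
  induction t with
  | var i => exact ⟨Term.var i, fun _ _ => rfl⟩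
  | @func n f ts ih =>
    choose ts' hts' using ih
    rcases f with f | f
    · refine ⟨Term.func f ts', fun M w => ?_⟩
      simp only [Term.realize_func, ← hts']
      rfl
    · exact f.elim

theorem definable_trace_rel {N : Set 𝔐} {β : Type} {n : ℕ} (R : L.Formula (N ⊕ Fin n))
    (ts : Fin n → L.Term β) : N.Definable L {w : β → 𝔐 |
      R.Realize (Sum.elim (fun b : N => (b : 𝔐)) fun i => (ts i).realize w)} := by
  refine definable_iff_exists_formula_sum.2 ⟨BoundedFormula.subst R
    (Sum.elim (fun b => Term.var (Sum.inl b)) fun i => (ts i).relabel Sum.inr), ?_⟩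
  ext w
  simp only [mem_ofPred_eq, Formula.Realize, BoundedFormula.realize_subst]
  congr! 2 with z
  rcases z with z | z
  · rfl
  · simp [Term.realize_relabel]

/-- A formula uses finitely many parameters from `N`, so goodness against small subsets of `N` is
enough. The family depends on `M` only through its quantifiers, which range over `M`. -/
theorem exists_traceFam {N : Set 𝔐} {α : Type} [Finite α] {n : ℕ}
    (φ : (L.sum (traceLang L N)).BoundedFormula α n) :
    ∃ (C : Set 𝔐) (k : ℕ) (P : Set 𝔐 → Set (α ⊕ Fin n → 𝔐)), C ⊆ N ∧ C.Finite ∧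
      TraceFam L C k P ∧ ∀ (M : L.ElementarySubstructure 𝔐) (v : α → M) (xs : Fin n → M),
        φ.Realize v xs ↔ (fun z => ((Sum.elim v xs z : M) : 𝔐)) ∈ P M := by
  induction φ with
  | falsum => exact ⟨∅, 0, fun _ => ∅, empty_subset _, finite_empty,
      .atom 0 inferInstance definable_empty, fun M v xs => Iff.rfl⟩
  | equal t₁ t₂ =>
    obtain ⟨t₁', h₁⟩ := exists_term_of_traceLang t₁
    obtain ⟨t₂', h₂⟩ := exists_term_of_traceLang t₂
    refine ⟨∅, 0, fun _ => {w | t₁'.realize w = t₂'.realize w}, empty_subset _, finite_empty,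
      .atom 0 inferInstance ?_, fun M v xs => ?_⟩
    · refine empty_definable_iff.2 ⟨t₁'.equal t₂', ?_⟩
      ext w
      exact Formula.realize_equal.symm
    · rw [mem_ofPred_eq, ← h₁, ← h₂]
      exact Subtype.ext_iff
  | @rel n l R ts =>
    choose ts' hts' using fun i => exists_term_of_traceLang (ts i)
    rcases R with R | R
    · refine ⟨∅, 0, fun _ => {w | Structure.RelMap R fun i => (ts' i).realize w}, empty_subset _,
        finite_empty, .atom 0 inferInstance ?_, fun M v xs => ?_⟩
      · refine empty_definable_iff.2 ⟨R.formula ts', ?_⟩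
        ext w
        exact Formula.realize_rel.symm
      · simp only [mem_ofPred_eq, ← hts']
        rfl
    · obtain ⟨C, hC, hdef⟩ := definable_iff_finitely_definable.1 (definable_trace_rel R ts')
      refine ⟨C, 0, _, hC, C.finite_toSet, .atom 0 inferInstance hdef, fun M v xs => ?_⟩
      simp only [mem_ofPred_eq, ← hts']
      rfl
  | imp _ _ ih₁ ih₂ =>
    obtain ⟨C₁, k₁, P₁, hC₁, hf₁, hP₁, h₁⟩ := ih₁
    obtain ⟨C₂, k₂, P₂, hC₂, hf₂, hP₂, h₂⟩ := ih₂
    refine ⟨C₁ ∪ C₂, max k₁ k₂, _, union_subset hC₁ hC₂, hf₁.union hf₂,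
      .imp inferInstance (hP₁.mono subset_union_left (le_max_left _ _))
        (hP₂.mono subset_union_right (le_max_right _ _)), fun M v xs => ?_⟩
    rw [BoundedFormula.realize_imp, h₁, h₂, mem_union, mem_compl_iff, imp_iff_not_or]
  | @all n _ ih =>
    obtain ⟨C, k, P, hC, hf, hP, h⟩ := ih
    -- The last bound variable becomes the `Unit` coordinate over which the family quantifies.
    let f : α ⊕ Fin (n + 1) → (α ⊕ Fin n) ⊕ Unit :=
      Sum.elim (fun i => Sum.inl (Sum.inl i))
        (Fin.lastCases (Sum.inr ()) fun i => Sum.inl (Sum.inr i))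
    refine ⟨C, k + 1, _, hC, hf, .all inferInstance (.comp inferInstance inferInstance f hP),
      fun M v xs => ?_⟩
    have key : ∀ y : M, (Sum.elim (fun z => ((Sum.elim v xs z : M) : 𝔐))
        (fun _ : Unit => (y : 𝔐))) ∘ f = fun z => ((Sum.elim v (Fin.snoc xs y) z : M) : 𝔐) := by
      intro y
      funext z
      rcases z with z | z
      · rfl
      · refine Fin.lastCases ?_ (fun i => ?_) z <;> simp [f]
    rw [BoundedFormula.realize_all]
    simp only [mem_ofPred_eq]
    constructor
    · intro hall y hy
      have := (h M v _).1 (hall ⟨y (), hy ()⟩)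
      rw [← key] at this
      exact this
    · intro hall y
      rw [h, ← key]
      exact hall (fun _ => y) fun _ => y.2

theorem Setting.traceElementary (S : Setting L 𝔐 κbar κ lam) {N : Set 𝔐}
    {M M' : L.ElementarySubstructure 𝔐} (hMl : #M ≤ lam)
    (hg : ∀ C ⊆ N, #C < κ → ∀ k, Good L κ k C (M : Set 𝔐)) (hMM' : (M : Set 𝔐) ⊆ M')
    (hS : SNsp L κ (M : Set 𝔐) M') : TraceElementary L N M M' := by
  refine ⟨⟨fun y => ⟨y, hMM' y.2⟩, fun n φ x => ?_⟩, fun _ => rfl⟩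
  obtain ⟨C, k, P, hC, hf, hP, h⟩ := exists_traceFam φ
  rw [Formula.Realize, Formula.Realize, h, h]
  have := hP.mem_iff S (hg C hC (hf.lt_aleph0.trans_le S.reg.aleph0_le) k) hMl hMM'
    M'.meetsDefinable hS (a := fun z => ((Sum.elim x default z : M) : 𝔐)) fun z => Subtype.prop _
  rw [this]
  refine iff_of_eq (congrArg (· ∈ P M') (funext fun z => ?_))
  rcases z with z | z
  · rfl
  · exact z.elim0

end Traces

theorem Setting.exists_nice (S : Setting L 𝔐 κbar κ lam) [Infinite 𝔐] {A A' : Set 𝔐} (hA : A ⊆ A')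
    (hA' : #A' ≤ lam) : ∃ M : L.ElementarySubstructure 𝔐,
      (#M = lam ∧ NspLE L κ A (M : Set 𝔐) ∧ IsReduced L κbar κ (M : Set 𝔐) A') ∧
      ∃ N : L.ElementarySubstructure 𝔐,
        #N < κbar ∧ IsNice L κbar κ M N ∧ A' ⊆ (N : Set 𝔐) := by
  -- Padding `A` to cardinality λ beforehand makes the cardinality of `M` exactly λ.
  obtain ⟨D, -, hAD, hDl⟩ := S.exists_con_mk_eq ((Cardinal.mk_le_mk_of_subset hA).trans hA')
  obtain ⟨M, N, hDM, hA'N, hMN, hcon, hMl, hNl, hN, hg⟩ := S.exists_good_pair hDl.le hA'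
  have hM : KSat L κ M := (hg ∅ (empty_subset _) (by simpa using S.reg.pos) 0).zero.1
  have hMs := hM.meetsDefinable S
  have hNs := hN.meetsDefinable S
  have hMc : (hMs.toElementarySubstructure : Set 𝔐) = M := hMs.closure_eq_self
  have hNc : (hNs.toElementarySubstructure : Set 𝔐) = N := hNs.closure_eq_self
  have hred : ∀ (m : ℕ) (c : Fin m → 𝔐), (∀ i, c i ∈ N) → Red L κ M c := fun m c hc =>
    (hg (range c) (range_subset_iff.2 hc) ((finite_range c).lt_aleph0.trans_le S.reg.aleph0_le)
      0).zero.2 m c fun i => mem_range_self i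
  have hMcard : #hMs.toElementarySubstructure = #M := congrArg (fun s : Set 𝔐 => #s) hMc
  have hNcard : #hNs.toElementarySubstructure = #N := congrArg (fun s : Set 𝔐 => #s) hNc
  refine ⟨hMs.toElementarySubstructure, ⟨?_, ?_, ?_⟩, hNs.toElementarySubstructure, ?_, ⟨?_, ?_, ?_, ?_, ?_⟩, ?_⟩
  · rw [hMcard]
    exact hMl.antisymm (hDl.ge.trans (Cardinal.mk_le_mk_of_subset hDM))
  · rw [nspLE_iff_con, hMc]
    exact hAD.trans hcon
  · rw [hMc]
    exact S.isReduced fun m c hc => hred m c fun i => hA'N (hc i)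
  · rw [hNcard]
    exact hNl.trans_lt S.lt_bar
  · rw [hMc, hNc]
    exact S.isReduced hred
  · rw [← SetLike.coe_subset_coe, hMc, hNc]
    exact hMN
  · exact S.isSaturated _ (by rwa [hMc])
  · exact S.isSaturated _ (by rwa [hNc])
  · intro M' _ hle
    rw [nspLE_iff_con] at hle
    refine S.traceElementary (hMcard.le.trans hMl) ?_ hle.subset (hle.sNsp S.reg)
    rw [hMc, hNc]
    exact hg
  · rw [hNc]
    exact hA'N

end DependentThy

theorem theorem1 {L : FirstOrder.Language.{u, v}} (T : L.Theory) (hT : T.IsComplete)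
    (hdep : DependentThy.IsDependent T)
    {𝔐 : Type w} [L.Structure 𝔐] [𝔐 ⊨ T] [Infinite 𝔐]
    (κbar : Cardinal.{w}) (hsat : DependentThy.IsSaturated L 𝔐 κbar)
    (κ lam : Cardinal.{w}) (hκ : κ.IsRegular)
    (hTκ : Cardinal.lift.{w} (max ℵ₀ L.card) < Cardinal.lift.{max u v} κ)
    (hlam : ℵ₀ ≤ lam) (hpow : ∀ θ : Cardinal.{w}, θ ≠ 0 → θ < κ → lam = lam ^ θ)
    (hbar : lam < κbar)
    (A A' : Set 𝔐) (hA : A ⊆ A') (hA' : #A' ≤ lam) :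
    ∃ M : L.ElementarySubstructure 𝔐,
      (#M = lam ∧ DependentThy.NspLE L κ A (M : Set 𝔐) ∧
        DependentThy.IsReduced L κbar κ (M : Set 𝔐) A') ∧
      ∃ N : L.ElementarySubstructure 𝔐,
        #N < κbar ∧ DependentThy.IsNice L κbar κ M N ∧ A' ⊆ (N : Set 𝔐) := by
  have S : DependentThy.Setting L 𝔐 κbar κ lam :=
    ⟨hsat, hdep.nip, hκ, hTκ, hlam, hpow, hbar⟩
  exact S.exists_nice hA hA'
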